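/- **Notation.** Write $\mathbb D=\{x:\|x\|\le 1\}$ for the closed Euclidean unit ball (of $\mathbb R^n$ or $\mathbb R^{2n}$), $A_*=A\setminus\{0\}$, and $\ln^-x=\max(0,-\ln x)$. $X\sim L^n(m,S,\nu)$ means that $X$ is an $n$-dimensional Lévy process (with càdlàg paths) with characteristic triplet $(m,S,\nu)$, i.e. $E e^{i\langle\theta,X(t)\rangle}=e^{t\Psi(\theta)}$ with $$\Psi(\theta)=i\langle m,\theta\rangle-\tfrac12\,\theta S\theta'+\int_{\mathbb R^n_*}\big(e^{i\langle\theta,x\rangle}-1-i\langle\theta,x\rangle 1_{\mathbb D}(x)\big)\,\nu(dx);$$ $\nu$ is called its Lévy measure, and Brownian motion is $BM^n(\mu,\Sigma)=L^n(\mu,\Sigma,0)$. If $\int_{\mathbb D_*}\|x\|\,\nu(dx)<\infty$, the *drift* of $X$ is $m-\int_{\mathbb D_*}x\,\nu(dx)$. $X$ is an $FV^n$-process if almost all of its paths are of locally finite variation; it is *drift-less* if its drift is $0$. A subordinator is a Lévy process with nondecreasing components. For $t\in[0,\infty)^n$ put $t\diamond\mu=(t_1\mu_1,\dots,t_n\mu_n)$,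 $(t\diamond\Sigma)_{kl}=\Sigma_{kl}\min(t_k,t_l)$, and $B(t)=(B_1(t_1),\dots,B_n(t_n))$. A *Thorin measure* is a Borel measure $\mathcal U$ on $[0,\infty)^n_*$ with $\int \min\{1+\ln^-\|u\|,\,1/\|u\|\}\,\mathcal U(du)<\infty$. For $d\in[0,\infty)^n$, a *Thorin subordinator* $T\sim GGC^n_S(d,\mathcal U)$ is a subordinator with $$-\ln E e^{-\langle\lambda,T(t)\rangle}=t\langle d,\lambda\rangle+t\int_{[0,\infty)^n_*}\ln\frac{\|u\|^2+\langle\lambda,u\rangle}{\|u\|^2}\,\mathcal U(du),\qquad t\ge0,\ \lambda\in[0,\infty)^n.$$ Let $T$ be a subordinator with drift $d$ and Lévy measure $\mathcal T$, and let $B\sim BM^n(\mu,\Sigma)$. The law of $(T,B\odot T)$ (weak subordination) is that of the $2n$-dimensional Lévy process $Z=(Z_1,Z_2)\sim L^{2n}((m_1,m_2),\Theta,\mathcal Z)$ with $$m_1=d+\int_{[0,\infty)^n_*} t\,P\big((t,B(t))\in\mathbb D\big)\,\mathcal T(dt),\qquad m_2=d\diamond\mu+\int_{[0,\infty)^n_*}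 E\big[B(t)1_{\mathbb D}(t,B(t))\big]\,\mathcal T(dt),$$ $$\Theta=\begin{pmatrix}0&0\\0&d\diamond\Sigma\end{pmatrix},\qquad \mathcal Z(dt,dx)=1_{[0,\infty)^n_*\times\mathbb R^n}\,P(B(t)\in dx)\,\mathcal T(dt).$$ A Lévy process $Y$ is a (weak) $VGG^n(d,\mu,\Sigma,\mathcal U)$-process if it is equal in law to $B\odot T$, i.e. to the second component $Z_2$, for some $B\sim BM^n(\mu,\Sigma)$ and $T\sim GGC^n_S(d,\mathcal U)$. **Proposition.** Let $d\in[0,\infty)^n$, $\mu\in\mathbb R^n$, let $\Sigma\in\mathbb R^{n\times n}$ be a covariance matrix and $\mathcal U$ an $n$-dimensional Thorin measure. Let $T\sim GGC^n_S(d,\mathcal U)$ and $Y\sim VGG^n(d,\mu,\Sigma,\mathcal U)$, with Lévy measures $\mathcal T$ and $\mathcal Y$, respectively. Suppose $0<q<1$. (i) $\int_{\mathbb D^C}\|u\|^{-q}\,\mathcal U(du)<\infty$ if and only if $\int_{\mathbb D_*}\|t\|^q\,\mathcal T(dt)<\infty$. (ii) If $\int_{\mathbb D^C}\|u\|^{-q}\,\mathcal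 U(du)<\infty$, then $\int_{\mathbb D_*}\|y\|^{2q}\,\mathcal Y(dy)<\infty$. If $\Sigma$ is invertible, the converse also holds. (iii) If $d=0$ and $\int_{\mathbb D^C}\|u\|^{-1/2}\,\mathcal U(du)<\infty$, then $Y$ is a drift-less $FV^n$-process. If, in addition, $\Sigma$ is invertible, then conversely: if $Y$ is an $FV^n$-process, then $d=0$ and $\int_{\mathbb D^C}\|u\|^{-1/2}\,\mathcal U(du)<\infty$ (this converse does not presuppose $d=0$). -/

import Mathlib

open MeasureTheory ProbabilityTheory Filter Topology Set
open scoped NNReal ENNReal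

universe w

noncomputable section

namespace WeakSub

/-! ### Lévy processes and their characteristic triplets -/

section Levy

variable {ι : Type*} [Fintype ι] {Ω : Type*} [MeasurableSpace Ω]

/-- A Lévy process: starts at `0`, has independent and stationary increments, is continuous in
probability, and has càdlàg paths (almost surely). -/
structure IsLevyProcess (P : Measure Ω) (X : ℝ≥0 → Ω → EuclideanSpace ℝ ι) : Prop where
  measurable : ∀ t, Measurable (X t)
  zero : ∀ᵐ ω ∂P, X 0 ω = 0
  indep : HasIndepIncrements X P
  stationary : ∀ s t : ℝ≥0, IdentDistrib (fun ω => X (s + t) ω - X s ω) (X t) P P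
  continuous_prob : ∀ t : ℝ≥0, TendstoInMeasure P X (𝓝 t) (X t)
  cadlag : ∀ᵐ ω ∂P, ∀ t : ℝ≥0,
    ContinuousWithinAt (fun s => X s ω) (Ici t) t ∧
      ∃ l, Tendsto (fun s => X s ω) (𝓝[<] t) (𝓝 l)

/-- A Lévy measure. A Borel measure on `ℝ^ι ∖ {0}` is encoded as a measure on `ℝ^ι` which does
not charge the origin. -/
def IsLevyMeasure (ν : Measure (EuclideanSpace ℝ ι)) : Prop :=
  ν {0} = 0 ∧ ∫⁻ x, ENNReal.ofReal (min (‖x‖ ^ 2) 1) ∂ν < ∞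

/-- `|θ|²_S = θ S θ'`. -/
def quadForm (S : Matrix ι ι ℝ) (θ : EuclideanSpace ℝ ι) : ℝ :=
  ∑ k, ∑ l, θ k * S k l * θ l

open scoped Classical in
/-- The Lévy-Khintchine exponent of the triplet `(m, S, ν)`, with truncation at the closed
Euclidean unit ball. -/
def levyExponent (m : EuclideanSpace ℝ ι) (S : Matrix ι ι ℝ) (ν : Measure (EuclideanSpace ℝ ι))
    (θ : EuclideanSpace ℝ ι) : ℂ :=
  Complex.I * (inner ℝ m θ : ℝ) - (1 / 2 : ℂ) * (quadForm S θ : ℝ) +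
    ∫ x, (Complex.exp (Complex.I * (inner ℝ θ x : ℝ)) - 1 -
      (if ‖x‖ ≤ 1 then Complex.I * (inner ℝ θ x : ℝ) else 0)) ∂ν

/-- `X ∼ L(m, S, ν)`: `X` is a Lévy process with characteristic triplet `(m, S, ν)`. -/
structure IsLevy (P : Measure Ω) (X : ℝ≥0 → Ω → EuclideanSpace ℝ ι)
    (m : EuclideanSpace ℝ ι) (S : Matrix ι ι ℝ) (ν : Measure (EuclideanSpace ℝ ι)) : Prop where
  isLevyProcess : IsLevyProcess P X
  covariance : S.PosSemidef
  levyMeasure : IsLevyMeasure ν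
  charFun_eq : ∀ (t : ℝ≥0) (θ : EuclideanSpace ℝ ι),
    charFun (P.map (X t)) θ = Complex.exp ((t : ℝ) * levyExponent m S ν θ)

/-- `ν` is the Lévy measure of the Lévy process `X`. -/
def HasLevyMeasure (P : Measure Ω) (X : ℝ≥0 → Ω → EuclideanSpace ℝ ι)
    (ν : Measure (EuclideanSpace ℝ ι)) : Prop :=
  ∃ m S, IsLevy P X m S ν

/-- `X ∼ BM(μ, S)`: Brownian motion with drift `μ` and covariance matrix `S`. -/
def IsBrownianMotion (P : Measure Ω) (X : ℝ≥0 → Ω → EuclideanSpace ℝ ι)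
    (μ : EuclideanSpace ℝ ι) (S : Matrix ι ι ℝ) : Prop :=
  IsLevy P X μ S 0

/-- The punctured closed Euclidean unit ball. -/
def puncturedBall (ι : Type*) [Fintype ι] : Set (EuclideanSpace ℝ ι) :=
  Metric.closedBall 0 1 \ {0}

/-- `X` has drift `d` after removing the compensation of small jumps: for some triplet `(m, S, ν)`
of `X` the small jumps are summable and `d = m - ∫_{0 < ‖x‖ ≤ 1} x ν(dx)`. -/
def HasDrift (P : Measure Ω) (X : ℝ≥0 → Ω → EuclideanSpace ℝ ι)
    (d : EuclideanSpace ℝ ι) (ν : Measure (EuclideanSpace ℝ ι)) : Prop :=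
  ∃ m S, IsLevy P X m S ν ∧ IntegrableOn (fun x => x) (puncturedBall ι) ν ∧
    d = m - ∫ x in puncturedBall ι, x ∂ν

/-- Almost all paths of `X` are of locally finite variation. -/
def HasFiniteVariationPaths (P : Measure Ω) (X : ℝ≥0 → Ω → EuclideanSpace ℝ ι) : Prop :=
  ∀ᵐ ω ∂P, LocallyBoundedVariationOn (fun t => X t ω) univ

/-- `X ∼ FV(d, ν)`: a Lévy process with paths of locally finite variation, drift `d` and
Lévy measure `ν`. -/
def IsFV (P : Measure Ω) (X : ℝ≥0 → Ω → EuclideanSpace ℝ ι)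
    (d : EuclideanSpace ℝ ι) (ν : Measure (EuclideanSpace ℝ ι)) : Prop :=
  HasFiniteVariationPaths P X ∧ HasDrift P X d ν

/-- A subordinator: a Lévy process with nondecreasing components. -/
def IsSubordinator (P : Measure Ω) (T : ℝ≥0 → Ω → EuclideanSpace ℝ ι) : Prop :=
  IsLevyProcess P T ∧ ∀ᵐ ω ∂P, ∀ i, Monotone (fun t => T t ω i)

/-- `T ∼ S(d, τ)`: a subordinator with drift `d` and Lévy measure `τ`. -/
def IsSubordinatorWith (P : Measure Ω) (T : ℝ≥0 → Ω → EuclideanSpace ℝ ι)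
    (d : EuclideanSpace ℝ ι) (τ : Measure (EuclideanSpace ℝ ι)) : Prop :=
  IsSubordinator P T ∧ (∀ i, 0 ≤ d i) ∧ HasDrift P T d τ

/-- The punctured nonnegative orthant `[0,∞)^ι ∖ {0}`. -/
def puncturedOrthant (ι : Type*) [Fintype ι] : Set (EuclideanSpace ℝ ι) :=
  {u | (∀ i, 0 ≤ u i) ∧ u ≠ 0}

/-- A Thorin measure: a measure carried by the punctured nonnegative orthant such that
`(1 + ln⁻ ‖u‖) ∧ (1 / ‖u‖)` is integrable. Here `ln⁻ x = max 0 (-ln x)`. -/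
def IsThorinMeasure (U : Measure (EuclideanSpace ℝ ι)) : Prop :=
  U (puncturedOrthant ι)ᶜ = 0 ∧
    ∫⁻ u, ENNReal.ofReal (min (1 + max 0 (-Real.log ‖u‖)) (1 / ‖u‖)) ∂U < ∞

/-- `T ∼ GGC_S(d, U)`: a Thorin subordinator, specified by its Laplace transform. -/
structure IsThorinSubordinator (P : Measure Ω) (T : ℝ≥0 → Ω → EuclideanSpace ℝ ι)
    (d : EuclideanSpace ℝ ι) (U : Measure (EuclideanSpace ℝ ι)) : Prop where
  subordinator : IsSubordinator P T
  drift_nonneg : ∀ i, 0 ≤ d i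
  thorin : IsThorinMeasure U
  laplace : ∀ (t : ℝ≥0) (l : EuclideanSpace ℝ ι), (∀ i, 0 ≤ l i) →
    -Real.log (∫ ω, Real.exp (-(inner ℝ l (T t ω))) ∂P) =
      t * inner ℝ d l +
        t * ∫ u, Real.log ((‖u‖ ^ 2 + inner ℝ l u) / ‖u‖ ^ 2) ∂U

/-- `t ⋄ μ = (t₁ μ₁, …, tₙ μₙ)`. -/
def diamondVec (t μ : EuclideanSpace ℝ ι) : EuclideanSpace ℝ ι :=
  WithLp.toLp 2 fun i => t i * μ i

/-- `(t ⋄ S)ₖₗ = Sₖₗ (tₖ ∧ tₗ)`. -/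
def diamondMat (t : EuclideanSpace ℝ ι) (S : Matrix ι ι ℝ) : Matrix ι ι ℝ :=
  Matrix.of fun k l => S k l * min (t k) (t l)

/-- The process evaluated at a multivariate time point: `B(t) = (B₁(t₁), …, Bₙ(tₙ))`
(meaningful for `t` in the nonnegative orthant). -/
def multiTime (B : ℝ≥0 → Ω → EuclideanSpace ℝ ι) (t : EuclideanSpace ℝ ι) (ω : Ω) :
    EuclideanSpace ℝ ι :=
  WithLp.toLp 2 fun i => B (t i).toNNReal ω i

/-- The vector `(t, x)` of `ℝ^{2n}`, with its Euclidean norm. -/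
def pair (t x : EuclideanSpace ℝ ι) : EuclideanSpace ℝ (ι ⊕ ι) :=
  WithLp.toLp 2 (Sum.elim (fun i => t i) (fun i => x i))

/-- The second component `Z₂` of a process `Z = (Z₁, Z₂)` in `ℝ^{2n}`. -/
def second (Z : ℝ≥0 → Ω → EuclideanSpace ℝ (ι ⊕ ι)) (t : ℝ≥0) (ω : Ω) : EuclideanSpace ℝ ι :=
  WithLp.toLp 2 fun i => Z t ω (Sum.inr i)

end Levy

/-! ### Weak subordination of Brownian motion -/

section Subordination

variable {ι : Type*} [Fintype ι]
  {ΩB : Type*} [MeasurableSpace ΩB] {ΩZ : Type*} [MeasurableSpace ΩZ]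
  {ΩT : Type*} [MeasurableSpace ΩT]

/-- First half of the location parameter of `(T, B ⊙ T)`:
`d + ∫ t P((t, B(t)) ∈ 𝔻) τ(dt)`. -/
def weakMean₁ (PB : Measure ΩB) (B : ℝ≥0 → ΩB → EuclideanSpace ℝ ι)
    (d : EuclideanSpace ℝ ι) (τ : Measure (EuclideanSpace ℝ ι)) : EuclideanSpace ℝ ι :=
  d + ∫ t in puncturedOrthant ι, PB.real {ω | ‖pair t (multiTime B t ω)‖ ≤ 1} • t ∂τ

/-- Second half of the location parameter of `(T, B ⊙ T)`:
`d ⋄ μ + ∫ E[B(t) 1_𝔻(t, B(t))] τ(dt)`. -/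
def weakMean₂ (PB : Measure ΩB) (B : ℝ≥0 → ΩB → EuclideanSpace ℝ ι)
    (μ d : EuclideanSpace ℝ ι) (τ : Measure (EuclideanSpace ℝ ι)) : EuclideanSpace ℝ ι :=
  diamondVec d μ + ∫ t in puncturedOrthant ι,
    (∫ ω in {ω | ‖pair t (multiTime B t ω)‖ ≤ 1}, multiTime B t ω ∂PB) ∂τ

/-- `Z` is equal in law to `(T, B ⊙ T)`: the subordinator `T` subordinating the Brownian motion
`B ∼ BM(μ, S)` in the weak sense. Here `T ∼ S(d, τ)`, and `Z` is the Lévy process in `ℝ^{2n}` with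
Gaussian covariance `diag(0, d ⋄ S)` and Lévy measure `P(B(t) ∈ dx) τ(dt)`. (The terms of weak
subordination that come from the Lévy measure of the subordinate vanish for Brownian motion.) -/
def IsWeakSubordination (PZ : Measure ΩZ) (Z : ℝ≥0 → ΩZ → EuclideanSpace ℝ (ι ⊕ ι))
    (PT : Measure ΩT) (T : ℝ≥0 → ΩT → EuclideanSpace ℝ ι)
    (PB : Measure ΩB) (B : ℝ≥0 → ΩB → EuclideanSpace ℝ ι)
    (μ : EuclideanSpace ℝ ι) (S : Matrix ι ι ℝ) : Prop :=
  IsBrownianMotion PB B μ S ∧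
  ∃ (d : EuclideanSpace ℝ ι) (τ : Measure (EuclideanSpace ℝ ι)),
    IsSubordinatorWith PT T d τ ∧
    ∃ ζ : Measure (EuclideanSpace ℝ (ι ⊕ ι)),
      (∀ A, MeasurableSet A → ζ A =
        ∫⁻ t in puncturedOrthant ι, PB {ω | pair t (multiTime B t ω) ∈ A} ∂τ) ∧
      IsLevy PZ Z (pair (weakMean₁ PB B d τ) (weakMean₂ PB B μ d τ))
        (Matrix.fromBlocks 0 0 0 (diamondMat d S)) ζ

end Subordination

/-- `Y ∼ VGG(d, μ, S, U)`: a Lévy process equal in law (as a process) to `B ⊙ T`, the second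
component of `(T, B ⊙ T)`, with `B ∼ BM(μ, S)` and `T ∼ GGC_S(d, U)`. -/
def IsVGG {ι : Type*} [Fintype ι] {Ω : Type*} [MeasurableSpace Ω]
    (P : Measure Ω) (Y : ℝ≥0 → Ω → EuclideanSpace ℝ ι)
    (d μ : EuclideanSpace ℝ ι) (S : Matrix ι ι ℝ) (U : Measure (EuclideanSpace ℝ ι)) : Prop :=
  IsLevyProcess P Y ∧
  ∃ (ΩB ΩT ΩZ : Type w) (_ : MeasurableSpace ΩB) (_ : MeasurableSpace ΩT)
    (_ : MeasurableSpace ΩZ)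
    (PB : Measure ΩB) (PT : Measure ΩT) (PZ : Measure ΩZ)
    (B : ℝ≥0 → ΩB → EuclideanSpace ℝ ι) (T : ℝ≥0 → ΩT → EuclideanSpace ℝ ι)
    (Z : ℝ≥0 → ΩZ → EuclideanSpace ℝ (ι ⊕ ι)),
    IsProbabilityMeasure PB ∧ IsProbabilityMeasure PT ∧ IsProbabilityMeasure PZ ∧
    IsThorinSubordinator PT T d U ∧
    IsWeakSubordination PZ Z PT T PB B μ S ∧
    IdentDistrib (fun ω t => Y t ω) (fun ω t => second Z t ω) P PZ

/-- Finiteness of `∫_{‖u‖ > 1} U(du) / ‖u‖ ^ q`. -/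
def ThorinTailFinite {ι : Type*} [Fintype ι] (U : Measure (EuclideanSpace ℝ ι)) (q : ℝ) : Prop :=
  ∫⁻ u in (Metric.closedBall 0 1)ᶜ, ENNReal.ofReal (1 / ‖u‖ ^ q) ∂U < ∞

/-- Finiteness of `∫_{0 < ‖x‖ ≤ 1} ‖x‖ ^ p ν(dx)`. -/
def SmallJumpsFinite {ι : Type*} [Fintype ι] (ν : Measure (EuclideanSpace ℝ ι)) (p : ℝ) : Prop :=
  ∫⁻ x in puncturedBall ι, ENNReal.ofReal (‖x‖ ^ p) ∂ν < ∞

end WeakSub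

end

/-! Everything reduces to one description of the jumps of `T`. By Frullani, `∫ (1 - e^{-ar})
e^{-r}/r dr = ln (1 + a)`. Taking `a = ⟨λ,u⟩/‖u‖²` shows that the Laplace exponent of `T` is that of
a subordinator with drift `d` whose Lévy measure is the image of `𝒰(du) ⊗ e^{-r}/r dr` under `(u, r)
↦ r u/‖u‖²` (`thorinLevyMeasure`). Analytic continuation of Laplace transforms
(`charFun_of_laplace`) and uniqueness of the triplet (`levyMeasure_unique`, `quadForm_unique`,
`location_unique`) show that this measure is `𝒯`.

For (i), the jump `r u/‖u‖²` has norm `r/‖u‖`, so `∫_{𝔻*} ‖t‖^q 𝒯(dt)` is the `𝒰`-integral of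
`‖u‖^{-q} ∫_0^{‖u‖} r^{q-1} e^{-r} dr`. The integrand is bounded for `‖u‖ ≤ 1`, where `𝒰` has finite
mass, and comparable to `‖u‖^{-q}` for `‖u‖ > 1` (`thorinTailFinite_iff`).

For (ii), the triplet of `Y` is read off the last block of `Z` (`IsVGG.exists_mixture`), and the
small jumps of `Y` contribute `∫ E[‖B(t)‖^{2q}; ‖B(t)‖ ≤ 1] 𝒯(dt)`. The inner expectation is at most
a multiple of `‖t‖^q`, because `E ‖B(t)‖² ≤ C ‖t‖` for `‖t‖ ≤ 1`. If `Σ` is invertible it is also at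
least a multiple of `‖t‖^q` for small `t`: the coordinate with the largest time is of order
`‖t‖^{1/2}` with probability bounded below. So (ii) reduces to (i).

For (iii), a Lévy process has paths of locally finite variation exactly when it has no Gaussian part
and `‖x‖ ∧ 1` is integrable for its Lévy measure. Both directions are proved coordinatewise, from
the variation along dyadic grids. Independence turns the Laplace transform of a grid variation into
a power of `E e^{-l|X(h)|}`. Since `e^{-|x|}` is the characteristic function of the Cauchy law, `1 -
E e^{-l|X(h)|}` is the Cauchy average of `1 - Re E e^{islX(h)}`, which the Lévy exponent controls.
Fatou's lemma as the mesh shrinks gives both implications (`ae_bddAbove_gridSum`,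
`lintegral_re_exponent_lt_top`). With `q = 1/2`, part (ii) turns summability of the jumps into the
Thorin tail condition. The Gaussian part `d ⋄ Σ` vanishes for `d = 0`, and when `Σ` has positive
diagonal it vanishes only then. -/

noncomputable section

namespace WeakSub

/-! ### Uniqueness of the characteristic triplet -/

section LevyKhintchine

variable {ι : Type*} [Fintype ι]

/-- The integrand in the Lévy-Khintchine formula. -/
def levyIntegrand (θ x : EuclideanSpace ℝ ι) : ℂ :=
  Complex.exp (Complex.I * (inner ℝ θ x : ℝ)) - 1 -
    (if ‖x‖ ≤ 1 then Complex.I * (inner ℝ θ x : ℝ) else 0)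

lemma levyExponent_eq (m : EuclideanSpace ℝ ι) (S : Matrix ι ι ℝ)
    (ν : Measure (EuclideanSpace ℝ ι)) (θ : EuclideanSpace ℝ ι) :
    levyExponent m S ν θ = Complex.I * (inner ℝ m θ : ℝ) - (1 / 2 : ℂ) * (quadForm S θ : ℝ) +
      ∫ x, levyIntegrand θ x ∂ν := rfl

lemma norm_cexp_I_sub_one_sub_le (y : ℝ) :
    ‖Complex.exp (Complex.I * y) - 1 - Complex.I * y‖ ≤ 3 * y ^ 2 := by
  rcases le_or_gt |y| 1 with h | h
  · have := Complex.norm_exp_sub_one_sub_id_le (x := Complex.I * y) (by simpa using h)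
    simp only [norm_mul, Complex.norm_I, one_mul, Complex.norm_real, Real.norm_eq_abs, sq_abs] at this
    nlinarith [sq_nonneg y]
  · have h1 : ‖Complex.exp (Complex.I * y) - 1‖ ≤ ‖y‖ := Real.norm_exp_I_mul_ofReal_sub_one_le
    have h2 := norm_sub_le (Complex.exp (Complex.I * y) - 1) (Complex.I * y)
    simp only [norm_mul, Complex.norm_I, one_mul, Complex.norm_real, Real.norm_eq_abs] at h1 h2
    nlinarith [sq_abs y]

lemma norm_cexp_I_sub_one_le_two (y : ℝ) : ‖Complex.exp (Complex.I * y) - 1‖ ≤ 2 := by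
  refine (norm_sub_le _ _).trans ?_
  rw [Complex.norm_exp_I_mul_ofReal]; norm_num

lemma norm_levyIntegrand_le (θ x : EuclideanSpace ℝ ι) :
    ‖levyIntegrand θ x‖ ≤ (3 * ‖θ‖ ^ 2 + 2) * min (‖x‖ ^ 2) 1 := by
  unfold levyIntegrand
  split_ifs with h
  · have h1 := norm_cexp_I_sub_one_sub_le (inner ℝ θ x)
    have h2 : (inner ℝ θ x) ^ 2 ≤ (‖θ‖ * ‖x‖) ^ 2 :=
      sq_le_sq.2 ((abs_real_inner_le_norm θ x).trans (le_abs_self _))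
    rw [min_eq_left (by nlinarith [norm_nonneg x])]
    nlinarith [sq_nonneg ‖x‖]
  · rw [sub_zero, min_eq_right (by nlinarith [norm_nonneg x])]
    nlinarith [norm_cexp_I_sub_one_le_two (inner ℝ θ x), sq_nonneg ‖θ‖]

@[fun_prop]
lemma measurable_levyIntegrand (θ : EuclideanSpace ℝ ι) : Measurable (levyIntegrand θ) := by
  unfold levyIntegrand
  have : MeasurableSet {x : EuclideanSpace ℝ ι | ‖x‖ ≤ 1} :=
    measurableSet_le measurable_norm measurable_const
  refine Measurable.sub (by fun_prop) (Measurable.ite this (by fun_prop) (by fun_prop))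

lemma IsLevyMeasure.integrable_min {ν : Measure (EuclideanSpace ℝ ι)} (hν : IsLevyMeasure ν) :
    Integrable (fun x => min (‖x‖ ^ 2) 1) ν := by
  refine ⟨by fun_prop, ?_⟩
  rw [hasFiniteIntegral_iff_ofReal (ae_of_all _ fun x => by positivity)]
  exact hν.2

lemma IsLevyMeasure.integrable_levyIntegrand {ν : Measure (EuclideanSpace ℝ ι)}
    (hν : IsLevyMeasure ν) (θ : EuclideanSpace ℝ ι) : Integrable (levyIntegrand θ) ν :=
  Integrable.mono' (hν.integrable_min.const_mul _) (by fun_prop)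
    (ae_of_all _ (norm_levyIntegrand_le θ))

lemma quadForm_second_difference (S : Matrix ι ι ℝ) (θ a : EuclideanSpace ℝ ι) :
    quadForm S (θ + a) + quadForm S (θ - a) - 2 * quadForm S θ = 2 * quadForm S a := by
  simp only [quadForm, Finset.mul_sum, ← Finset.sum_add_distrib, ← Finset.sum_sub_distrib]
  refine Finset.sum_congr rfl fun k _ => Finset.sum_congr rfl fun l _ => ?_
  simp only [PiLp.add_apply, PiLp.sub_apply]
  ring

lemma quadForm_nonneg {S : Matrix ι ι ℝ} (hS : S.PosSemidef) (θ : EuclideanSpace ℝ ι) :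
    0 ≤ quadForm S θ := by
  have := hS.dotProduct_mulVec_nonneg (fun i => θ i)
  simpa [quadForm, dotProduct, Matrix.mulVec, Finset.mul_sum, mul_assoc] using this

/-- The constant and the compensator are affine in `θ`, so a second difference removes them. What is
left is nonnegative up to a character, hence the Fourier transform of a positive measure. -/
lemma levyIntegrand_second_difference (θ a x : EuclideanSpace ℝ ι) :
    2 * levyIntegrand θ x - levyIntegrand (θ + a) x - levyIntegrand (θ - a) x =
      Complex.exp ((inner ℝ x θ : ℝ) * Complex.I) * ((2 - 2 * Real.cos (inner ℝ a x) : ℝ) : ℂ) := by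
  have h : ((2 - 2 * Real.cos (inner ℝ a x) : ℝ) : ℂ) = 2 -
      (Complex.exp ((inner ℝ a x : ℝ) * Complex.I) + Complex.exp (-(inner ℝ a x : ℝ) * Complex.I)) := by
    push_cast
    rw [Complex.cos]; ring
  rw [h, real_inner_comm θ x]
  simp only [levyIntegrand, inner_add_left, inner_sub_left]
  push_cast
  have e1 : Complex.exp (Complex.I * ((inner ℝ θ x : ℝ) + (inner ℝ a x : ℝ))) =
      Complex.exp ((inner ℝ θ x : ℝ) * Complex.I) * Complex.exp ((inner ℝ a x : ℝ) * Complex.I) := by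
    rw [← Complex.exp_add]; congr 1; ring
  have e2 : Complex.exp (Complex.I * ((inner ℝ θ x : ℝ) - (inner ℝ a x : ℝ))) =
      Complex.exp ((inner ℝ θ x : ℝ) * Complex.I) * Complex.exp (-(inner ℝ a x : ℝ) * Complex.I) := by
    rw [← Complex.exp_add]; congr 1; ring
  rw [e1, e2, mul_comm Complex.I (inner ℝ θ x : ℂ)]
  split_ifs <;> ring

lemma levyExponent_second_difference {ν : Measure (EuclideanSpace ℝ ι)} (hν : IsLevyMeasure ν)
    (m : EuclideanSpace ℝ ι) (S : Matrix ι ι ℝ) (θ a : EuclideanSpace ℝ ι) :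
    2 * levyExponent m S ν θ - levyExponent m S ν (θ + a) - levyExponent m S ν (θ - a) =
      (quadForm S a : ℝ) + ∫ x, Complex.exp ((inner ℝ x θ : ℝ) * Complex.I) *
        ((2 - 2 * Real.cos (inner ℝ a x) : ℝ) : ℂ) ∂ν := by
  have h1 := hν.integrable_levyIntegrand
  have : ∫ x, Complex.exp ((inner ℝ x θ : ℝ) * Complex.I) *
      ((2 - 2 * Real.cos (inner ℝ a x) : ℝ) : ℂ) ∂ν = 2 * ∫ x, levyIntegrand θ x ∂ν -
      ∫ x, levyIntegrand (θ + a) x ∂ν - ∫ x, levyIntegrand (θ - a) x ∂ν := by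
    simp_rw [← levyIntegrand_second_difference θ a]
    rw [integral_sub (f := fun x => 2 * levyIntegrand θ x - levyIntegrand (θ + a) x)
      (((h1 _).const_mul _).sub (h1 _)) (h1 _), integral_sub ((h1 _).const_mul _) (h1 _), integral_const_mul]
  rw [this]
  simp only [levyExponent_eq, inner_add_right, inner_sub_right]
  have hq : ((quadForm S (θ + a) : ℝ) : ℂ) =
      2 * (quadForm S a : ℝ) + 2 * (quadForm S θ : ℝ) - (quadForm S (θ - a) : ℝ) := by
    have := quadForm_second_difference S θ a
    rw [← Complex.ofReal_ofNat, ← Complex.ofReal_mul, ← Complex.ofReal_mul, ← Complex.ofReal_add,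
      ← Complex.ofReal_sub]
    congr 1; linarith
  rw [hq]
  push_cast
  ring

/-- The finite measure `(2 - 2 cos ⟨a, x⟩) ν(dx) + Q(a) δ₀` obtained from second differences of the
Lévy exponent. -/
def secondDifferenceMeasure (S : Matrix ι ι ℝ) (ν : Measure (EuclideanSpace ℝ ι))
    (a : EuclideanSpace ℝ ι) : Measure (EuclideanSpace ℝ ι) :=
  ν.withDensity (fun x => ENNReal.ofReal (2 - 2 * Real.cos (inner ℝ a x))) +
    ENNReal.ofReal (quadForm S a) • Measure.dirac 0

lemma two_sub_two_cos_nonneg (y : ℝ) : 0 ≤ 2 - 2 * Real.cos y := by linarith [Real.cos_le_one y]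

lemma IsLevyMeasure.integrable_two_sub_two_cos {ν : Measure (EuclideanSpace ℝ ι)}
    (hν : IsLevyMeasure ν) (a : EuclideanSpace ℝ ι) :
    Integrable (fun x => 2 - 2 * Real.cos (inner ℝ a x)) ν := by
  have h1 := hν.integrable_levyIntegrand
  have h2 := (((h1 0).const_mul 2).sub (h1 (0 + a))).sub (h1 (0 - a))
  refine h2.re.congr (ae_of_all _ fun x => ?_)
  simp only [Pi.sub_apply, levyIntegrand_second_difference]
  simp [Complex.cos_ofReal_re]

lemma isFiniteMeasure_secondDifferenceMeasure (S : Matrix ι ι ℝ)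
    {ν : Measure (EuclideanSpace ℝ ι)} (hν : IsLevyMeasure ν) (a : EuclideanSpace ℝ ι) :
    IsFiniteMeasure (secondDifferenceMeasure S ν a) := by
  have : IsFiniteMeasure
      (ν.withDensity (fun x => ENNReal.ofReal (2 - 2 * Real.cos (inner ℝ a x)))) := by
    refine isFiniteMeasure_withDensity ?_
    exact ((hasFiniteIntegral_iff_ofReal (ae_of_all _ fun x => two_sub_two_cos_nonneg _)).1
      (hν.integrable_two_sub_two_cos a).2).ne
  have h2 : IsFiniteMeasure (ENNReal.ofReal (quadForm S a) •
      (Measure.dirac 0 : Measure (EuclideanSpace ℝ ι))) := Measure.smul_finite _ ENNReal.ofReal_ne_top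
  unfold secondDifferenceMeasure
  infer_instance

lemma charFun_secondDifferenceMeasure {S : Matrix ι ι ℝ} (hS : ∀ a, 0 ≤ quadForm S a)
    {ν : Measure (EuclideanSpace ℝ ι)} (hν : IsLevyMeasure ν) (m a θ : EuclideanSpace ℝ ι) :
    charFun (secondDifferenceMeasure S ν a) θ =
      2 * levyExponent m S ν θ - levyExponent m S ν (θ + a) - levyExponent m S ν (θ - a) := by
  have hfin := isFiniteMeasure_secondDifferenceMeasure S hν a
  rw [levyExponent_second_difference hν, charFun_apply, secondDifferenceMeasure,
    integral_add_measure, integral_smul_measure, integral_dirac, add_comm]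
  · congr 1
    · simp [ENNReal.toReal_ofReal (hS a)]
    · rw [integral_withDensity_eq_integral_toReal_smul (by fun_prop) (by simp)]
      refine integral_congr_ae (ae_of_all _ fun x => ?_)
      simp only
      rw [ENNReal.toReal_ofReal (two_sub_two_cos_nonneg _), Complex.real_smul, mul_comm]
  all_goals
    have hc : Integrable (fun _ : EuclideanSpace ℝ ι => (1 : ℝ)) (secondDifferenceMeasure S ν a) :=
      integrable_const 1
    rw [secondDifferenceMeasure] at hc
    refine Integrable.mono' (g := fun _ => 1) ?_ (by fun_prop) (ae_of_all _ fun x => ?_)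
    · first
      | exact hc.left_of_add_measure
      | exact hc.right_of_add_measure
    · rw [Complex.norm_exp_ofReal_mul_I]

/-- A Lévy exponent determines its Lévy measure. -/
theorem levyMeasure_unique {m m' : EuclideanSpace ℝ ι} {S S' : Matrix ι ι ℝ}
    (hS : ∀ a, 0 ≤ quadForm S a) (hS' : ∀ a, 0 ≤ quadForm S' a)
    {ν ν' : Measure (EuclideanSpace ℝ ι)} (hν : IsLevyMeasure ν) (hν' : IsLevyMeasure ν')
    (h : ∀ θ, levyExponent m S ν θ = levyExponent m' S' ν' θ) :
    ν = ν' := by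
  classical
  have hE : ∀ a, secondDifferenceMeasure S ν a = secondDifferenceMeasure S' ν' a := fun a => by
    have := isFiniteMeasure_secondDifferenceMeasure S hν a
    have := isFiniteMeasure_secondDifferenceMeasure S' hν' a
    refine Measure.ext_of_charFun (funext fun θ => ?_)
    rw [charFun_secondDifferenceMeasure hS hν m, charFun_secondDifferenceMeasure hS' hν' m']
    simp only [h]
  have hA : ∀ a A, MeasurableSet A →
      ∫⁻ x in A, ENNReal.ofReal (2 - 2 * Real.cos (inner ℝ a x)) ∂ν =
        ∫⁻ x in A, ENNReal.ofReal (2 - 2 * Real.cos (inner ℝ a x)) ∂ν' := fun a A hA => by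
    -- Deleting the origin discards the Gaussian atom and costs nothing in the jump part, since `ν`
    -- does not charge the origin.
    have key : ∀ (S : Matrix ι ι ℝ) {ν : Measure (EuclideanSpace ℝ ι)}, IsLevyMeasure ν →
        ∫⁻ x in A, ENNReal.ofReal (2 - 2 * Real.cos (inner ℝ a x)) ∂ν =
          secondDifferenceMeasure S ν a (A \ {0}) := fun S ν hν => by
      have hm : MeasurableSet (A \ {0}) := hA.diff (measurableSet_singleton 0)
      rw [secondDifferenceMeasure, Measure.add_apply, withDensity_apply _ hm, Measure.smul_apply,
        Measure.dirac_apply' _ hm]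
      simp only [Set.mem_sdiff, mem_singleton_iff, not_true_eq_false, and_false, not_false_eq_true,
        indicator_of_notMem, smul_zero, add_zero]
      exact (setLIntegral_congr (sdiff_null_ae_eq_self hν.1)).symm
    rw [key S hν, key S' hν', hE]
  -- A single frequency misses the points of a lattice. The frequencies `1` and `√2` are
  -- incommensurable, so both cosines equal `1` only where `x k = 0`; summed over coordinates, the
  -- weight vanishes only at the origin and can be divided out.
  let w : EuclideanSpace ℝ ι → ℝ≥0∞ := fun x => ∑ k : ι,
    (ENNReal.ofReal (2 - 2 * Real.cos (inner ℝ (EuclideanSpace.single k (1 : ℝ)) x)) +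
      ENNReal.ofReal (2 - 2 * Real.cos (inner ℝ (EuclideanSpace.single k (√2)) x)))
  have hw : Measurable w := by fun_prop
  have hwd : ν.withDensity w = ν'.withDensity w := by
    ext A hmA
    rw [withDensity_apply _ hmA, withDensity_apply _ hmA, lintegral_finsetSum _ (by fun_prop),
      lintegral_finsetSum _ (by fun_prop)]
    refine Finset.sum_congr rfl fun k _ => ?_
    rw [lintegral_add_left (by fun_prop), lintegral_add_left (by fun_prop), hA _ _ hmA,
      hA _ _ hmA]
  have hw0 : ∀ x, x ≠ 0 → w x ≠ 0 := fun x hx hwx => by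
    obtain ⟨k, hk⟩ : ∃ k, x k ≠ 0 := by
      by_contra! hc
      exact hx (by ext k; simpa using hc k)
    have h1 := (Finset.sum_eq_zero_iff.1 hwx) k (Finset.mem_univ k)
    simp only [EuclideanSpace.inner_single_left, add_eq_zero, ENNReal.ofReal_eq_zero, conj_trivial,
      one_mul] at h1
    have c1 : Real.cos (x k) = 1 := le_antisymm (Real.cos_le_one _) (by linarith [h1.1])
    have c2 : Real.cos (√2 * x k) = 1 := le_antisymm (Real.cos_le_one _) (by linarith [h1.2])
    obtain ⟨p, hp⟩ := (Real.cos_eq_one_iff _).1 c1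
    obtain ⟨r, hr⟩ := (Real.cos_eq_one_iff _).1 c2
    rw [← hp] at hr hk
    have hpi := Real.pi_pos
    have hp0 : (p : ℝ) ≠ 0 := fun h0 => hk (by rw [h0]; ring)
    refine irrational_sqrt_two ⟨(r : ℚ) / p, ?_⟩
    push_cast
    rw [div_eq_iff hp0]
    have : (r : ℝ) * (2 * Real.pi) = (√2 * p) * (2 * Real.pi) := by linarith
    exact mul_right_cancel₀ (by positivity) this
  have hfin : ∀ x, w x ≠ ∞ := fun x => by simp [w]
  have hae : ∀ {ν : Measure (EuclideanSpace ℝ ι)}, IsLevyMeasure ν → ∀ᵐ x ∂ν, w x ≠ 0 :=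
    fun {ν} hν => by
      have : {0}ᶜ ∈ ae ν := compl_mem_ae_iff.2 hν.1
      filter_upwards [this] with x hx using hw0 x hx
  rw [← withDensity_inv_same hw (hae hν) (ae_of_all _ hfin), hwd,
    withDensity_inv_same hw (hae hν') (ae_of_all _ hfin)]

/-- A Lévy exponent determines its Gaussian covariance. -/
theorem quadForm_unique {m m' : EuclideanSpace ℝ ι} {S S' : Matrix ι ι ℝ}
    (hS : ∀ a, 0 ≤ quadForm S a) (hS' : ∀ a, 0 ≤ quadForm S' a)
    {ν ν' : Measure (EuclideanSpace ℝ ι)} (hν : IsLevyMeasure ν) (hν' : IsLevyMeasure ν')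
    (h : ∀ θ, levyExponent m S ν θ = levyExponent m' S' ν' θ) (a : EuclideanSpace ℝ ι) :
    quadForm S a = quadForm S' a := by
  obtain rfl := levyMeasure_unique hS hS' hν hν' h
  -- The jump integrals now agree, so they cancel in the second difference at `θ = 0` and the
  -- quadratic forms remain.
  have h1 := levyExponent_second_difference hν m S 0 a
  rw [h, h, h, levyExponent_second_difference hν m' S' 0 a] at h1
  exact_mod_cast (add_right_cancel h1).symm

/-- A Lévy exponent determines its location parameter. -/
theorem location_unique {m m' : EuclideanSpace ℝ ι} {S S' : Matrix ι ι ℝ}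
    (hS : ∀ a, 0 ≤ quadForm S a) (hS' : ∀ a, 0 ≤ quadForm S' a)
    {ν ν' : Measure (EuclideanSpace ℝ ι)} (hν : IsLevyMeasure ν) (hν' : IsLevyMeasure ν')
    (h : ∀ θ, levyExponent m S ν θ = levyExponent m' S' ν' θ) : m = m' := by
  obtain rfl := levyMeasure_unique hS hS' hν hν' h
  refine ext_inner_right ℝ fun θ => ?_
  have h1 := h θ
  rw [levyExponent_eq, levyExponent_eq, quadForm_unique hS hS' hν hν' h θ] at h1
  have h2 := mul_left_cancel₀ Complex.I_ne_zero (sub_left_injective (add_right_cancel h1))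
  exact_mod_cast h2

/-- Varying the time removes the ambiguity of the complex logarithm: at `t = 1/‖z - w‖` the number
`t (z - w)` has modulus `1`, yet would have to be a multiple of `2πi`. -/
lemma eq_of_forall_exp_mul_eq {z w : ℂ}
    (h : ∀ t : ℝ≥0, Complex.exp ((t : ℝ) * z) = Complex.exp ((t : ℝ) * w)) : z = w := by
  by_contra hne
  have hc : 0 < ‖z - w‖ := norm_pos_iff.2 (sub_ne_zero.2 hne)
  have h1 := h (Real.toNNReal ‖z - w‖⁻¹)
  rw [Real.coe_toNNReal _ (by positivity)] at h1
  rw [← div_eq_one_iff_eq (Complex.exp_ne_zero _), ← Complex.exp_sub, ← mul_sub,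
    Complex.exp_eq_one_iff] at h1
  obtain ⟨n, hn⟩ := h1
  have h2 := congrArg norm hn
  simp only [norm_mul, Complex.norm_real, norm_inv, abs_of_pos hc, Complex.norm_I, mul_one,
    inv_mul_cancel₀ hc.ne', Complex.norm_intCast, Real.norm_eq_abs, Complex.norm_ofNat,
    abs_of_pos Real.pi_pos] at h2
  have h3 : (3 : ℝ) < Real.pi := Real.pi_gt_three
  rcases eq_or_ne n 0 with rfl | hn0
  · simp at h2
  · have : (1 : ℝ) ≤ |(n : ℝ)| := by exact_mod_cast Int.one_le_abs hn0
    nlinarith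

/-- If `‖x‖ ∧ 1` is integrable, small jumps need no compensation. -/
lemma integral_levyIntegrand_of_integrable {ν : Measure (EuclideanSpace ℝ ι)}
    (hν : IsLevyMeasure ν) (hint : IntegrableOn (fun x => x) (puncturedBall ι) ν)
    (θ : EuclideanSpace ℝ ι) :
    Integrable (fun x => Complex.exp (Complex.I * (inner ℝ θ x : ℝ)) - 1) ν ∧
    ∫ x, levyIntegrand θ x ∂ν = (∫ x, (Complex.exp (Complex.I * (inner ℝ θ x : ℝ)) - 1) ∂ν) -
      Complex.I * (inner ℝ (∫ x in puncturedBall ι, x ∂ν) θ : ℝ) := by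
  have hm : MeasurableSet (puncturedBall ι) :=
    measurableSet_closedBall.diff (measurableSet_singleton 0)
  have hi : Integrable ((puncturedBall ι).indicator
      fun x => Complex.I * (inner ℝ θ x : ℝ)) ν := by
    rw [integrable_indicator_iff hm]
    exact ((hint.const_inner θ).ofReal).const_mul _
  have heq : ∀ x, (if ‖x‖ ≤ 1 then Complex.I * (inner ℝ θ x : ℝ) else 0) =
      (puncturedBall ι).indicator (fun x => Complex.I * ((inner ℝ θ x : ℝ) : ℂ)) x := fun x => by
    rcases eq_or_ne x 0 with rfl | hx
    · simp [puncturedBall]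
    · simp [puncturedBall, indicator, hx]
  have h1 : ∀ x, Complex.exp (Complex.I * (inner ℝ θ x : ℝ)) - 1 = levyIntegrand θ x +
      (puncturedBall ι).indicator (fun x => Complex.I * ((inner ℝ θ x : ℝ) : ℂ)) x := fun x => by
    rw [levyIntegrand, ← heq]; ring
  have h2 := hν.integrable_levyIntegrand θ
  refine ⟨(h2.add hi).congr (ae_of_all _ fun x => (h1 x).symm), ?_⟩
  simp_rw [h1]
  rw [integral_add h2 hi, integral_indicator hm, integral_const_mul, integral_complex_ofReal,
    integral_inner hint θ, real_inner_comm]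
  ring

/-- The compensator inside the integral cancels against the shift of the location parameter, so the
drift is the location parameter of the uncompensated formula. -/
lemma levyExponent_of_integrable {ν : Measure (EuclideanSpace ℝ ι)}
    (hν : IsLevyMeasure ν) (hint : IntegrableOn (fun x => x) (puncturedBall ι) ν)
    (d : EuclideanSpace ℝ ι) (S : Matrix ι ι ℝ) (θ : EuclideanSpace ℝ ι) :
    levyExponent (d + ∫ x in puncturedBall ι, x ∂ν) S ν θ =
      Complex.I * (inner ℝ d θ : ℝ) - (1 / 2 : ℂ) * (quadForm S θ : ℝ) +
        ∫ x, (Complex.exp (Complex.I * (inner ℝ θ x : ℝ)) - 1) ∂ν := by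
  rw [levyExponent_eq, (integral_levyIntegrand_of_integrable hν hint θ).2, inner_add_left]
  push_cast
  ring

end LevyKhintchine

/-! ### The Cauchy law as a mixing measure for cosines -/

section Cauchy

/-- The Fourier transform of `x ↦ exp (-|x|)`. -/
lemma integral_exp_neg_abs_mul_cexp (a : ℝ) :
    ∫ x : ℝ, Complex.exp (a * x * Complex.I) * (Real.exp (-|x|) : ℂ) = ((2 / (1 + a ^ 2) : ℝ) : ℂ) := by
  have h1 : ∀ x ∈ Ioi (0 : ℝ), Complex.exp (a * x * Complex.I) * (Real.exp (-|x|) : ℂ) =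
      Complex.exp ((a * Complex.I - 1) * x) := fun x hx => by
    rw [abs_of_pos hx, Complex.ofReal_exp, ← Complex.exp_add]
    push_cast; congr 1; ring
  have h2 : ∀ x ∈ Iic (0 : ℝ), Complex.exp (a * x * Complex.I) * (Real.exp (-|x|) : ℂ) =
      Complex.exp ((a * Complex.I + 1) * x) := fun x hx => by
    rw [abs_of_nonpos hx, Complex.ofReal_exp, ← Complex.exp_add]
    push_cast; congr 1; ring
  have i1 : IntegrableOn (fun x : ℝ => Complex.exp ((a * Complex.I - 1) * x)) (Ioi 0) :=
    integrableOn_exp_mul_complex_Ioi (by simp) 0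
  have i2 : IntegrableOn (fun x : ℝ => Complex.exp ((a * Complex.I + 1) * x)) (Iic 0) :=
    integrableOn_exp_mul_complex_Iic (by simp) 0
  have n1 : (a * Complex.I - 1 : ℂ) ≠ 0 := fun h => by simpa using congrArg Complex.re h
  have n2 : (a * Complex.I + 1 : ℂ) ≠ 0 := fun h => by simpa using congrArg Complex.re h
  have n3 : (1 + a ^ 2 : ℂ) ≠ 0 := by
    have : (1 + a ^ 2 : ℝ) ≠ 0 := by positivity
    exact_mod_cast this
  rw [← intervalIntegral.integral_Iic_add_Ioi (b := 0) (i2.congr_fun (fun x hx => (h2 x hx).symm) measurableSet_Iic)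
    (i1.congr_fun (fun x hx => (h1 x hx).symm) measurableSet_Ioi),
    setIntegral_congr_fun measurableSet_Iic h2, setIntegral_congr_fun measurableSet_Ioi h1,
    integral_exp_mul_complex_Ioi (by simp), integral_exp_mul_complex_Iic (by simp)]
  simp only [Complex.ofReal_zero, mul_zero, Complex.exp_zero]
  push_cast
  field_simp
  ring_nf
  rw [Complex.I_sq]
  ring

/-- The characteristic function of the standard Cauchy distribution. -/
lemma charFun_cauchyMeasure (x : ℝ) : charFun (cauchyMeasure 0 1) x = Real.exp (-|x|) := by
  let f : ℝ → ℂ := fun y => (Real.exp (-|y|) : ℂ)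
  -- Fourier inversion for `e^{-|y|}`, whose transform is integrable, followed by the substitution
  -- `s = 2πw`, produces the Cauchy density.
  have hF : FourierTransform.fourier f = fun w => ((2 / (1 + (2 * Real.pi * w) ^ 2) : ℝ) : ℂ) := by
    ext w
    rw [Real.fourier_eq', show (2 * Real.pi * w) ^ 2 = (-(2 * Real.pi * w)) ^ 2 by ring,
      ← integral_exp_neg_abs_mul_cexp]
    refine integral_congr_ae (ae_of_all _ fun y => ?_)
    simp only [smul_eq_mul, f]
    congr 2
    simp
    ring
  have hint : Integrable f := by
    refine Integrable.of_integral_ne_zero ?_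
    have := integral_exp_neg_abs_mul_cexp 0
    simp only [Complex.ofReal_zero, zero_mul, Complex.exp_zero, one_mul] at this
    rw [this]
    norm_num
  have hg : Integrable fun s : ℝ => ((2 / (1 + s ^ 2) : ℝ) : ℂ) := by
    simp only [div_eq_mul_inv]
    exact (integrable_inv_one_add_sq.const_mul 2).ofReal
  have hFi : Integrable (FourierTransform.fourier f) := by
    rw [hF]
    exact hg.comp_mul_left' (by positivity)
  have hinv := hint.fourierInv_fourier_eq hFi (v := x)
    (by fun_prop)
  rw [hF, Real.fourierInv_eq'] at hinv
  have hsub := Measure.integral_comp_mul_left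
    (fun s : ℝ => Complex.exp (s * x * Complex.I) * ((2 / (1 + s ^ 2) : ℝ) : ℂ)) (2 * Real.pi)
  have h1 : ∫ w : ℝ, Complex.exp (((2 * Real.pi * w : ℝ) : ℂ) * x * Complex.I) *
      ((2 / (1 + (2 * Real.pi * w) ^ 2) : ℝ) : ℂ) = Real.exp (-|x|) := by
    refine Eq.trans ?_ hinv
    refine integral_congr_ae (ae_of_all _ fun w => ?_)
    simp only [smul_eq_mul]
    congr 2
    simp
    ring
  rw [h1] at hsub
  rw [hsub, charFun_apply_real, cauchyMeasure_of_scale_ne_zero 0 one_ne_zero,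
    integral_withDensity_eq_integral_toReal_smul (by fun_prop) (by simp [cauchyPDF]),
    ← integral_smul]
  refine integral_congr_ae (ae_of_all _ fun s => ?_)
  simp only
  rw [cauchyPDF, ENNReal.toReal_ofReal (cauchyPDF_pos 0 one_ne_zero s).le, cauchyPDFReal]
  simp only [Complex.real_smul, sub_zero, NNReal.coe_one, mul_one, one_pow]
  rw [abs_of_pos (by positivity)]
  push_cast
  rw [mul_comm (x : ℂ) s]
  have : (Real.pi : ℂ) ≠ 0 := by exact_mod_cast Real.pi_ne_zero
  have : (1 + s ^ 2 : ℂ) ≠ 0 := by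
    have : (1 + s ^ 2 : ℝ) ≠ 0 := by positivity
    exact_mod_cast this
  have : (s ^ 2 + 1 : ℂ) ≠ 0 := by rwa [add_comm]
  field_simp
  ring

lemma integral_one_sub_cos_cauchyMeasure (x : ℝ) :
    ∫ s, (1 - Real.cos (s * x)) ∂(cauchyMeasure 0 1) = 1 - Real.exp (-|x|) := by
  have h := congrArg Complex.re (charFun_cauchyMeasure x)
  rw [charFun_apply_real, Complex.ofReal_re] at h
  have hi : Integrable (fun s : ℝ => Complex.exp (x * s * Complex.I)) (cauchyMeasure 0 1) :=
    Integrable.mono' (integrable_const 1) (by fun_prop) (ae_of_all _ fun s => by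
      rw [← Complex.ofReal_mul, Complex.norm_exp_ofReal_mul_I])
  have hre : ∀ s : ℝ, (Complex.exp (x * s * Complex.I)).re = Real.cos (s * x) := fun s => by
    rw [← Complex.ofReal_mul, Complex.exp_ofReal_mul_I_re, mul_comm]
  have h3 := integral_re hi
  simp only [RCLike.re_eq_complex_re, hre] at h3
  rw [integral_sub (integrable_const 1), h3, h]
  · simp
  · exact hi.re.congr (ae_of_all _ hre)

lemma lintegral_cauchyMeasure {f : ℝ → ℝ≥0∞} (hf : Measurable f) :
    ∫⁻ s, f s ∂(cauchyMeasure 0 1) =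
      ∫⁻ s, ENNReal.ofReal (Real.pi⁻¹ * (1 + s ^ 2)⁻¹) * f s := by
  rw [cauchyMeasure_of_scale_ne_zero 0 one_ne_zero,
    lintegral_withDensity_eq_lintegral_mul _ (by fun_prop) hf]
  refine lintegral_congr fun s => ?_
  simp [cauchyPDF, cauchyPDFReal, add_comm]

/-- The Cauchy law has no second moment, so truncation yields order `a` instead of `a²`. Bounding
`min 1 y²` by `2y²/(1 + y²)` with `y = as`, and absorbing `s²` into the density, leaves a rescaled
Cauchy integral equal to `2a`. -/
lemma lintegral_min_sq_cauchyMeasure_le {a : ℝ} (ha : 0 ≤ a) :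
    ∫⁻ s, ENNReal.ofReal (min 1 ((a * s) ^ 2)) ∂(cauchyMeasure 0 1) ≤ ENNReal.ofReal (2 * a) := by
  rcases ha.eq_or_lt with rfl | ha
  · simp
  rw [lintegral_cauchyMeasure (by fun_prop)]
  have hi : Integrable (fun s : ℝ => 2 * a ^ 2 * Real.pi⁻¹ * (1 + (a * s) ^ 2)⁻¹) :=
    (integrable_inv_one_add_sq.comp_mul_left' ha.ne').const_mul _
  have hval : ∫ s : ℝ, 2 * a ^ 2 * Real.pi⁻¹ * (1 + (a * s) ^ 2)⁻¹ = 2 * a := by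
    rw [integral_const_mul, Measure.integral_comp_mul_left (fun s : ℝ => (1 + s ^ 2)⁻¹) a,
      integral_univ_inv_one_add_sq, abs_of_pos (by positivity), smul_eq_mul]
    field_simp
  rw [← hval, ofReal_integral_eq_lintegral_ofReal hi (ae_of_all _ fun s => by positivity)]
  refine lintegral_mono fun s => ?_
  rw [← ENNReal.ofReal_mul (by positivity)]
  refine ENNReal.ofReal_le_ofReal ?_
  have h1 : min 1 ((a * s) ^ 2) ≤ 2 * (a * s) ^ 2 * (1 + (a * s) ^ 2)⁻¹ := by
    rw [← div_eq_mul_inv, le_div_iff₀ (by positivity)]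
    rcases le_total 1 ((a * s) ^ 2) with h | h
    · rw [min_eq_left h]; linarith
    · rw [min_eq_right h]; nlinarith [sq_nonneg (a * s)]
  have h2 : (1 + s ^ 2)⁻¹ * s ^ 2 ≤ 1 := by
    rw [inv_mul_le_iff₀ (by positivity)]; linarith
  calc Real.pi⁻¹ * (1 + s ^ 2)⁻¹ * min 1 ((a * s) ^ 2)
      ≤ Real.pi⁻¹ * (1 + s ^ 2)⁻¹ * (2 * (a * s) ^ 2 * (1 + (a * s) ^ 2)⁻¹) := by gcongr
    _ = ((1 + s ^ 2)⁻¹ * s ^ 2) * (2 * a ^ 2 * Real.pi⁻¹ * (1 + (a * s) ^ 2)⁻¹) := by ring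
    _ ≤ 1 * (2 * a ^ 2 * Real.pi⁻¹ * (1 + (a * s) ^ 2)⁻¹) := by gcongr
    _ = _ := one_mul _

/-- The divergence that excludes a Gaussian component when the variation is finite. -/
lemma lintegral_sq_cauchyMeasure :
    ∫⁻ s, ENNReal.ofReal (s ^ 2) ∂(cauchyMeasure 0 1) = ∞ := by
  rw [lintegral_cauchyMeasure (by fun_prop), eq_top_iff]
  calc ∞ = ∫⁻ s in Ioi (1 : ℝ), ENNReal.ofReal (Real.pi⁻¹ / 2) := by
        rw [setLIntegral_const, Real.volume_Ioi, ENNReal.mul_top]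
        simpa using Real.pi_pos
    _ ≤ ∫⁻ s in Ioi (1 : ℝ),
          ENNReal.ofReal (Real.pi⁻¹ * (1 + s ^ 2)⁻¹) * ENNReal.ofReal (s ^ 2) := by
        refine setLIntegral_mono' measurableSet_Ioi fun s hs => ?_
        rw [← ENNReal.ofReal_mul (by positivity)]
        refine ENNReal.ofReal_le_ofReal ?_
        rw [div_eq_mul_inv, mul_assoc]
        gcongr
        rw [inv_mul_eq_div, le_div_iff₀ (by positivity)]
        have : (1 : ℝ) < s := hs
        nlinarith
    _ ≤ _ := setLIntegral_le_lintegral _ _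

end Cauchy

/-! ### Variation along dyadic grids -/

section DyadicGrid

/-- The dyadic point `j / 2 ^ m`. -/
def dyadicPoint (m j : ℕ) : ℝ≥0 := j / 2 ^ m

/-- The smallest dyadic point of level `m` above `t`. -/
def dyadicCeil (m : ℕ) (t : ℝ≥0) : ℝ≥0 := dyadicPoint m ⌈t * 2 ^ m⌉₊

/-- The dyadic grid of level `m` on `[0, N]`. -/
def dyadicGrid (N m : ℕ) : Set ℝ≥0 := dyadicPoint m '' Iic (N * 2 ^ m)

lemma dyadicPoint_mono (m : ℕ) : Monotone (dyadicPoint m) := fun i j h => by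
  unfold dyadicPoint; gcongr

lemma dyadicCeil_mono (m : ℕ) : Monotone (dyadicCeil m) := fun s t h =>
  dyadicPoint_mono m (Nat.ceil_mono (by gcongr))

lemma le_dyadicCeil (m : ℕ) (t : ℝ≥0) : t ≤ dyadicCeil m t := by
  rw [dyadicCeil, dyadicPoint, le_div_iff₀ (by positivity)]
  exact Nat.le_ceil _

lemma dyadicCeil_le (m : ℕ) (t : ℝ≥0) : dyadicCeil m t ≤ t + (1 / 2) ^ m := by
  rw [dyadicCeil, dyadicPoint, div_le_iff₀ (by positivity), add_mul, ← mul_pow]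
  have := (Nat.ceil_lt_add_one (zero_le (a := t * 2 ^ m))).le
  rwa [one_div_mul_cancel two_ne_zero, one_pow]

lemma tendsto_dyadicCeil (t : ℝ≥0) : Tendsto (fun m => dyadicCeil m t) atTop (𝓝[≥] t) := by
  refine tendsto_nhdsWithin_iff.2 ⟨?_, Eventually.of_forall fun m => le_dyadicCeil m t⟩
  refine tendsto_of_tendsto_of_tendsto_of_le_of_le tendsto_const_nhds (h := fun m => t + (1 / 2) ^ m)
    ?_ (fun m => le_dyadicCeil m t) (fun m => dyadicCeil_le m t)
  have : Tendsto (fun m : ℕ => ((1 : ℝ≥0) / 2) ^ m) atTop (𝓝 0) :=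
    NNReal.tendsto_pow_atTop_nhds_zero_of_lt_one (by
      rw [← NNReal.coe_lt_coe]; norm_num)
  simpa using this.const_add t

lemma dyadicGrid_subset_succ (N m : ℕ) : dyadicGrid N m ⊆ dyadicGrid N (m + 1) := by
  rintro _ ⟨j, hj, rfl⟩
  refine ⟨2 * j, ?_, ?_⟩
  · simp only [mem_Iic] at hj ⊢
    rw [pow_succ]; linarith
  · simp only [dyadicPoint, pow_succ]
    push_cast
    field_simp

lemma dyadicGrid_subset_Icc (N m : ℕ) : dyadicGrid N m ⊆ Icc 0 (N : ℝ≥0) := by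
  rintro _ ⟨j, hj, rfl⟩
  refine ⟨zero_le, ?_⟩
  rw [dyadicPoint, div_le_iff₀ (by positivity)]
  exact_mod_cast hj

lemma dyadicCeil_mem_grid {N m : ℕ} {t : ℝ≥0} (ht : t ≤ N) : dyadicCeil m t ∈ dyadicGrid N m := by
  refine ⟨_, ?_, rfl⟩
  simp only [mem_Iic]
  rw [Nat.ceil_le]
  push_cast
  gcongr

variable {E : Type*} [SeminormedAddCommGroup E]

/-- The variation of `f` along the dyadic grid of level `m` on `[0, N]`. -/
def gridSum (f : ℝ≥0 → E) (N m : ℕ) : ℝ :=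
  ∑ j ∈ Finset.range (N * 2 ^ m), ‖f (dyadicPoint m (j + 1)) - f (dyadicPoint m j)‖

lemma gridSum_nonneg (f : ℝ≥0 → E) (N m : ℕ) : 0 ≤ gridSum f N m :=
  Finset.sum_nonneg fun _ _ => norm_nonneg _

lemma ofReal_gridSum (f : ℝ≥0 → E) (N m : ℕ) :
    ENNReal.ofReal (gridSum f N m) = eVariationOn f (dyadicGrid N m) := by
  rw [dyadicGrid, eVariationOn.image_range_of_monotone f (dyadicPoint_mono m), gridSum,
    ENNReal.ofReal_sum_of_nonneg fun _ _ => norm_nonneg _]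
  refine Finset.sum_congr rfl fun j _ => ?_
  rw [edist_comm, edist_dist, dist_eq_norm]

lemma gridSum_mono (f : ℝ≥0 → E) (N : ℕ) : Monotone (gridSum f N) := by
  refine monotone_nat_of_le_succ fun m => ?_
  rw [← ENNReal.ofReal_le_ofReal_iff (gridSum_nonneg f N _), ofReal_gridSum, ofReal_gridSum]
  exact eVariationOn.mono f (dyadicGrid_subset_succ N m)

/-- A right-continuous function whose variations along dyadic grids are bounded has locally
bounded variation. -/
lemma locallyBoundedVariationOn_of_gridSum {f : ℝ≥0 → E}
    (hf : ∀ t, ContinuousWithinAt f (Ici t) t) (hb : ∀ N, BddAbove (range (gridSum f N))) :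
    LocallyBoundedVariationOn f univ := by
  intro a b _ _
  obtain ⟨N, hN⟩ := exists_nat_ge b
  obtain ⟨C, hC⟩ := hb N
  have hsub : univ ∩ Icc a b ⊆ Icc 0 (N : ℝ≥0) := fun x hx => ⟨zero_le, hx.2.2.trans hN⟩
  refine ne_top_of_le_ne_top ?_ (eVariationOn.mono f hsub)
  suffices h : eVariationOn f (Icc 0 (N : ℝ≥0)) ≤ ENNReal.ofReal C from
    ne_top_of_le_ne_top ENNReal.ofReal_ne_top h
  by_contra! hlt
  -- Right continuity makes `f ∘ dyadicCeil m` converge pointwise to `f`. Variation is lower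
  -- semicontinuous under pointwise convergence, and each approximant varies no more than `f` does
  -- on the grid.
  have hev := eVariationOn.lowerSemicontinuous_aux (F := fun m => f ∘ dyadicCeil m) (p := atTop)
    (fun x _ => (hf x).tendsto.comp (tendsto_dyadicCeil x)) hlt
  obtain ⟨m, hm⟩ := hev.exists
  refine absurd hm (not_lt.2 ?_)
  refine (eVariationOn.comp_le_of_monotoneOn f (s := dyadicGrid N m) _
    ((dyadicCeil_mono m).monotoneOn _) fun t ht => dyadicCeil_mem_grid ht.2).trans ?_
  rw [← ofReal_gridSum]
  exact ENNReal.ofReal_le_ofReal (hC ⟨m, rfl⟩)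

lemma bddAbove_gridSum {f : ℝ≥0 → E} (hf : LocallyBoundedVariationOn f univ) (N : ℕ) :
    BddAbove (range (gridSum f N)) := by
  have h := hf 0 N (mem_univ _) (mem_univ _)
  refine ⟨(eVariationOn f (univ ∩ Icc 0 (N : ℝ≥0))).toReal, ?_⟩
  rintro _ ⟨m, rfl⟩
  rw [← ENNReal.ofReal_le_iff_le_toReal h, ofReal_gridSum]
  exact eVariationOn.mono f (by rw [univ_inter]; exact dyadicGrid_subset_Icc N m)

end DyadicGrid

/-! ### Laplace transforms of grid variations -/

section GridLaplace

variable {Ω : Type*} [MeasurableSpace Ω] {P : Measure Ω}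
  {X : ℝ≥0 → Ω → ℝ}

lemma measurable_gridSum (hX : ∀ t, Measurable (X t)) (N m : ℕ) :
    Measurable fun ω => gridSum (fun t => X t ω) N m := by
  unfold gridSum
  fun_prop

lemma integrable_exp_neg [IsProbabilityMeasure P] {f : Ω → ℝ} (hf : Measurable f) (h0 : ∀ ω, 0 ≤ f ω) :
    Integrable (fun ω => Real.exp (-f ω)) P :=
  Integrable.mono' (integrable_const 1) (by fun_prop) (ae_of_all _ fun ω => by
    rw [Real.norm_eq_abs, Real.abs_exp]; exact Real.exp_le_one_iff.2 (by linarith [h0 ω]))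

/-- The Laplace transform of the grid variation of a process with stationary independent
increments. -/
lemma laplace_gridSum (hX : ∀ t, Measurable (X t)) (hind : HasIndepIncrements X P)
    (hstat : ∀ s t : ℝ≥0, IdentDistrib (fun ω => X (s + t) ω - X s ω) (X t) P P)
    (l : ℝ) (N m : ℕ) :
    ∫ ω, Real.exp (-(l * gridSum (fun t => X t ω) N m)) ∂P =
      (∫ ω, Real.exp (-(l * |X (dyadicPoint m 1) ω|)) ∂P) ^ (N * 2 ^ m) := by
  have h1 := hind.nat (dyadicPoint_mono m)
  have h2 := h1.comp (fun _ x => ‖x‖) (fun _ => measurable_norm)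
  have h3 := h2.mgf_sum (t := -l) (fun j => by
    simp only [Function.comp_def]; fun_prop) (Finset.range (N * 2 ^ m))
  have h4 : ∀ j, mgf ((fun x => ‖x‖) ∘
      fun ω => X (dyadicPoint m (j + 1)) ω - X (dyadicPoint m j) ω) P (-l) =
      ∫ ω, Real.exp (-(l * |X (dyadicPoint m 1) ω|)) ∂P := fun j => by
    have hs := hstat (dyadicPoint m j) (dyadicPoint m 1)
    have hadd : dyadicPoint m j + dyadicPoint m 1 = dyadicPoint m (j + 1) := by
      simp [dyadicPoint, add_div]
    rw [hadd] at hs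
    have := (hs.comp (u := fun x : ℝ => Real.exp (-(l * |x|))) (by fun_prop)).integral_eq
    rw [mgf]
    simpa [Function.comp_def] using this
  simp only [h4, Finset.prod_const, Finset.card_range] at h3
  rw [← h3, mgf]
  refine integral_congr_ae (ae_of_all _ fun ω => ?_)
  simp [gridSum]

/-- The Laplace transform of `|Z|` in terms of the characteristic function of `Z`. -/
lemma one_sub_laplace_abs [IsProbabilityMeasure P] {Z : Ω → ℝ} (hZ : Measurable Z) (l : ℝ) (hl : 0 ≤ l) :
    1 - ∫ ω, Real.exp (-(l * |Z ω|)) ∂P =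
      ∫ s, (1 - (charFun (P.map Z) (s * l)).re) ∂(cauchyMeasure 0 1) := by
  have h1 : ∀ s, 1 - (charFun (P.map Z) (s * l)).re = ∫ ω, (1 - Real.cos (s * (l * Z ω))) ∂P := by
    intro s
    have hi : Integrable (fun ω => Complex.exp (((s * l : ℝ) : ℂ) * (Z ω) * Complex.I)) P :=
      Integrable.mono' (integrable_const 1) (by fun_prop) (ae_of_all _ fun ω => by
        rw [← Complex.ofReal_mul, Complex.norm_exp_ofReal_mul_I])
    have hre : ∀ ω, (Complex.exp (((s * l : ℝ) : ℂ) * (Z ω) * Complex.I)).re =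
        Real.cos (s * (l * Z ω)) := fun ω => by
      rw [← Complex.ofReal_mul, Complex.exp_ofReal_mul_I_re, mul_assoc]
    have h3 := integral_re hi
    simp only [RCLike.re_eq_complex_re, hre] at h3
    rw [charFun_apply_real, integral_map hZ.aemeasurable (by fun_prop), ← h3,
      integral_sub (integrable_const 1)]
    · simp
    · exact hi.re.congr (ae_of_all _ hre)
  simp_rw [h1]
  -- Fubini, so that for each `ω` the Cauchy average of `1 - cos (s l Z)` becomes `1 - exp (-l|Z|)`.
  rw [integral_integral_swap]
  · simp_rw [integral_one_sub_cos_cauchyMeasure, abs_mul, abs_of_nonneg hl]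
    rw [integral_sub (integrable_const 1)]
    · simp
    · exact integrable_exp_neg (by fun_prop) fun ω => by positivity
  · refine Integrable.mono' (integrable_const 2) (by fun_prop) (ae_of_all _ fun p => ?_)
    simp only [Function.uncurry]
    rw [Real.norm_eq_abs, abs_le]
    constructor <;> linarith [Real.cos_le_one (p.1 * (l * Z p.2)), Real.neg_one_le_cos (p.1 * (l * Z p.2))]

end GridLaplace

/-! ### Grid variation of Lévy processes on the line -/

section FiniteVariation

variable {Ω : Type*} [MeasurableSpace Ω] {P : Measure Ω} {X : ℝ≥0 → Ω → ℝ}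

/-- Write `1 - e^a cos b = (1 - e^a) + e^a (1 - cos b)` and use `e^a ≤ 1`. The imaginary part is
kept truncated at `2`, as it will be averaged over a law without second moment. -/
lemma one_sub_re_cexp_le {z : ℂ} (hz : z.re ≤ 0) :
    1 - (Complex.exp z).re ≤ -z.re + min 2 (z.im ^ 2) := by
  rw [Complex.exp_re]
  have h1 : Real.exp z.re ≤ 1 := Real.exp_le_one_iff.2 hz
  have h2 := Real.add_one_le_exp z.re
  have h3 := Real.one_sub_sq_div_two_le_cos (x := z.im)
  have h4 : 1 - Real.cos z.im ≤ min 2 (z.im ^ 2) :=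
    le_min (by linarith [Real.neg_one_le_cos z.im]) (by nlinarith [sq_nonneg z.im])
  nlinarith [Real.exp_pos z.re, Real.cos_le_one z.im]

lemma re_cexp_I_mul_sub_one (y : ℝ) : (Complex.exp (Complex.I * y) - 1).re = Real.cos y - 1 := by
  rw [mul_comm, Complex.sub_re, Complex.exp_ofReal_mul_I_re, Complex.one_re]

lemma one_sub_cos_nonneg (y : ℝ) : 0 ≤ 1 - Real.cos y := sub_nonneg.2 (Real.cos_le_one y)

lemma one_sub_exp_neg_nonneg {y : ℝ} (hy : 0 ≤ y) : 0 ≤ 1 - Real.exp (-y) :=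
  sub_nonneg.2 (Real.exp_le_one_iff.2 (neg_nonpos.2 hy))

lemma lintegral_one_sub_cos_cauchyMeasure (x : ℝ) :
    ∫⁻ s, ENNReal.ofReal (1 - Real.cos (s * x)) ∂(cauchyMeasure 0 1) =
      ENNReal.ofReal (1 - Real.exp (-|x|)) := by
  rw [← integral_one_sub_cos_cauchyMeasure, ofReal_integral_eq_lintegral_ofReal _
    (ae_of_all _ fun s => one_sub_cos_nonneg _)]
  refine Integrable.mono' (integrable_const 2) (by fun_prop) (ae_of_all _ fun s => ?_)
  rw [Real.norm_eq_abs, abs_of_nonneg (one_sub_cos_nonneg _)]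
  linarith [Real.neg_one_le_cos (s * x)]

/-- Averaging `∫ (1 - cos (s l x)) ν(dx)` over a Cauchy distributed `s`. -/
lemma lintegral_lintegral_one_sub_cos (ν : Measure ℝ) [SFinite ν] {l : ℝ} (hl : 0 ≤ l) :
    ∫⁻ s, ∫⁻ x, ENNReal.ofReal (1 - Real.cos (s * (l * x))) ∂ν ∂(cauchyMeasure 0 1) =
      ∫⁻ x, ENNReal.ofReal (1 - Real.exp (-(l * |x|))) ∂ν := by
  rw [lintegral_lintegral_swap (by fun_prop)]
  simp_rw [lintegral_one_sub_cos_cauchyMeasure, abs_mul, abs_of_nonneg hl]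

section Jumps

variable {ν : Measure ℝ}

lemma norm_cexp_sub_one_le_min (s x : ℝ) :
    ‖Complex.exp (Complex.I * (s * x : ℝ)) - 1‖ ≤ (|s| + 2) * min |x| 1 := by
  have h1 : ‖Complex.exp (Complex.I * (s * x : ℝ)) - 1‖ ≤ ‖s * x‖ :=
    Real.norm_exp_I_mul_ofReal_sub_one_le
  have h2 := norm_cexp_I_sub_one_le_two (s * x)
  rw [Real.norm_eq_abs, abs_mul] at h1
  rcases le_total |x| 1 with h | h
  · rw [min_eq_left h]; nlinarith [abs_nonneg s, abs_nonneg x]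
  · rw [min_eq_right h]; nlinarith [abs_nonneg s, abs_nonneg x]

lemma integrable_cexp_sub_one (hν : Integrable (fun x => min |x| 1) ν) (s : ℝ) :
    Integrable (fun x : ℝ => Complex.exp (Complex.I * (s * x : ℝ)) - 1) ν :=
  Integrable.mono' (hν.const_mul _) (by fun_prop)
    (ae_of_all _ fun x => norm_cexp_sub_one_le_min s x)

lemma integrable_one_sub_exp (hν : Integrable (fun x => min |x| 1) ν) {l : ℝ} (hl : 0 ≤ l) :
    Integrable (fun x : ℝ => 1 - Real.exp (-(l * |x|))) ν := by
  refine Integrable.mono' (hν.const_mul (l + 1)) (by fun_prop) (ae_of_all _ fun x => ?_)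
  rw [Real.norm_eq_abs, abs_of_nonneg (one_sub_exp_neg_nonneg (by positivity))]
  have h1 := Real.add_one_le_exp (-(l * |x|))
  have h2 := Real.exp_pos (-(l * |x|))
  rcases le_total |x| 1 with h | h
  · rw [min_eq_left h]; nlinarith [abs_nonneg x]
  · rw [min_eq_right h]; nlinarith [abs_nonneg x]

/-- The Cauchy average of `1 - Re exp (h ψ(sl))` has two sources. The real part of `ψ` averages
exactly to the jump integral. The imaginary part, of size at most `(|sl| + 2) κ`, contributes `4hκl
+ 8(hκ)²`. The first of these is only of order `h`, but its factor `l` makes it vanish when `l → 0`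
after the mesh has gone to zero. -/
lemma one_sub_laplace_le (hν : Integrable (fun x => min |x| 1) ν)
    [IsProbabilityMeasure P] [SFinite ν] {Z : Ω → ℝ} (hZ : Measurable Z)
    {h : ℝ} (hh : 0 ≤ h)
    (hchar : ∀ s : ℝ, charFun (P.map Z) s =
      Complex.exp (h * ∫ x, (Complex.exp (Complex.I * (s * x : ℝ)) - 1) ∂ν))
    {l : ℝ} (hl : 0 ≤ l) :
    1 - ∫ ω, Real.exp (-(l * |Z ω|)) ∂P ≤ h * ∫ x, (1 - Real.exp (-(l * |x|))) ∂ν +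
      4 * (h * (∫ x, min |x| 1 ∂ν) * l) + 8 * (h * ∫ x, min |x| 1 ∂ν) ^ 2 := by
  set κ := ∫ x, min |x| 1 ∂ν with hκ
  have hκ0 : 0 ≤ κ := integral_nonneg fun x => by positivity
  have hI0 : 0 ≤ ∫ x, (1 - Real.exp (-(l * |x|))) ∂ν :=
    integral_nonneg fun x => one_sub_exp_neg_nonneg (by positivity)
  set ψ : ℝ → ℂ := fun s => ∫ x, (Complex.exp (Complex.I * (s * x : ℝ)) - 1) ∂ν with hψ
  have hre : ∀ s, (ψ s).re = -∫ x, (1 - Real.cos (s * x)) ∂ν := fun s => by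
    have := integral_re (integrable_cexp_sub_one hν s)
    simp only [RCLike.re_eq_complex_re, re_cexp_I_mul_sub_one] at this
    rw [hψ, ← this, ← integral_neg]
    simp
  have hnorm : ∀ s, ‖ψ s‖ ≤ (|s| + 2) * κ := fun s => by
    rw [hκ, ← integral_const_mul]
    exact norm_integral_le_of_norm_le (hν.const_mul _)
      (ae_of_all _ fun x => norm_cexp_sub_one_le_min s x)
  have hcosint : ∀ s : ℝ, Integrable (fun x => 1 - Real.cos (s * x)) ν := fun s => by
    refine (integrable_cexp_sub_one hν s).re.neg.congr (ae_of_all _ fun x => ?_)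
    simp only [Pi.neg_apply, RCLike.re_eq_complex_re, re_cexp_I_mul_sub_one]
    ring
  have hpt : ∀ s, 1 - (charFun (P.map Z) (s * l)).re ≤
      h * (∫ x, (1 - Real.cos (s * (l * x))) ∂ν) + 2 * min 1 ((h * κ * l * s) ^ 2) +
        8 * (h * κ) ^ 2 := fun s => by
    have hz : ((h : ℂ) * ψ (s * l)).re ≤ 0 := by
      rw [Complex.re_ofReal_mul, hre]
      have : 0 ≤ ∫ x, (1 - Real.cos (s * l * x)) ∂ν := integral_nonneg fun x => one_sub_cos_nonneg _
      nlinarith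
    have h1 := one_sub_re_cexp_le hz
    rw [hchar]
    refine h1.trans ?_
    rw [Complex.re_ofReal_mul, hre, Complex.im_ofReal_mul]
    have h2 : |(ψ (s * l)).im| ≤ (|s * l| + 2) * κ := (Complex.abs_im_le_norm _).trans (hnorm _)
    have h3 : (h * (ψ (s * l)).im) ^ 2 ≤ 2 * (h * κ * l * s) ^ 2 + 8 * (h * κ) ^ 2 := by
      have h4 : (h * (ψ (s * l)).im) ^ 2 ≤ (h * ((|s * l| + 2) * κ)) ^ 2 := by
        refine sq_le_sq.2 ?_
        rw [abs_mul, abs_mul, abs_of_nonneg hh]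
        exact mul_le_mul_of_nonneg_left (h2.trans (le_abs_self _)) hh
      have h5 : (h * κ * l * s) ^ 2 = (h * κ * |s * l|) ^ 2 := by
        rw [mul_pow _ |s * l|, sq_abs]; ring
      rw [h5]
      nlinarith [sq_nonneg (h * κ * |s * l| - 2 * (h * κ))]
    -- Only the part growing with `s` needs the truncation; the constant part is already of order
    -- `h²`.
    have h6 : min 2 ((h * (ψ (s * l)).im) ^ 2) ≤
        2 * min 1 ((h * κ * l * s) ^ 2) + 8 * (h * κ) ^ 2 := by
      rcases le_total 1 ((h * κ * l * s) ^ 2) with h7 | h7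
      · rw [min_eq_left h7]
        exact (min_le_left _ _).trans (by nlinarith [sq_nonneg (h * κ)])
      · rw [min_eq_right h7]
        exact (min_le_right _ _).trans h3
    simp only [mul_assoc] at h6 ⊢
    linarith
  have hre1 : ∀ s, (charFun (P.map Z) s).re ≤ 1 := fun s => by
    have : IsProbabilityMeasure (P.map Z) := Measure.isProbabilityMeasure_map hZ.aemeasurable
    exact (Complex.re_le_norm _).trans (norm_charFun_le_one s)
  rw [one_sub_laplace_abs hZ l hl, ← ENNReal.ofReal_le_ofReal_iff (by positivity),
    ofReal_integral_eq_lintegral_ofReal _ (ae_of_all _ fun s => sub_nonneg.2 (hre1 _))]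
  · calc ∫⁻ s, ENNReal.ofReal (1 - (charFun (P.map Z) (s * l)).re) ∂(cauchyMeasure 0 1)
        ≤ ∫⁻ s, (ENNReal.ofReal h * (∫⁻ x, ENNReal.ofReal (1 - Real.cos (s * (l * x))) ∂ν) +
          2 * ENNReal.ofReal (min 1 ((h * κ * l * s) ^ 2)) +
          ENNReal.ofReal (8 * (h * κ) ^ 2)) ∂(cauchyMeasure 0 1) := by
          refine lintegral_mono fun s => ?_
          refine (ENNReal.ofReal_le_ofReal (hpt s)).trans ?_
          have h0 : 0 ≤ ∫ x, (1 - Real.cos (s * (l * x))) ∂ν :=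
            integral_nonneg fun x => one_sub_cos_nonneg _
          rw [ENNReal.ofReal_add (by positivity) (by positivity),
            ENNReal.ofReal_add (by positivity) (by positivity), ENNReal.ofReal_mul hh,
            ENNReal.ofReal_mul zero_le_two, ofReal_integral_eq_lintegral_ofReal _
            (ae_of_all _ fun x => one_sub_cos_nonneg _)]
          · simp
          · simpa only [mul_assoc] using hcosint (s * l)
      _ = ENNReal.ofReal h * (∫⁻ x, ENNReal.ofReal (1 - Real.exp (-(l * |x|))) ∂ν) +
          2 * (∫⁻ s, ENNReal.ofReal (min 1 ((h * κ * l * s) ^ 2)) ∂(cauchyMeasure 0 1)) +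
          ENNReal.ofReal (8 * (h * κ) ^ 2) := by
          rw [lintegral_add_right _ (by fun_prop), lintegral_add_right _ (by fun_prop),
            lintegral_const_mul' _ _ ENNReal.ofReal_ne_top, lintegral_const_mul' _ _ (by simp),
            lintegral_lintegral_one_sub_cos ν hl]
          simp
      _ ≤ ENNReal.ofReal h * (∫⁻ x, ENNReal.ofReal (1 - Real.exp (-(l * |x|))) ∂ν) +
          2 * ENNReal.ofReal (2 * (h * κ * l)) + ENNReal.ofReal (8 * (h * κ) ^ 2) := by
          gcongr
          exact lintegral_min_sq_cauchyMeasure_le (by positivity)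
      _ = _ := by
          rw [ENNReal.ofReal_add (by positivity) (by positivity),
            ENNReal.ofReal_add (by positivity) (by positivity), ENNReal.ofReal_mul hh,
            ofReal_integral_eq_lintegral_ofReal (integrable_one_sub_exp hν hl)
            (ae_of_all _ fun x => one_sub_exp_neg_nonneg (by positivity)),
            show 4 * (h * κ * l) = 2 * (2 * (h * κ * l)) by ring, ENNReal.ofReal_mul zero_le_two]
          simp
  · have : IsProbabilityMeasure (P.map Z) := Measure.isProbabilityMeasure_map hZ.aemeasurable
    have hm : Measurable fun s => (charFun (P.map Z) (s * l)).re :=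
      Complex.measurable_re.comp (measurable_charFun.comp (measurable_id.mul_const l))
    refine Integrable.mono' (integrable_const 2) (by fun_prop) (ae_of_all _ fun s => ?_)
    have := (abs_le.1 ((Complex.abs_re_le_norm _).trans
      (norm_charFun_le_one (μ := P.map Z) (s * l)))).1
    rw [Real.norm_eq_abs, abs_of_nonneg (sub_nonneg.2 (hre1 _))]
    linarith

/-- Fatou's lemma for the event that the grid variations are unbounded. -/
lemma measure_not_bddAbove_gridSum_le [IsProbabilityMeasure P] (hX : ∀ t, Measurable (X t))
    {N : ℕ} {l : ℝ} (hl : 0 < l) {c : ℕ → ℝ} {C : ℝ} (hc : Tendsto c atTop (𝓝 C))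
    (hle : ∀ m, 1 - ∫ ω, Real.exp (-(l * gridSum (fun t => X t ω) N m)) ∂P ≤ c m) :
    P {ω | ¬ BddAbove (range (gridSum (fun t => X t ω) N))} ≤ ENNReal.ofReal C := by
  have hmeas : ∀ m, Measurable fun ω => gridSum (fun t => X t ω) N m := measurable_gridSum hX N
  let F : ℕ → Ω → ℝ≥0∞ := fun m ω =>
    ENNReal.ofReal (1 - Real.exp (-(l * gridSum (fun t => X t ω) N m)))
  have hF : ∀ m, Measurable (F m) := fun m => by
    have := hmeas m
    fun_prop
  have hFle : ∀ m, ∫⁻ ω, F m ω ∂P ≤ ENNReal.ofReal (c m) := fun m => by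
    have hi : Integrable (fun ω => Real.exp (-(l * gridSum (fun t => X t ω) N m))) P :=
      integrable_exp_neg ((hmeas m).const_mul l) fun ω => mul_nonneg hl.le (gridSum_nonneg _ _ _)
    rw [← ofReal_integral_eq_lintegral_ofReal
      (f := fun ω => 1 - Real.exp (-(l * gridSum (fun t => X t ω) N m)))
      ((integrable_const 1).sub hi) (ae_of_all _ fun ω => one_sub_exp_neg_nonneg (mul_nonneg hl.le (gridSum_nonneg _ _ _))),
      integral_sub (integrable_const 1) hi]
    exact ENNReal.ofReal_le_ofReal (by simpa using hle m)
  -- Grid variations increase with the level, so unbounded means divergent to infinity, and then `F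
  -- m ω` tends to `1`.
  have hlim : ∀ ω ∈ {ω | ¬ BddAbove (range (gridSum (fun t => X t ω) N))},
      1 ≤ liminf (fun m => F m ω) atTop := fun ω hω => by
    have h1 : Tendsto (gridSum (fun t => X t ω) N) atTop atTop :=
      tendsto_atTop_atTop_of_monotone' (gridSum_mono _ N) hω
    have h2 : Tendsto (fun m => F m ω) atTop (𝓝 (ENNReal.ofReal (1 - 0))) := by
      refine ENNReal.tendsto_ofReal (tendsto_const_nhds.sub ?_)
      exact Real.tendsto_exp_neg_atTop_nhds_zero.comp (h1.const_mul_atTop hl)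
    rw [h2.liminf_eq]
    simp
  calc P {ω | ¬ BddAbove (range (gridSum (fun t => X t ω) N))}
      ≤ P {ω | 1 ≤ liminf (fun m => F m ω) atTop} := measure_mono hlim
    _ ≤ ∫⁻ ω, liminf (fun m => F m ω) atTop ∂P := by
        have := mul_meas_ge_le_lintegral (μ := P) (Measurable.liminf hF) 1
        simpa using this
    _ ≤ liminf (fun m => ∫⁻ ω, F m ω ∂P) atTop := lintegral_liminf_le hF
    _ ≤ liminf (fun m => ENNReal.ofReal (c m)) atTop := liminf_le_liminf (Eventually.of_forall hFle)
    _ = ENNReal.ofReal C := (ENNReal.tendsto_ofReal hc).liminf_eq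

lemma tendsto_dyadicPoint_one : Tendsto (fun m => ((dyadicPoint m 1 : ℝ≥0) : ℝ)) atTop (𝓝 0) := by
  have : ∀ m, ((dyadicPoint m 1 : ℝ≥0) : ℝ) = (1 / 2 : ℝ) ^ m := fun m => by
    simp [dyadicPoint]
  simp_rw [this]
  exact tendsto_pow_atTop_nhds_zero_of_lt_one (by norm_num) (by norm_num)

lemma natCast_mul_dyadicPoint_one (N m : ℕ) :
    ((N * 2 ^ m : ℕ) : ℝ) * (dyadicPoint m 1 : ℝ≥0) = N := by
  simp [dyadicPoint]

/-- A Lévy process on the line without Gaussian part and drift, and with summable jumps, has grid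
variations which are almost surely bounded. -/
theorem ae_bddAbove_gridSum (hν : Integrable (fun x => min |x| 1) ν) [IsProbabilityMeasure P]
    [SFinite ν] (hX : ∀ t, Measurable (X t)) (hind : HasIndepIncrements X P)
    (hstat : ∀ s t : ℝ≥0, IdentDistrib (fun ω => X (s + t) ω - X s ω) (X t) P P)
    (hchar : ∀ (h : ℝ≥0) (s : ℝ), charFun (P.map (X h)) s =
      Complex.exp ((h : ℝ) * ∫ x, (Complex.exp (Complex.I * (s * x : ℝ)) - 1) ∂ν)) (N : ℕ) :
    ∀ᵐ ω ∂P, BddAbove (range (gridSum (fun t => X t ω) N)) := by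
  set κ := ∫ x, min |x| 1 ∂ν with hκ
  have hκ0 : 0 ≤ κ := integral_nonneg fun x => by positivity
  -- The bound left after the mesh tends to zero with `l` fixed; it tends to `0` as `l → 0` by
  -- dominated convergence.
  let K : ℝ → ℝ := fun l => N * ((∫ x, (1 - Real.exp (-(l * |x|))) ∂ν) + 4 * (κ * l))
  have hK : ∀ l : ℝ, 0 < l →
      P {ω | ¬ BddAbove (range (gridSum (fun t => X t ω) N))} ≤ ENNReal.ofReal (K l) := by
    intro l hl
    refine measure_not_bddAbove_gridSum_le hX hl
      (c := fun m => K l + N * (8 * κ ^ 2 * (dyadicPoint m 1 : ℝ≥0))) ?_ fun m => ?_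
    · have := ((tendsto_dyadicPoint_one.const_mul (8 * κ ^ 2)).const_mul (N : ℝ)).const_add (K l)
      simpa using this
    · rw [laplace_gridSum hX hind hstat]
      set p := ∫ ω, Real.exp (-(l * |X (dyadicPoint m 1) ω|)) ∂P with hp
      have hp0 : 0 ≤ p := integral_nonneg fun ω => (Real.exp_pos _).le
      have h1 := one_sub_laplace_le hν (hX (dyadicPoint m 1)) (NNReal.coe_nonneg _)
        (hchar (dyadicPoint m 1)) hl.le
      rw [← hp, ← hκ] at h1
      -- Bernoulli: `1 - p^k ≤ k (1 - p)` with `k = N * 2 ^ m` increments of length `h`, so that `k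
      -- h = N`.
      have h2 := one_add_mul_le_pow (a := p - 1) (by linarith) (N * 2 ^ m)
      rw [add_sub_cancel] at h2
      have h3 := natCast_mul_dyadicPoint_one N m
      set h : ℝ := ((dyadicPoint m 1 : ℝ≥0) : ℝ)
      have h4 : ((N * 2 ^ m : ℕ) : ℝ) * (1 - p) ≤ ((N * 2 ^ m : ℕ) : ℝ) *
          (h * ∫ x, (1 - Real.exp (-(l * |x|))) ∂ν + 4 * (h * κ * l) + 8 * (h * κ) ^ 2) := by
        gcongr
      have h5 : ((N * 2 ^ m : ℕ) : ℝ) *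
          (h * ∫ x, (1 - Real.exp (-(l * |x|))) ∂ν + 4 * (h * κ * l) + 8 * (h * κ) ^ 2) =
          K l + N * (8 * κ ^ 2 * h) := by
        simp only [K]
        rw [← h3]
        ring
      linarith
  have hlim : Tendsto (fun n : ℕ => K (1 / ((n : ℝ) + 1))) atTop (𝓝 0) := by
    have hl := tendsto_one_div_add_atTop_nhds_zero_nat (𝕜 := ℝ)
    have h1 : Tendsto (fun n : ℕ => ∫ x, (1 - Real.exp (-(1 / ((n : ℝ) + 1) * |x|))) ∂ν) atTop
        (𝓝 (∫ x : ℝ, (0 : ℝ) ∂ν)) := by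
      refine tendsto_integral_of_dominated_convergence (fun x => 1 - Real.exp (-(1 * |x|)))
        (fun n => by fun_prop) (integrable_one_sub_exp hν zero_le_one) (fun n => ae_of_all _ fun x => ?_)
        (ae_of_all _ fun x => ?_)
      · rw [Real.norm_eq_abs, abs_of_nonneg (one_sub_exp_neg_nonneg (by positivity))]
        have : 1 / ((n : ℝ) + 1) ≤ 1 := by
          rw [div_le_one (by positivity)]; linarith [(Nat.cast_nonneg n : (0 : ℝ) ≤ n)]
        gcongr
      · have h2 : Tendsto (fun n : ℕ => 1 - Real.exp (-(1 / ((n : ℝ) + 1) * |x|))) atTop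
            (𝓝 (1 - Real.exp (-(0 * |x|)))) :=
          tendsto_const_nhds.sub ((Real.continuous_exp.tendsto _).comp (hl.mul_const _).neg)
        simpa using h2
    rw [integral_zero] at h1
    have h2 := (h1.add ((hl.const_mul κ).const_mul 4)).const_mul (N : ℝ)
    simpa [K] using h2
  have h0 : P {ω | ¬ BddAbove (range (gridSum (fun t => X t ω) N))} ≤ ENNReal.ofReal 0 :=
    ge_of_tendsto' (ENNReal.tendsto_ofReal hlim) fun n => hK _ (by positivity)
  rw [ENNReal.ofReal_zero] at h0
  exact le_antisymm h0 (zero_le)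

end Jumps

/-- If the grid variations are almost surely bounded, then `1 - E exp (-|X h|)` is of order `h`
along dyadic `h`. -/
lemma exists_one_sub_laplace_le [IsProbabilityMeasure P] (hX : ∀ t, Measurable (X t))
    (hind : HasIndepIncrements X P)
    (hstat : ∀ s t : ℝ≥0, IdentDistrib (fun ω => X (s + t) ω - X s ω) (X t) P P)
    (hb : ∀ᵐ ω ∂P, BddAbove (range (gridSum (fun t => X t ω) 1))) :
    ∃ C : ℝ, ∀ m, 1 - ∫ ω, Real.exp (-|X (dyadicPoint m 1) ω|) ∂P ≤
      C * (dyadicPoint m 1 : ℝ≥0) := by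
  have hmeas : ∀ m, Measurable fun ω => gridSum (fun t => X t ω) 1 m := measurable_gridSum hX 1
  let A : ℕ → Set Ω := fun K => {ω | ∀ m, gridSum (fun t => X t ω) 1 m ≤ K}
  have hAm : ∀ K, MeasurableSet (A K) := fun K => by
    simp only [A, ofPred_forall]
    exact MeasurableSet.iInter fun m => measurableSet_le (hmeas m) measurable_const
  -- The sets `A K` cover almost every `ω`, so one of them has positive probability. This keeps the
  -- Laplace transforms of all grid variations above a common `c > 0`.
  obtain ⟨K, hK⟩ : ∃ K, P (A K) ≠ 0 := by
    by_contra! hall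
    have h1 := measure_iUnion_null hall
    have h2 : ∀ᵐ ω ∂P, ω ∈ ⋃ K, A K := by
      filter_upwards [hb] with ω hω
      obtain ⟨C, hC⟩ := hω
      obtain ⟨K, hK⟩ := exists_nat_ge C
      exact mem_iUnion.2 ⟨K, fun m => (hC ⟨m, rfl⟩).trans hK⟩
    have h3 : ∀ᵐ ω ∂P, False := by
      filter_upwards [h2, measure_eq_zero_iff_ae_notMem.1 h1] with ω ha hb using hb ha
    exact IsProbabilityMeasure.ne_zero P (by simpa using h3)
  set c := Real.exp (-K) * P.real (A K) with hc
  have hc0 : 0 < c := mul_pos (Real.exp_pos _) (ENNReal.toReal_pos hK (measure_ne_top _ _))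
  refine ⟨-Real.log c, fun m => ?_⟩
  have hlap := laplace_gridSum hX hind hstat 1 1 m
  simp only [one_mul] at hlap
  set p := ∫ ω, Real.exp (-|X (dyadicPoint m 1) ω|) ∂P with hp
  have hp0 : 0 ≤ p := integral_nonneg fun ω => (Real.exp_pos _).le
  have hcp : c ≤ p ^ 2 ^ m := by
    rw [← hlap, hc, mul_comm, ← smul_eq_mul, ← setIntegral_const]
    have hi : Integrable (fun ω => Real.exp (-(gridSum (fun t => X t ω) 1 m))) P :=
      integrable_exp_neg (hmeas m) fun ω => gridSum_nonneg _ _ _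
    refine (setIntegral_mono_on (integrable_const _).integrableOn hi.integrableOn (hAm K)
      fun ω hω => ?_).trans (setIntegral_le_integral hi (ae_of_all _ fun ω => (Real.exp_pos _).le))
    exact Real.exp_le_exp.2 (neg_le_neg (hω m))
  -- Combined with `c ≤ p ^ 2 ^ m`, taking logarithms gives `1 - p ≤ -log c / 2 ^ m`.
  have h1 : p ^ 2 ^ m ≤ Real.exp (-((2 : ℝ) ^ m * (1 - p))) := by
    have h2 : p ≤ Real.exp (p - 1) := by linarith [Real.add_one_le_exp (p - 1)]
    calc p ^ 2 ^ m ≤ Real.exp (p - 1) ^ 2 ^ m := by gcongr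
      _ = _ := by
        rw [← Real.exp_nat_mul]
        congr 1
        push_cast
        ring
  have h3 := Real.log_le_log hc0 (hcp.trans h1)
  rw [Real.log_exp] at h3
  have h4 : ((dyadicPoint m 1 : ℝ≥0) : ℝ) = ((2 : ℝ) ^ m)⁻¹ := by simp [dyadicPoint]
  rw [h4, ← div_eq_mul_inv, le_div_iff₀ (by positivity)]
  linarith

/-- This is the derivative of `t ↦ exp (tz)` at `0`; it recovers the Lévy exponent from short times.
-/
lemma tendsto_one_sub_re_cexp_div (z : ℂ) {h : ℕ → ℝ} (h0 : ∀ m, 0 < h m)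
    (hlim : Tendsto h atTop (𝓝 0)) :
    Tendsto (fun m => (1 - (Complex.exp (h m * z)).re) / h m) atTop (𝓝 (-z.re)) := by
  have hd : HasDerivAt (fun t : ℝ => Complex.exp (t * z)) z 0 := by
    have := ((Complex.ofRealCLM.hasDerivAt (x := 0)).mul_const z).cexp
    simpa using this
  have h1 := hd.tendsto_slope_zero.comp
    (tendsto_nhdsWithin_iff.2 ⟨hlim, Eventually.of_forall fun m => (h0 m).ne'⟩)
  have h2 := (Complex.continuous_re.tendsto _).comp h1
  refine h2.neg.congr fun m => ?_
  simp only [Function.comp_apply, zero_add, Complex.ofReal_zero, zero_mul, Complex.exp_zero,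
    Complex.smul_re, Complex.sub_re, Complex.one_re, smul_eq_mul]
  rw [div_eq_inv_mul]
  ring

/-- If a Lévy process on the line has almost surely bounded grid variations, then the real part of
its exponent is integrable with respect to the Cauchy distribution. -/
theorem lintegral_re_exponent_lt_top [IsProbabilityMeasure P] (hX : ∀ t, Measurable (X t))
    (hind : HasIndepIncrements X P)
    (hstat : ∀ s t : ℝ≥0, IdentDistrib (fun ω => X (s + t) ω - X s ω) (X t) P P)
    (hb : ∀ᵐ ω ∂P, BddAbove (range (gridSum (fun t => X t ω) 1))) {ψ : ℝ → ℂ}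
    (hchar : ∀ (h : ℝ≥0) (s : ℝ), charFun (P.map (X h)) s = Complex.exp ((h : ℝ) * ψ s)) :
    ∫⁻ s, ENNReal.ofReal (-(ψ s).re) ∂(cauchyMeasure 0 1) < ∞ := by
  obtain ⟨C, hC⟩ := exists_one_sub_laplace_le hX hind hstat hb
  have hpos : ∀ m, 0 < ((dyadicPoint m 1 : ℝ≥0) : ℝ) := fun m => by simp [dyadicPoint]
  let F : ℕ → ℝ → ℝ := fun m s =>
    (1 - (charFun (P.map (X (dyadicPoint m 1))) s).re) / (dyadicPoint m 1 : ℝ≥0)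
  have hprob : ∀ m, IsProbabilityMeasure (P.map (X (dyadicPoint m 1))) := fun m =>
    Measure.isProbabilityMeasure_map (hX _).aemeasurable
  have hFm : ∀ m, Measurable (F m) := fun m =>
    (measurable_const.sub (Complex.measurable_re.comp measurable_charFun)).div_const _
  have hF0 : ∀ m s, 0 ≤ F m s := fun m s =>
    div_nonneg (sub_nonneg.2 ((Complex.re_le_norm _).trans (norm_charFun_le_one s))) (hpos m).le
  have hFlim : ∀ s, Tendsto (fun m => F m s) atTop (𝓝 (-(ψ s).re)) := fun s => by
    simp only [F, hchar]
    exact tendsto_one_sub_re_cexp_div _ hpos tendsto_dyadicPoint_one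
  have hFint : ∀ m, ∫⁻ s, ENNReal.ofReal (F m s) ∂(cauchyMeasure 0 1) ≤ ENNReal.ofReal C := by
    intro m
    rw [← ofReal_integral_eq_lintegral_ofReal _ (ae_of_all _ (hF0 m))]
    · refine ENNReal.ofReal_le_ofReal ?_
      simp only [F]
      rw [integral_div, div_le_iff₀ (hpos m)]
      have := one_sub_laplace_abs (P := P) (hX (dyadicPoint m 1)) 1 zero_le_one
      simp only [one_mul, mul_one] at this
      rw [← this]
      exact hC m
    · refine Integrable.mono' (integrable_const (2 / (dyadicPoint m 1 : ℝ≥0) : ℝ))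
        (hFm m).aestronglyMeasurable (ae_of_all _ fun s => ?_)
      rw [Real.norm_eq_abs, abs_of_nonneg (hF0 m s)]
      have h1 := (abs_le.1 ((Complex.abs_re_le_norm _).trans
        (norm_charFun_le_one (μ := P.map (X (dyadicPoint m 1))) s))).1
      have := (hpos m).le
      simp only [F]
      gcongr
      linarith
  -- Fatou: the difference quotients converge to `-Re ψ`, and their Cauchy averages are bounded by
  -- `C`.
  calc ∫⁻ s, ENNReal.ofReal (-(ψ s).re) ∂(cauchyMeasure 0 1)
      = ∫⁻ s, liminf (fun m => ENNReal.ofReal (F m s)) atTop ∂(cauchyMeasure 0 1) :=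
        lintegral_congr fun s => ((ENNReal.tendsto_ofReal (hFlim s)).liminf_eq).symm
    _ ≤ liminf (fun m => ∫⁻ s, ENNReal.ofReal (F m s) ∂(cauchyMeasure 0 1)) atTop :=
        lintegral_liminf_le fun m => (hFm m).ennreal_ofReal
    _ ≤ liminf (fun _ => ENNReal.ofReal C) atTop :=
        liminf_le_liminf (Eventually.of_forall hFint)
    _ < ∞ := by simp

end FiniteVariation

/-! ### s-finiteness of Lévy and Thorin measures -/

section SFinite

/-- The measure with density `f` is finite, and dividing by `f` recovers `ν`. This is what licenses
Tonelli for Lévy and Thorin measures, which may be infinite. -/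
lemma sFinite_of_lintegral_lt_top {α : Type*} [MeasurableSpace α] {ν : Measure α} {f : α → ℝ≥0∞}
    (hf : Measurable f) (h0 : ∀ᵐ x ∂ν, f x ≠ 0) (htop : ∀ x, f x ≠ ∞) (hint : ∫⁻ x, f x ∂ν ≠ ∞) :
    SFinite ν := by
  have := isFiniteMeasure_withDensity hint
  rw [← withDensity_inv_same hf h0 (ae_of_all _ htop)]
  infer_instance

variable {ι : Type*} [Fintype ι]

lemma IsLevyMeasure.sFinite {ν : Measure (EuclideanSpace ℝ ι)} (hν : IsLevyMeasure ν) :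
    SFinite ν := by
  refine sFinite_of_lintegral_lt_top (f := fun x => ENNReal.ofReal (min (‖x‖ ^ 2) 1)) (by fun_prop)
    ?_ (fun _ => ENNReal.ofReal_ne_top) hν.2.ne
  have : {0}ᶜ ∈ ae ν := compl_mem_ae_iff.2 hν.1
  filter_upwards [this] with x hx
  have hx0 : 0 < ‖x‖ := norm_pos_iff.2 hx
  simp only [ne_eq, ENNReal.ofReal_eq_zero, not_le]
  positivity

lemma IsThorinMeasure.ae_mem {U : Measure (EuclideanSpace ℝ ι)} (hU : IsThorinMeasure U) :
    ∀ᵐ u ∂U, u ∈ puncturedOrthant ι := mem_ae_iff.2 hU.1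

lemma thorinWeight_pos {x : ℝ} (hx : 0 < x) :
    0 < min (1 + max 0 (-Real.log x)) (1 / x) := by
  refine lt_min ?_ (by positivity)
  linarith [le_max_left 0 (-Real.log x)]

lemma IsThorinMeasure.sFinite {U : Measure (EuclideanSpace ℝ ι)} (hU : IsThorinMeasure U) :
    SFinite U := by
  refine sFinite_of_lintegral_lt_top
    (f := fun u => ENNReal.ofReal (min (1 + max 0 (-Real.log ‖u‖)) (1 / ‖u‖))) (by fun_prop)
    ?_ (fun _ => ENNReal.ofReal_ne_top) hU.2.ne
  filter_upwards [hU.ae_mem] with u hu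
  simp only [ne_eq, ENNReal.ofReal_eq_zero, not_le]
  exact thorinWeight_pos (norm_pos_iff.2 hu.2)

end SFinite

/-! ### The Lévy measure attached to a Thorin measure -/

section ThorinLevyMeasure

/-- The Lévy measure `exp (-r) / r dr` of the gamma process. -/
def gammaLevyMeasure : Measure ℝ :=
  (volume.restrict (Ioi 0)).withDensity fun r => ENNReal.ofReal (Real.exp (-r) / r)

instance : SFinite gammaLevyMeasure := by unfold gammaLevyMeasure; infer_instance

lemma lintegral_gammaLevyMeasure {f : ℝ → ℝ≥0∞} (hf : Measurable f) :
    ∫⁻ r, f r ∂gammaLevyMeasure = ∫⁻ r in Ioi 0, ENNReal.ofReal (Real.exp (-r) / r) * f r := by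
  rw [gammaLevyMeasure, lintegral_withDensity_eq_lintegral_mul _ (by fun_prop) hf]
  rfl

lemma ae_gammaLevyMeasure_pos : ∀ᵐ r ∂gammaLevyMeasure, 0 < r :=
  (withDensity_absolutelyContinuous _ _).ae_le (ae_restrict_mem measurableSet_Ioi)

/-- Frullani's integral for the gamma process. -/
lemma lintegral_one_sub_exp_gammaLevyMeasure {a : ℝ} (ha : 0 ≤ a) :
    ∫⁻ r, ENNReal.ofReal (1 - Real.exp (-(a * r))) ∂gammaLevyMeasure =
      ENNReal.ofReal (Real.log (1 + a)) := by
  have hcont : Continuous fun x : ℝ => Real.exp (-x) := by fun_prop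
  have heq : ∀ r : ℝ, r⁻¹ • (Real.exp (-(1 * r)) - Real.exp (-((1 + a) * r))) =
      Real.exp (-r) / r * (1 - Real.exp (-(a * r))) := fun r => by
    rw [smul_eq_mul, show -((1 + a) * r) = -r + -(a * r) by ring, Real.exp_add]
    ring_nf
  have hint : IntegrableOn
      (fun r : ℝ => r⁻¹ • (Real.exp (-(1 * r)) - Real.exp (-((1 + a) * r)))) (Ioi 0) := by
    simp only [heq]
    refine Integrable.mono' ((integrableOn_exp_neg_Ioi 0).const_mul a) (by fun_prop) ?_
    refine (ae_restrict_iff' measurableSet_Ioi).2 (ae_of_all _ fun r hr => ?_)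
    have hr0 : 0 < r := hr
    have h1 : 0 ≤ 1 - Real.exp (-(a * r)) := one_sub_exp_neg_nonneg (by positivity)
    have h2 := Real.add_one_le_exp (-(a * r))
    rw [Real.norm_eq_abs, abs_of_nonneg (by positivity)]
    calc Real.exp (-r) / r * (1 - Real.exp (-(a * r))) ≤ Real.exp (-r) / r * (a * r) := by
          gcongr; linarith
      _ = a * Real.exp (-r) := by field_simp
  -- Factoring out `e^{-r}` writes the integrand as `(e^{-r} - e^{-(1+a)r})/r`, a Frullani integral
  -- with endpoint values `1` at zero and `0` at infinity.
  have hF := Frullani.integral_Ioi_eq (f := fun x : ℝ => Real.exp (-x)) (a := 1) (b := 1 + a)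
    (L := 1) (R := 0) (hcont.locallyIntegrable.locallyIntegrableOn _) one_pos (by linarith)
    (by simpa only [neg_zero, Real.exp_zero] using
      (hcont.tendsto 0).mono_left (nhdsWithin_le_nhds (s := Ioi 0)))
    Real.tendsto_exp_neg_atTop_nhds_zero hint
  simp only [heq] at hF hint
  rw [lintegral_gammaLevyMeasure (by fun_prop)]
  have h3 : Real.log (1 + a) = ∫ r in Ioi 0, Real.exp (-r) / r * (1 - Real.exp (-(a * r))) := by
    rw [hF]; simp
  rw [h3, ofReal_integral_eq_lintegral_ofReal hint]
  · refine setLIntegral_congr_fun measurableSet_Ioi fun r hr => ?_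
    have hr0 : 0 < r := hr
    rw [ENNReal.ofReal_mul (by positivity)]
  · refine (ae_restrict_iff' measurableSet_Ioi).2 (ae_of_all _ fun r hr => ?_)
    have hr0 : 0 < r := hr
    have h1 : 0 ≤ 1 - Real.exp (-(a * r)) := one_sub_exp_neg_nonneg (by positivity)
    simp only [Pi.zero_apply]
    positivity

variable {ι : Type*} [Fintype ι]

/-- The Lévy measure of a Thorin subordinator with Thorin measure `U`. -/
def thorinLevyMeasure (U : Measure (EuclideanSpace ℝ ι)) : Measure (EuclideanSpace ℝ ι) :=
  (U.prod gammaLevyMeasure).map fun p => (p.2 / ‖p.1‖ ^ 2) • p.1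

lemma measurable_thorinMap :
    Measurable fun p : EuclideanSpace ℝ ι × ℝ => (p.2 / ‖p.1‖ ^ 2) • p.1 := by
  fun_prop

lemma lintegral_thorinLevyMeasure (U : Measure (EuclideanSpace ℝ ι)) [SFinite U]
    {f : EuclideanSpace ℝ ι → ℝ≥0∞} (hf : Measurable f) :
    ∫⁻ x, f x ∂(thorinLevyMeasure U) =
      ∫⁻ u, ∫⁻ r, f ((r / ‖u‖ ^ 2) • u) ∂gammaLevyMeasure ∂U := by
  rw [thorinLevyMeasure, lintegral_map hf measurable_thorinMap,
    lintegral_prod (fun p => f ((p.2 / ‖p.1‖ ^ 2) • p.1)) (hf.comp measurable_thorinMap).aemeasurable]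

lemma measurableSet_puncturedOrthant : MeasurableSet (puncturedOrthant ι) := by
  have : puncturedOrthant ι = (⋂ i, {u : EuclideanSpace ℝ ι | 0 ≤ u i}) ∩ {0}ᶜ := by
    ext u; simp [puncturedOrthant]
  rw [this]
  exact (MeasurableSet.iInter fun i => measurableSet_le measurable_const (by fun_prop)).inter
    (measurableSet_singleton 0).compl

variable {U : Measure (EuclideanSpace ℝ ι)}

lemma ae_thorinLevyMeasure_mem (hU : IsThorinMeasure U) :
    ∀ᵐ x ∂(thorinLevyMeasure U), x ∈ puncturedOrthant ι := by
  have := hU.sFinite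
  have h1 : ∫⁻ x, (puncturedOrthant ι)ᶜ.indicator 1 x ∂(thorinLevyMeasure U) = 0 := by
    rw [lintegral_thorinLevyMeasure U
      (measurable_one.indicator measurableSet_puncturedOrthant.compl)]
    refine lintegral_eq_zero_of_ae_eq_zero ?_
    filter_upwards [hU.ae_mem] with u hu
    refine lintegral_eq_zero_of_ae_eq_zero ?_
    filter_upwards [ae_gammaLevyMeasure_pos] with r hr
    have hn : 0 < ‖u‖ := norm_pos_iff.2 hu.2
    have hmem : (r / ‖u‖ ^ 2) • u ∈ puncturedOrthant ι :=
      ⟨fun i => mul_nonneg (by positivity) (hu.1 i), smul_ne_zero (by positivity) hu.2⟩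
    simp [hmem]
  rw [lintegral_indicator_one measurableSet_puncturedOrthant.compl] at h1
  exact mem_ae_iff.2 h1

lemma inner_nonneg_of_nonneg {l u : EuclideanSpace ℝ ι} (hl : ∀ i, 0 ≤ l i) (hu : ∀ i, 0 ≤ u i) :
    0 ≤ inner ℝ l u := by
  rw [PiLp.inner_apply]
  exact Finset.sum_nonneg fun i _ => by
    simpa using mul_nonneg (hu i) (hl i)

lemma thorin_ratio {l u : EuclideanSpace ℝ ι} (hu : u ≠ 0) :
    (‖u‖ ^ 2 + inner ℝ l u) / ‖u‖ ^ 2 = 1 + inner ℝ l u / ‖u‖ ^ 2 := by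
  have : ‖u‖ ≠ 0 := norm_ne_zero_iff.2 hu
  field_simp

/-- For fixed `u` the inner integral over `r` is Frullani's with `a = ⟨l,u⟩/‖u‖²`. -/
lemma lintegral_one_sub_exp_thorinLevyMeasure (hU : IsThorinMeasure U) {l : EuclideanSpace ℝ ι}
    (hl : ∀ i, 0 ≤ l i) :
    ∫⁻ x, ENNReal.ofReal (1 - Real.exp (-(inner ℝ l x))) ∂(thorinLevyMeasure U) =
      ∫⁻ u, ENNReal.ofReal (Real.log ((‖u‖ ^ 2 + inner ℝ l u) / ‖u‖ ^ 2)) ∂U := by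
  have := hU.sFinite
  rw [lintegral_thorinLevyMeasure U (by fun_prop)]
  refine lintegral_congr_ae ?_
  filter_upwards [hU.ae_mem] with u hu
  rw [thorin_ratio hu.2, ← lintegral_one_sub_exp_gammaLevyMeasure
    (div_nonneg (inner_nonneg_of_nonneg hl hu.1) (by positivity))]
  refine lintegral_congr fun r => ?_
  rw [inner_smul_right]
  ring_nf

/-- By Cauchy-Schwarz the logarithm is at most `log (1 + ‖l‖/‖u‖)`. This is at most `‖l‖/‖u‖`, and
for `‖u‖ ≤ 1` also at most `log (1 + ‖l‖) - log ‖u‖`: the two regimes of the Thorin integrability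
condition. -/
lemma log_thorin_le {l u : EuclideanSpace ℝ ι} (hl : ∀ i, 0 ≤ l i) (hu : u ∈ puncturedOrthant ι) :
    Real.log ((‖u‖ ^ 2 + inner ℝ l u) / ‖u‖ ^ 2) ≤
      (1 + ‖l‖) * min (1 + max 0 (-Real.log ‖u‖)) (1 / ‖u‖) := by
  have hn : 0 < ‖u‖ := norm_pos_iff.2 hu.2
  have h0 := inner_nonneg_of_nonneg hl hu.1
  have h1 : inner ℝ l u / ‖u‖ ^ 2 ≤ ‖l‖ / ‖u‖ := by
    rw [div_le_div_iff₀ (by positivity) hn]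
    nlinarith [real_inner_le_norm l u]
  have hl0 := norm_nonneg l
  rw [thorin_ratio hu.2]
  have h2 : Real.log (1 + inner ℝ l u / ‖u‖ ^ 2) ≤ Real.log (1 + ‖l‖ / ‖u‖) :=
    Real.log_le_log (by positivity) (by linarith)
  have h3 : Real.log (1 + ‖l‖ / ‖u‖) ≤ ‖l‖ / ‖u‖ := by
    have := Real.log_le_sub_one_of_pos (show 0 < 1 + ‖l‖ / ‖u‖ by positivity)
    linarith
  refine h2.trans ?_
  rw [mul_min_of_nonneg _ _ (by positivity)]
  refine le_min ?_ (h3.trans ?_)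
  · rcases le_total ‖u‖ 1 with h | h
    · have h4 : 1 + ‖l‖ / ‖u‖ ≤ (1 + ‖l‖) / ‖u‖ := by
        rw [add_div, add_le_add_iff_right, le_div_iff₀ hn]; linarith
      have h5 := Real.log_le_log (by positivity) h4
      rw [Real.log_div (by positivity) hn.ne'] at h5
      have h6 := Real.log_le_sub_one_of_pos (show 0 < 1 + ‖l‖ by positivity)
      have h7 := le_max_right 0 (-Real.log ‖u‖)
      have h8 := le_max_left 0 (-Real.log ‖u‖)
      nlinarith
    · have h4 : ‖l‖ / ‖u‖ ≤ ‖l‖ := div_le_self hl0 h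
      have h8 := le_max_left 0 (-Real.log ‖u‖)
      nlinarith
  · rw [mul_one_div]
    gcongr
    linarith

lemma lintegral_log_thorin_lt_top (hU : IsThorinMeasure U) {l : EuclideanSpace ℝ ι}
    (hl : ∀ i, 0 ≤ l i) :
    ∫⁻ u, ENNReal.ofReal (Real.log ((‖u‖ ^ 2 + inner ℝ l u) / ‖u‖ ^ 2)) ∂U < ∞ := by
  calc _ ≤ ∫⁻ u, ENNReal.ofReal (1 + ‖l‖) *
        ENNReal.ofReal (min (1 + max 0 (-Real.log ‖u‖)) (1 / ‖u‖)) ∂U := by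
        refine lintegral_mono_ae ?_
        filter_upwards [hU.ae_mem] with u hu
        rw [← ENNReal.ofReal_mul (by positivity)]
        exact ENNReal.ofReal_le_ofReal (log_thorin_le hl hu)
    _ < ∞ := by
        rw [lintegral_const_mul' _ _ ENNReal.ofReal_ne_top]
        exact ENNReal.mul_lt_top ENNReal.ofReal_lt_top hU.2

/-- The vector `(1, …, 1)`. -/
def ones (ι : Type*) : EuclideanSpace ℝ ι := WithLp.toLp 2 fun _ => 1

lemma inner_ones (x : EuclideanSpace ℝ ι) : inner ℝ (ones ι) x = ∑ i, x i := by
  simp [ones, PiLp.inner_apply]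

lemma norm_le_inner_ones {x : EuclideanSpace ℝ ι} (hx : ∀ i, 0 ≤ x i) :
    ‖x‖ ≤ inner ℝ (ones ι) x := by
  rw [inner_ones, EuclideanSpace.norm_eq]
  refine Real.sqrt_le_iff.2 ⟨Finset.sum_nonneg fun i _ => hx i, ?_⟩
  simp only [Real.norm_eq_abs, sq_abs]
  exact Finset.sum_sq_le_sq_sum_of_nonneg fun i _ => hx i

lemma min_one_le_two_mul_one_sub_exp {s : ℝ} (hs : 0 ≤ s) :
    min s 1 ≤ 2 * (1 - Real.exp (-s)) := by
  have h1 : Real.exp (-s) ≤ 1 / (1 + s) := by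
    rw [Real.exp_neg, ← one_div]
    exact one_div_le_one_div_of_le (by positivity) (by linarith [Real.add_one_le_exp s])
  have h2 : min s 1 ≤ 2 * (1 - 1 / (1 + s)) := by
    rw [one_sub_div (by positivity), add_sub_cancel_left, ← mul_div_assoc, le_div_iff₀ (by positivity)]
    rcases le_total s 1 with h | h
    · rw [min_eq_left h]; nlinarith
    · rw [min_eq_right h]; linarith
  linarith

/-- On the orthant `‖x‖ ≤ ⟨(1,…,1), x⟩`, so `‖x‖ ∧ 1` is at most twice the integrand of the Laplace
exponent at `(1,…,1)`, which is finite. -/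
lemma integrable_min_norm_thorinLevyMeasure (hU : IsThorinMeasure U) :
    Integrable (fun x => min ‖x‖ 1) (thorinLevyMeasure U) := by
  refine ⟨by fun_prop, ?_⟩
  rw [hasFiniteIntegral_iff_ofReal (ae_of_all _ fun x => by positivity)]
  calc ∫⁻ x, ENNReal.ofReal (min ‖x‖ 1) ∂(thorinLevyMeasure U)
      ≤ ∫⁻ x, ENNReal.ofReal 2 * ENNReal.ofReal (1 - Real.exp (-(inner ℝ (ones ι) x))) ∂(thorinLevyMeasure U) := by
        refine lintegral_mono_ae ?_
        filter_upwards [ae_thorinLevyMeasure_mem hU] with x hx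
        rw [← ENNReal.ofReal_mul zero_le_two]
        refine ENNReal.ofReal_le_ofReal ?_
        have h1 := norm_le_inner_ones hx.1
        exact (min_le_min_right _ h1).trans
          (min_one_le_two_mul_one_sub_exp ((norm_nonneg x).trans h1))
    _ < ∞ := by
        rw [lintegral_const_mul' _ _ (by simp),
          lintegral_one_sub_exp_thorinLevyMeasure hU (fun i => by simp [ones])]
        exact ENNReal.mul_lt_top (by simp)
          (lintegral_log_thorin_lt_top hU fun i => by simp [ones])

lemma isLevyMeasure_of_integrable_min {ν : Measure (EuclideanSpace ℝ ι)} (h0 : ν {0} = 0)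
    (hint : Integrable (fun x => min ‖x‖ 1) ν) : IsLevyMeasure ν := by
  refine ⟨h0, ?_⟩
  have h1 : Integrable (fun x => min (‖x‖ ^ 2) 1) ν := by
    refine Integrable.mono' hint (by fun_prop) (ae_of_all _ fun x => ?_)
    rw [Real.norm_eq_abs, abs_of_nonneg (by positivity)]
    rcases le_total ‖x‖ 1 with h | h
    · rw [min_eq_left h]; exact (min_le_left _ _).trans (by nlinarith [norm_nonneg x])
    · rw [min_eq_right h]; exact min_le_right _ _
  exact (hasFiniteIntegral_iff_ofReal (ae_of_all _ fun x => by positivity)).1 h1.2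

lemma measurableSet_puncturedBall : MeasurableSet (puncturedBall ι) :=
  measurableSet_closedBall.diff (measurableSet_singleton 0)

lemma integrableOn_puncturedBall_of_integrable_min {ν : Measure (EuclideanSpace ℝ ι)}
    (hint : Integrable (fun x => min ‖x‖ 1) ν) : IntegrableOn (fun x => x) (puncturedBall ι) ν := by
  refine Integrable.mono' hint.integrableOn (by fun_prop) ?_
  refine (ae_restrict_iff' measurableSet_puncturedBall).2 (ae_of_all _ fun x hx => ?_)
  have : ‖x‖ ≤ 1 := by simpa using hx.1
  rw [min_eq_left this]

lemma isLevyMeasure_thorinLevyMeasure (hU : IsThorinMeasure U) :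
    IsLevyMeasure (thorinLevyMeasure U) := by
  refine isLevyMeasure_of_integrable_min ?_ (integrable_min_norm_thorinLevyMeasure hU)
  refine measure_mono_null ?_ (mem_ae_iff.1 (ae_thorinLevyMeasure_mem hU))
  rintro _ rfl h
  exact h.2 rfl

/-- The Laplace exponent of a Thorin subordinator in terms of its Lévy measure. -/
lemma integral_one_sub_exp_thorinLevyMeasure (hU : IsThorinMeasure U) {l : EuclideanSpace ℝ ι}
    (hl : ∀ i, 0 ≤ l i) :
    ∫ x, (1 - Real.exp (-(inner ℝ l x))) ∂(thorinLevyMeasure U) =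
      ∫ u, Real.log ((‖u‖ ^ 2 + inner ℝ l u) / ‖u‖ ^ 2) ∂U := by
  rw [integral_eq_lintegral_of_nonneg_ae ?_ (by fun_prop), integral_eq_lintegral_of_nonneg_ae ?_
    (Measurable.aestronglyMeasurable (by fun_prop)), lintegral_one_sub_exp_thorinLevyMeasure hU hl]
  · filter_upwards [hU.ae_mem] with u hu
    rw [thorin_ratio hu.2]
    exact Real.log_nonneg (by
      have := div_nonneg (inner_nonneg_of_nonneg hl hu.1) (sq_nonneg ‖u‖)
      linarith)
  · filter_upwards [ae_thorinLevyMeasure_mem hU] with x hx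
    exact one_sub_exp_neg_nonneg (inner_nonneg_of_nonneg hl hx.1)

end ThorinLevyMeasure

/-! ### From Laplace transforms to characteristic functions -/

section LaplaceContinuation

variable {ι : Type*} [Fintype ι]

/-- Mean value inequality on the closed left half plane, which is convex and on which `exp` has
derivative of modulus at most `1`. -/
lemma norm_one_sub_cexp_neg_le {w : ℂ} (hw : 0 ≤ w.re) : ‖1 - Complex.exp (-w)‖ ≤ ‖w‖ := by
  have hconv : Convex ℝ {z : ℂ | z.re ≤ 0} := convex_halfSpace_re_le 0
  have h := hconv.norm_image_sub_le_of_norm_hasDerivWithin_le (f := Complex.exp)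
    (f' := Complex.exp) (C := 1) (x := -w) (y := 0)
    (fun z _ => (Complex.hasDerivAt_exp z).hasDerivWithinAt) (fun z hz => by
      rw [Complex.norm_exp]; exact Real.exp_le_one_iff.2 hz) (by simpa using hw) (by simp)
  simpa using h

lemma norm_one_sub_cexp_neg_le_two {w : ℂ} (hw : 0 ≤ w.re) : ‖1 - Complex.exp (-w)‖ ≤ 2 := by
  refine (norm_sub_le _ _).trans ?_
  rw [Complex.norm_exp, norm_one]
  have : Real.exp (-w).re ≤ 1 := Real.exp_le_one_iff.2 (by simpa using hw)
  linarith

/-- The linear form `x ↦ ε ⟨(1, …, 1), x⟩ + z ⟨θ, x⟩`. -/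
def tiltedForm (ε : ℝ) (θ : EuclideanSpace ℝ ι) (z : ℂ) (x : EuclideanSpace ℝ ι) : ℂ :=
  (ε * inner ℝ (ones ι) x : ℝ) + z * (inner ℝ θ x : ℝ)

@[fun_prop]
lemma measurable_tiltedForm (ε : ℝ) (θ : EuclideanSpace ℝ ι) (z : ℂ) :
    Measurable (tiltedForm ε θ z) := by
  unfold tiltedForm; fun_prop

lemma norm_tiltedForm_le {ε : ℝ} (hε : 0 ≤ ε) (θ : EuclideanSpace ℝ ι) (z : ℂ)
    (x : EuclideanSpace ℝ ι) :
    ‖tiltedForm ε θ z x‖ ≤ (ε * ‖ones ι‖ + ‖z‖ * ‖θ‖) * ‖x‖ := by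
  refine (norm_add_le _ _).trans ?_
  rw [norm_mul, Complex.norm_real, Complex.norm_real, norm_mul, Real.norm_of_nonneg hε, add_mul,
    mul_assoc, mul_assoc]
  gcongr <;> exact norm_inner_le_norm _ _

lemma norm_one_sub_cexp_tiltedForm_le {ε : ℝ} (hε : 0 ≤ ε) (θ : EuclideanSpace ℝ ι) (z : ℂ)
    {x : EuclideanSpace ℝ ι} (hre : 0 ≤ (tiltedForm ε θ z x).re) :
    ‖1 - Complex.exp (-tiltedForm ε θ z x)‖ ≤ (ε * ‖ones ι‖ + ‖z‖ * ‖θ‖ + 2) * min ‖x‖ 1 := by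
  have h1 := (norm_one_sub_cexp_neg_le hre).trans (norm_tiltedForm_le hε θ z x)
  have h2 := norm_one_sub_cexp_neg_le_two hre
  have h3 : 0 ≤ ε * ‖ones ι‖ + ‖z‖ * ‖θ‖ := by positivity
  rcases le_total ‖x‖ 1 with h | h
  · rw [min_eq_left h]; nlinarith [norm_nonneg x]
  · rw [min_eq_right h]; nlinarith

/-- The half width of a strip on which `tiltedForm` has positive real part. -/
def tiltWidth (ε : ℝ) (θ : EuclideanSpace ℝ ι) : ℝ := ε / (2 * (‖θ‖ + 1))

lemma tiltWidth_pos {ε : ℝ} (hε : 0 < ε) (θ : EuclideanSpace ℝ ι) : 0 < tiltWidth ε θ := by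
  unfold tiltWidth; positivity

lemma tiltWidth_mul_le {ε : ℝ} (hε : 0 < ε) (θ : EuclideanSpace ℝ ι) :
    tiltWidth ε θ * ‖θ‖ ≤ ε / 2 := by
  unfold tiltWidth
  rw [div_mul_eq_mul_div, div_le_div_iff₀ (by positivity) two_pos]
  nlinarith [norm_nonneg θ]

/-- The tilt contributes at least `ε‖x‖` on the orthant, and on the strip the `θ` term can take back
at most half of it. -/
lemma re_tiltedForm_ge {ε : ℝ} (hε : 0 < ε) (θ : EuclideanSpace ℝ ι) {z : ℂ}
    (hz : |z.re| < tiltWidth ε θ) {x : EuclideanSpace ℝ ι} (hx : ∀ i, 0 ≤ x i) :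
    ε / 2 * ‖x‖ ≤ (tiltedForm ε θ z x).re := by
  have h1 : |z.re * inner ℝ θ x| ≤ ε / 2 * ‖x‖ := by
    rw [abs_mul]
    calc |z.re| * |inner ℝ θ x| ≤ tiltWidth ε θ * (‖θ‖ * ‖x‖) :=
          mul_le_mul hz.le (abs_real_inner_le_norm θ x) (abs_nonneg _) (tiltWidth_pos hε θ).le
      _ = tiltWidth ε θ * ‖θ‖ * ‖x‖ := by ring
      _ ≤ ε / 2 * ‖x‖ := by gcongr; exact tiltWidth_mul_le hε θ
  have h2 := norm_le_inner_ones hx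
  have h3 := (abs_le.1 h1).1
  simp only [tiltedForm, Complex.add_re, Complex.ofReal_re, Complex.re_mul_ofReal]
  nlinarith

/-- The Laplace exponent `∫ (1 - exp (-⟨l, x⟩)) ν(dx)` along the complex line
`l = ε (1, …, 1) + z θ`. -/
def tiltedExponent (ν : Measure (EuclideanSpace ℝ ι)) (ε : ℝ) (θ : EuclideanSpace ℝ ι) (z : ℂ) : ℂ :=
  ∫ x, (1 - Complex.exp (-tiltedForm ε θ z x)) ∂ν

variable {ν : Measure (EuclideanSpace ℝ ι)}

lemma integrable_one_sub_cexp_tiltedForm (hν : Integrable (fun x => min ‖x‖ 1) ν)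
    {ε : ℝ} (hε : 0 ≤ ε) (θ : EuclideanSpace ℝ ι) (z : ℂ)
    (hre : ∀ᵐ x ∂ν, 0 ≤ (tiltedForm ε θ z x).re) :
    Integrable (fun x => 1 - Complex.exp (-tiltedForm ε θ z x)) ν := by
  refine Integrable.mono' (hν.const_mul (ε * ‖ones ι‖ + ‖z‖ * ‖θ‖ + 2)) (by fun_prop) ?_
  filter_upwards [hre] with x hx using norm_one_sub_cexp_tiltedForm_le hε θ z hx

/-- Differentiation under the integral. The tilt supplies the decay `e^{-ε‖x‖/2}`, which absorbs the
factor `⟨θ,x⟩` produced by the derivative at large `x`; without it the large jumps need not have a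
first moment. -/
lemma differentiableOn_tiltedExponent (hν : Integrable (fun x => min ‖x‖ 1) ν)
    (h0 : ∀ᵐ x ∂ν, ∀ i, 0 ≤ x i) {ε : ℝ} (hε : 0 < ε) (θ : EuclideanSpace ℝ ι) :
    DifferentiableOn ℂ (tiltedExponent ν ε θ) {z | |z.re| < tiltWidth ε θ} := by
  have hopen : IsOpen {z : ℂ | |z.re| < tiltWidth ε θ} :=
    isOpen_lt (by fun_prop) continuous_const
  intro z hz
  refine DifferentiableAt.differentiableWithinAt ?_
  have hd := hasDerivAt_integral_of_dominated_loc_of_deriv_le (μ := ν)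
    (F := fun z x => 1 - Complex.exp (-tiltedForm ε θ z x))
    (F' := fun z x => (inner ℝ θ x : ℝ) * Complex.exp (-tiltedForm ε θ z x))
    (bound := fun x => ‖θ‖ * (1 + 2 / ε) * min ‖x‖ 1) (hopen.mem_nhds hz)
    (Eventually.of_forall fun z => by fun_prop)
    (integrable_one_sub_cexp_tiltedForm hν hε.le θ z (by
      filter_upwards [h0] with x hx
      exact le_trans (by positivity) (re_tiltedForm_ge hε θ hz hx)))
    (by fun_prop) ?_ (hν.const_mul _) ?_
  · exact hd.2.differentiableAt
  · filter_upwards [h0] with x hx w hw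
    have h1 := re_tiltedForm_ge hε θ hw hx
    rw [norm_mul, Complex.norm_exp, Complex.norm_real, Complex.neg_re, mul_assoc]
    have h2 : Real.exp (-(tiltedForm ε θ w x).re) ≤ Real.exp (-(ε / 2 * ‖x‖)) :=
      Real.exp_le_exp.2 (by linarith)
    have h3 : ‖x‖ * Real.exp (-(ε / 2 * ‖x‖)) ≤ (1 + 2 / ε) * min ‖x‖ 1 := by
      have hexp : Real.exp (-(ε / 2 * ‖x‖)) ≤ 1 := Real.exp_le_one_iff.2 (by
        have : 0 ≤ ε / 2 * ‖x‖ := by positivity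
        linarith)
      have h2ε : 0 < 2 / ε := by positivity
      rcases le_total ‖x‖ 1 with h | h
      · rw [min_eq_left h]; nlinarith [norm_nonneg x]
      · rw [min_eq_right h, mul_one, Real.exp_neg, ← div_eq_mul_inv, div_le_iff₀ (Real.exp_pos _)]
        have h4 := Real.add_one_le_exp (ε / 2 * ‖x‖)
        have h5 : 2 / ε * (ε / 2 * ‖x‖) = ‖x‖ := by field_simp
        have h6 := Real.exp_pos (ε / 2 * ‖x‖)
        nlinarith
    calc ‖inner ℝ θ x‖ * Real.exp (-(tiltedForm ε θ w x).re)
        ≤ (‖θ‖ * ‖x‖) * Real.exp (-(ε / 2 * ‖x‖)) := by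
          gcongr
          exact norm_inner_le_norm _ _
      _ = ‖θ‖ * (‖x‖ * Real.exp (-(ε / 2 * ‖x‖))) := by ring
      _ ≤ _ := by gcongr
  · refine ae_of_all _ fun x w _ => ?_
    have h1 : HasDerivAt (fun z => -tiltedForm ε θ z x) (-(inner ℝ θ x : ℝ)) w := by
      have h := (((hasDerivAt_id w).mul_const ((inner ℝ θ x : ℝ) : ℂ)).const_add
        ((ε * inner ℝ (ones ι) x : ℝ) : ℂ)).neg
      rw [one_mul] at h
      exact h
    have h2 := h1.cexp.const_sub 1
    convert h2 using 1
    ring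

lemma tendsto_tiltedExponent (hν : Integrable (fun x => min ‖x‖ 1) ν)
    (h0 : ∀ᵐ x ∂ν, ∀ i, 0 ≤ x i) (θ : EuclideanSpace ℝ ι) :
    Tendsto (fun n : ℕ => tiltedExponent ν (1 / ((n : ℝ) + 1)) θ (-Complex.I)) atTop
      (𝓝 (∫ x, (1 - Complex.exp (Complex.I * (inner ℝ θ x : ℝ))) ∂ν)) := by
  have hl := tendsto_one_div_add_atTop_nhds_zero_nat (𝕜 := ℝ)
  refine tendsto_integral_of_dominated_convergence
    (fun x => (‖ones ι‖ + ‖θ‖ + 2) * min ‖x‖ 1) (fun n => by fun_prop) (hν.const_mul _)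
    (fun n => ?_) (ae_of_all _ fun x => ?_)
  · filter_upwards [h0] with x hx
    have hn : 1 / ((n : ℝ) + 1) ≤ 1 := by
      rw [div_le_one (by positivity)]; linarith [(Nat.cast_nonneg n : (0 : ℝ) ≤ n)]
    have h1 := norm_one_sub_cexp_tiltedForm_le (ε := 1 / ((n : ℝ) + 1)) (by positivity) θ
      (-Complex.I) (x := x) (le_trans (by positivity) (re_tiltedForm_ge (by positivity) θ (by
        simpa using tiltWidth_pos (by positivity) θ) hx))
    refine h1.trans ?_
    rw [norm_neg, Complex.norm_I, one_mul]
    gcongr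
    exact mul_le_of_le_one_left (norm_nonneg _) hn
  · have h1 : Tendsto (fun n : ℕ => 1 - Complex.exp (-tiltedForm (1 / ((n : ℝ) + 1)) θ (-Complex.I) x))
        atTop (𝓝 (1 - Complex.exp (-tiltedForm 0 θ (-Complex.I) x))) := by
      have hc : Continuous fun ε : ℝ => 1 - Complex.exp (-tiltedForm ε θ (-Complex.I) x) := by
        unfold tiltedForm; fun_prop
      exact (hc.tendsto 0).comp hl
    simpa [tiltedForm] using h1

/-- The characteristic function of a nonnegative random vector whose Laplace transform is that of
a driftful infinitely divisible law with Lévy measure `ν`. -/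
theorem charFun_of_laplace {Ω : Type*} [MeasurableSpace Ω] {P : Measure Ω} [IsProbabilityMeasure P]
    {ξ : Ω → EuclideanSpace ℝ ι} (hξ : Measurable ξ) (hξ0 : ∀ᵐ ω ∂P, ∀ i, 0 ≤ ξ ω i)
    (hν : Integrable (fun x => min ‖x‖ 1) ν) (h0 : ∀ᵐ x ∂ν, ∀ i, 0 ≤ x i)
    (t : ℝ) (d : EuclideanSpace ℝ ι)
    (hlap : ∀ l : EuclideanSpace ℝ ι, (∀ i, 0 ≤ l i) → ∫ ω, Real.exp (-(inner ℝ l (ξ ω))) ∂P =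
      Real.exp (-(t * inner ℝ d l + t * ∫ x, (1 - Real.exp (-(inner ℝ l x))) ∂ν)))
    (θ : EuclideanSpace ℝ ι) :
    charFun (P.map ξ) θ = Complex.exp (t * (Complex.I * (inner ℝ d θ : ℝ) +
      ∫ x, (Complex.exp (Complex.I * (inner ℝ θ x : ℝ)) - 1) ∂ν)) := by
  have : IsProbabilityMeasure (P.map ξ) := Measure.isProbabilityMeasure_map hξ.aemeasurable
  set ρ := P.map ξ with hρ
  have hρ0 : ∀ᵐ x ∂ρ, ∀ i, 0 ≤ x i := by
    rw [hρ, ae_map_iff hξ.aemeasurable]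
    · exact hξ0
    · simp only [ofPred_forall]
      exact MeasurableSet.iInter fun i => measurableSet_le measurable_const (by fun_prop)
  have hρint : Integrable (fun x => min ‖x‖ 1) ρ :=
    Integrable.mono' (integrable_const 1) (by fun_prop) (ae_of_all _ fun x => by
      rw [Real.norm_eq_abs, abs_of_nonneg (by positivity)]; exact min_le_right _ _)
  -- The law `ρ` is a probability measure, so `1 - tiltedExponent ρ` is its Laplace transform along
  -- the complex line, and the same analyticity lemma applies to `ρ` and to `ν`.
  let G : ℝ → ℂ → ℂ := fun ε z => Complex.exp (-(t * (tiltedForm ε θ z d + tiltedExponent ν ε θ z)))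
  have hreal : ∀ {μ : Measure (EuclideanSpace ℝ ι)} (ε r : ℝ), tiltedExponent μ ε θ r =
      ((∫ x, (1 - Real.exp (-(inner ℝ (ε • ones ι + r • θ) x))) ∂μ : ℝ) : ℂ) := fun {μ} ε r => by
    rw [tiltedExponent, ← integral_complex_ofReal]
    refine integral_congr_ae (ae_of_all _ fun x => ?_)
    simp [tiltedForm, inner_add_left, inner_smul_left]
  have hstrip : ∀ ε : ℝ, 0 < ε → EqOn (fun z => 1 - tiltedExponent ρ ε θ z) (G ε)
      {z | |z.re| < tiltWidth ε θ} := fun ε hε => by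
    have hopen : IsOpen {z : ℂ | |z.re| < tiltWidth ε θ} :=
      isOpen_lt (by fun_prop) continuous_const
    have hconv : Convex ℝ {z : ℂ | |z.re| < tiltWidth ε θ} := by
      have : {z : ℂ | |z.re| < tiltWidth ε θ} =
          {z : ℂ | -tiltWidth ε θ < z.re} ∩ {z | z.re < tiltWidth ε θ} := by
        ext z; simp [abs_lt]
      rw [this]
      exact (convex_halfSpace_re_gt _).inter (convex_halfSpace_re_lt _)
    have hform : Differentiable ℂ fun z => tiltedForm ε θ z d := by
      unfold tiltedForm; fun_prop
    have hA := ((differentiableOn_const (1 : ℂ)).sub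
      (differentiableOn_tiltedExponent hρint hρ0 hε θ)).analyticOnNhd hopen
    have hB : AnalyticOnNhd ℂ (G ε) {z | |z.re| < tiltWidth ε θ} := by
      refine DifferentiableOn.analyticOnNhd ?_ hopen
      exact (((hform.differentiableOn.add
        (differentiableOn_tiltedExponent hν h0 hε θ)).const_mul (t : ℂ)).neg).cexp
    refine hA.eqOn_of_preconnected_of_frequently_eq hB hconv.isPreconnected (z₀ := 0)
      (by simpa using tiltWidth_pos hε θ) ?_
    -- For small real `r` the vector `ε (1,…,1) + r θ` is still nonnegative, so the Laplace
    -- hypothesis applies. The identity theorem then extends equality to the strip, which contains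
    -- `-i`.
    have hev : ∀ᶠ r : ℝ in 𝓝[≠] 0, 1 - tiltedExponent ρ ε θ r = G ε r := by
      have h1 : ∀ᶠ r : ℝ in 𝓝 0, |r| < tiltWidth ε θ := by
        have := (continuous_abs (G := ℝ)).tendsto 0
        rw [abs_zero] at this
        exact this.eventually_lt_const (tiltWidth_pos hε θ)
      filter_upwards [h1.filter_mono nhdsWithin_le_nhds] with r hr
      have hl : ∀ i, 0 ≤ (ε • ones ι + r • θ) i := fun i => by
        have h2 : |r * θ i| ≤ ε := by
          rw [abs_mul]
          calc |r| * |θ i| ≤ tiltWidth ε θ * ‖θ‖ :=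
                mul_le_mul hr.le (PiLp.norm_apply_le θ i) (abs_nonneg _) (tiltWidth_pos hε θ).le
            _ ≤ ε / 2 := tiltWidth_mul_le hε θ
            _ ≤ ε := by linarith
        have := (abs_le.1 h2).1
        simp [ones]
        linarith
      have hexp : Integrable (fun x => Real.exp (-(inner ℝ (ε • ones ι + r • θ) x))) ρ := by
        refine Integrable.mono' (integrable_const 1) (by fun_prop) ?_
        filter_upwards [hρ0] with x hx
        rw [Real.norm_eq_abs, Real.abs_exp]
        exact Real.exp_le_one_iff.2 (neg_nonpos.2 (inner_nonneg_of_nonneg hl hx))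
      have h3 := hlap _ hl
      rw [← integral_map (f := fun x => Real.exp (-(inner ℝ (ε • ones ι + r • θ) x)))
        hξ.aemeasurable (by fun_prop), ← hρ] at h3
      simp only [G]
      rw [hreal, hreal, integral_sub (integrable_const 1) hexp, h3]
      simp [tiltedForm, inner_add_right, inner_smul_right, real_inner_comm]
      ring_nf
    have hmap : Tendsto (fun r : ℝ => (r : ℂ)) (𝓝[≠] 0) (𝓝[≠] 0) := by
      refine tendsto_nhdsWithin_iff.2 ⟨?_, ?_⟩
      · exact (Complex.continuous_ofReal.tendsto' 0 0 (by simp)).mono_left nhdsWithin_le_nhds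
      · filter_upwards [self_mem_nhdsWithin] with r hr
        simpa using hr
    exact hmap.frequently hev.frequently
  have hlimL := (tendsto_tiltedExponent hρint hρ0 θ).const_sub 1
  have hlimR : Tendsto (fun n : ℕ => G (1 / ((n : ℝ) + 1)) (-Complex.I)) atTop
      (𝓝 (Complex.exp (-(t * (tiltedForm 0 θ (-Complex.I) d +
        ∫ x, (1 - Complex.exp (Complex.I * (inner ℝ θ x : ℝ))) ∂ν))))) := by
    refine (Complex.continuous_exp.tendsto _).comp
      (((Tendsto.add ?_ (tendsto_tiltedExponent hν h0 θ)).const_mul _).neg)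
    have hc : Continuous fun ε : ℝ => tiltedForm ε θ (-Complex.I) d := by
      unfold tiltedForm; fun_prop
    exact (hc.tendsto 0).comp (tendsto_one_div_add_atTop_nhds_zero_nat (𝕜 := ℝ))
  have heq : ∀ n : ℕ, 1 - tiltedExponent ρ (1 / ((n : ℝ) + 1)) θ (-Complex.I) =
      G (1 / ((n : ℝ) + 1)) (-Complex.I) := fun n =>
    hstrip _ (by positivity) (by simpa using tiltWidth_pos (by positivity) θ)
  have hfin := tendsto_nhds_unique (hlimL.congr heq) hlimR
  have hexpI : Integrable (fun x => Complex.exp (Complex.I * (inner ℝ θ x : ℝ))) ρ :=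
    Integrable.mono' (integrable_const 1) (by fun_prop) (ae_of_all _ fun x => by
      rw [Complex.norm_exp_I_mul_ofReal])
  rw [integral_sub (integrable_const 1) hexpI] at hfin
  simp only [integral_const, probReal_univ, one_smul, sub_sub_cancel] at hfin
  rw [charFun_apply]
  have h4 : ∀ x, Complex.exp ((inner ℝ x θ : ℝ) * Complex.I) =
      Complex.exp (Complex.I * (inner ℝ θ x : ℝ)) := fun x => by
    rw [real_inner_comm, mul_comm]
  simp_rw [h4]
  rw [hfin]
  congr 1
  have h5 : ∫ x, (1 - Complex.exp (Complex.I * (inner ℝ θ x : ℝ))) ∂ν =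
      -∫ x, (Complex.exp (Complex.I * (inner ℝ θ x : ℝ)) - 1) ∂ν := by
    rw [← integral_neg]; simp
  rw [h5, tiltedForm, real_inner_comm d θ]
  simp
  ring

end LaplaceContinuation

/-! ### The triplet of a Thorin subordinator -/

section ThorinSubordinator

variable {ι : Type*} [Fintype ι] {Ω : Type*} [MeasurableSpace Ω] {P : Measure Ω}
  {T : ℝ≥0 → Ω → EuclideanSpace ℝ ι} {d : EuclideanSpace ℝ ι} {U : Measure (EuclideanSpace ℝ ι)}

lemma IsSubordinator.ae_nonneg (hT : IsSubordinator P T) (t : ℝ≥0) :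
    ∀ᵐ ω ∂P, ∀ i, 0 ≤ T t ω i := by
  filter_upwards [hT.1.zero, hT.2] with ω h0 hmono i
  have := hmono i (zero_le (a := t))
  simpa [h0] using this

lemma quadForm_zero (θ : EuclideanSpace ℝ ι) : quadForm 0 θ = 0 := by simp [quadForm]

lemma IsThorinSubordinator.laplace_eq [IsProbabilityMeasure P] (hT : IsThorinSubordinator P T d U)
    (t : ℝ≥0) {l : EuclideanSpace ℝ ι} (hl : ∀ i, 0 ≤ l i) :
    ∫ ω, Real.exp (-(inner ℝ l (T t ω))) ∂P = Real.exp (-(t * inner ℝ d l +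
      t * ∫ x, (1 - Real.exp (-(inner ℝ l x))) ∂(thorinLevyMeasure U))) := by
  have hmeas := hT.subordinator.1.measurable t
  have hint : Integrable (fun ω => Real.exp (-(inner ℝ l (T t ω)))) P := by
    refine Integrable.mono' (integrable_const 1) (by fun_prop) ?_
    filter_upwards [hT.subordinator.ae_nonneg t] with ω hω
    rw [Real.norm_eq_abs, Real.abs_exp]
    exact Real.exp_le_one_iff.2 (neg_nonpos.2 (inner_nonneg_of_nonneg hl hω))
  have h := hT.laplace t l hl
  rw [integral_one_sub_exp_thorinLevyMeasure hT.thorin hl, ← h, neg_neg,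
    Real.exp_log (integral_exp_pos hint)]

/-- The characteristic triplet of a Thorin subordinator. -/
theorem IsThorinSubordinator.triplet [IsProbabilityMeasure P] (hT : IsThorinSubordinator P T d U)
    {m : EuclideanSpace ℝ ι} {S : Matrix ι ι ℝ} {τ : Measure (EuclideanSpace ℝ ι)}
    (hL : IsLevy P T m S τ) :
    τ = thorinLevyMeasure U ∧ m = d + ∫ x in puncturedBall ι, x ∂(thorinLevyMeasure U) := by
  have hint := integrable_min_norm_thorinLevyMeasure hT.thorin
  have hlev := isLevyMeasure_thorinLevyMeasure hT.thorin
  have hon := integrableOn_puncturedBall_of_integrable_min hint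
  have hpos : ∀ᵐ x ∂(thorinLevyMeasure U), ∀ i, 0 ≤ x i := by
    filter_upwards [ae_thorinLevyMeasure_mem hT.thorin] with x hx using hx.1
  have hexp : ∀ θ, levyExponent m S τ θ = levyExponent
      (d + ∫ x in puncturedBall ι, x ∂(thorinLevyMeasure U)) 0 (thorinLevyMeasure U) θ := fun θ => by
    refine eq_of_forall_exp_mul_eq fun t => ?_
    rw [← hL.charFun_eq, charFun_of_laplace (hT.subordinator.1.measurable t)
      (hT.subordinator.ae_nonneg t) hint hpos t d (fun l hl => hT.laplace_eq t hl),
      levyExponent_of_integrable hlev hon, quadForm_zero]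
    simp
  have hS := quadForm_nonneg hL.covariance
  have h0 : ∀ a : EuclideanSpace ℝ ι, 0 ≤ quadForm 0 a := fun a => (quadForm_zero a).ge
  exact ⟨levyMeasure_unique hS h0 hL.levyMeasure hlev hexp,
    location_unique hS h0 hL.levyMeasure hlev hexp⟩

end ThorinSubordinator

/-! ### Thorin tails and small jumps of the subordinator -/

section ThorinTail

variable {ι : Type*} [Fintype ι] {U : Measure (EuclideanSpace ℝ ι)} {q : ℝ}

/-- The Thorin weight is at least `1` on the punctured unit ball. -/
lemma IsThorinMeasure.measure_closedBall_lt_top (hU : IsThorinMeasure U) :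
    U (Metric.closedBall 0 1) < ∞ := by
  refine lt_of_le_of_lt ?_ hU.2
  calc U (Metric.closedBall 0 1) = ∫⁻ u in Metric.closedBall 0 1, 1 ∂U := by simp
    _ ≤ ∫⁻ u in Metric.closedBall 0 1,
          ENNReal.ofReal (min (1 + max 0 (-Real.log ‖u‖)) (1 / ‖u‖)) ∂U := by
        refine lintegral_mono_ae ?_
        filter_upwards [ae_restrict_of_ae hU.ae_mem, ae_restrict_mem measurableSet_closedBall]
          with u hu hu1
        have h1 : ‖u‖ ≤ 1 := by simpa using hu1
        have h0 : 0 < ‖u‖ := norm_pos_iff.2 hu.2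
        rw [← ENNReal.ofReal_one]
        refine ENNReal.ofReal_le_ofReal (le_min ?_ ?_)
        · linarith [le_max_left 0 (-Real.log ‖u‖)]
        · rwa [le_div_iff₀ h0, one_mul]
    _ ≤ _ := setLIntegral_le_lintegral _ _

/-- The `q`-th moment of the jumps of size at most `1` of a gamma process with rate `y`. -/
def gammaSmallMoment (q y : ℝ) : ℝ≥0∞ :=
  ∫⁻ r in Ioc 0 y, ENNReal.ofReal (Real.exp (-r) / r * (r / y) ^ q)

/-- The point `r u/‖u‖²` has norm `r/‖u‖`, so the cut-off at the unit ball becomes `r ≤ ‖u‖`. -/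
lemma lintegral_puncturedBall_thorinLevyMeasure (hU : IsThorinMeasure U) (q : ℝ) :
    ∫⁻ x in puncturedBall ι, ENNReal.ofReal (‖x‖ ^ q) ∂(thorinLevyMeasure U) =
      ∫⁻ u, gammaSmallMoment q ‖u‖ ∂U := by
  have := hU.sFinite
  have hm : Measurable ((puncturedBall ι).indicator fun x => ENNReal.ofReal (‖x‖ ^ q)) :=
    Measurable.indicator (by fun_prop) measurableSet_puncturedBall
  rw [← lintegral_indicator measurableSet_puncturedBall, lintegral_thorinLevyMeasure U hm]
  refine lintegral_congr_ae ?_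
  filter_upwards [hU.ae_mem] with u hu
  have h0 : 0 < ‖u‖ := norm_pos_iff.2 hu.2
  rw [lintegral_gammaLevyMeasure (f := fun r => (puncturedBall ι).indicator
    (fun x => ENNReal.ofReal (‖x‖ ^ q)) ((r / ‖u‖ ^ 2) • u)) (hm.comp (by fun_prop)),
    gammaSmallMoment, ← lintegral_indicator measurableSet_Ioi,
    ← lintegral_indicator measurableSet_Ioc]
  refine lintegral_congr fun r => ?_
  by_cases hr : 0 < r
  · have hx : ‖(r / ‖u‖ ^ 2) • u‖ = r / ‖u‖ := by
      rw [norm_smul, Real.norm_of_nonneg (by positivity)]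
      field_simp
    have hx0 : (r / ‖u‖ ^ 2) • u ≠ 0 := smul_ne_zero (by positivity) hu.2
    by_cases hru : r ≤ ‖u‖
    · have h1 : (r / ‖u‖ ^ 2) • u ∈ puncturedBall ι :=
        ⟨by rw [mem_closedBall_zero_iff, hx]; exact (div_le_one h0).2 hru, hx0⟩
      rw [indicator_of_mem (show r ∈ Ioi 0 from hr), indicator_of_mem h1,
        indicator_of_mem (show r ∈ Ioc 0 ‖u‖ from ⟨hr, hru⟩), hx,
        ← ENNReal.ofReal_mul (by positivity)]
    · have h1 : (r / ‖u‖ ^ 2) • u ∉ puncturedBall ι := fun h =>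
        hru (by
          have := h.1
          rwa [mem_closedBall_zero_iff, hx, div_le_one h0] at this)
      rw [indicator_of_mem (show r ∈ Ioi 0 from hr), indicator_of_notMem h1,
        indicator_of_notMem (fun h => hru h.2), mul_zero]
  · rw [indicator_of_notMem (show r ∉ Ioi 0 from hr), indicator_of_notMem (fun h => hr h.1)]

/-- Drop `e^{-r} ≤ 1`; the remaining power integrates to `1/q` whatever `y` is. Used for `‖u‖ ≤ 1`.
-/
lemma gammaSmallMoment_le_of_pos (hq : 0 < q) {y : ℝ} (hy : 0 < y) :
    gammaSmallMoment q y ≤ ENNReal.ofReal (1 / q) := by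
  have hi : IntervalIntegrable (fun r : ℝ => r ^ (q - 1)) volume 0 y :=
    intervalIntegral.intervalIntegrable_rpow' (by linarith)
  have hi2 : IntegrableOn (fun r : ℝ => (y ^ q)⁻¹ * r ^ (q - 1)) (Ioc 0 y) :=
    ((intervalIntegrable_iff_integrableOn_Ioc_of_le hy.le).1 hi).const_mul _
  have hval : ∫ r in Ioc 0 y, (y ^ q)⁻¹ * r ^ (q - 1) = 1 / q := by
    rw [integral_const_mul, ← intervalIntegral.integral_of_le hy.le,
      integral_rpow (Or.inl (by linarith)), sub_add_cancel, Real.zero_rpow hq.ne', sub_zero]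
    have : y ^ q ≠ 0 := (Real.rpow_pos_of_pos hy q).ne'
    field_simp
  rw [← hval, ofReal_integral_eq_lintegral_ofReal hi2]
  · refine setLIntegral_mono' measurableSet_Ioc fun r hr => ENNReal.ofReal_le_ofReal ?_
    rw [Real.div_rpow hr.1.le hy.le, Real.rpow_sub_one hr.1.ne']
    have h1 : Real.exp (-r) ≤ 1 := Real.exp_le_one_iff.2 (by linarith [hr.1])
    have h2 := Real.rpow_nonneg hr.1.le q
    have h3 := Real.rpow_pos_of_pos hy q
    have h4 := hr.1
    calc Real.exp (-r) / r * (r ^ q / y ^ q) ≤ 1 / r * (r ^ q / y ^ q) := by gcongr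
      _ = (y ^ q)⁻¹ * (r ^ q / r) := by field_simp
  · refine (ae_restrict_iff' measurableSet_Ioc).2 (ae_of_all _ fun r hr => ?_)
    have := Real.rpow_nonneg hr.1.le (q - 1)
    have h3 := Real.rpow_pos_of_pos hy q
    simp only [Pi.zero_apply]
    positivity

/-- Extend the range to all `r > 0`; the remaining factor is a Gamma integral. Used for `‖u‖ > 1`.
-/
lemma gammaSmallMoment_le (q : ℝ) {y : ℝ} (hy : 0 < y) :
    gammaSmallMoment q y ≤ ENNReal.ofReal (1 / y ^ q) *
      ∫⁻ r in Ioi 0, ENNReal.ofReal (Real.exp (-r) * r ^ (q - 1)) := by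
  rw [gammaSmallMoment, ← lintegral_const_mul' _ _ ENNReal.ofReal_ne_top]
  refine (setLIntegral_mono' measurableSet_Ioc fun r hr => ?_).trans
    (lintegral_mono_set Ioc_subset_Ioi_self)
  have h3 := Real.rpow_pos_of_pos hy q
  rw [← ENNReal.ofReal_mul (by positivity)]
  refine ENNReal.ofReal_le_ofReal (le_of_eq ?_)
  rw [Real.div_rpow hr.1.le hy.le, Real.rpow_sub_one hr.1.ne']
  have := hr.1.ne'
  field_simp

/-- Keep only `r ≤ 1`, where `e^{-r} ≥ e^{-1}` and `r^{q-1} ≥ 1`. -/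
lemma le_gammaSmallMoment (hq1 : q ≤ 1) {y : ℝ} (hy : 1 ≤ y) :
    ENNReal.ofReal (Real.exp (-1)) * ENNReal.ofReal (1 / y ^ q) ≤ gammaSmallMoment q y := by
  have hy0 : 0 < y := by linarith
  have h3 := Real.rpow_pos_of_pos hy0 q
  calc ENNReal.ofReal (Real.exp (-1)) * ENNReal.ofReal (1 / y ^ q)
      = ∫⁻ r in Ioc (0 : ℝ) 1, ENNReal.ofReal (Real.exp (-1) * (1 / y ^ q)) := by
        rw [setLIntegral_const, Real.volume_Ioc, ENNReal.ofReal_mul (Real.exp_pos _).le]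
        simp
    _ ≤ ∫⁻ r in Ioc (0 : ℝ) 1, ENNReal.ofReal (Real.exp (-r) / r * (r / y) ^ q) := by
        refine setLIntegral_mono' measurableSet_Ioc fun r hr => ENNReal.ofReal_le_ofReal ?_
        have hr0 := hr.1
        rw [Real.div_rpow hr.1.le hy0.le]
        have h1 : 1 ≤ r ^ q / r := by
          rw [← Real.rpow_sub_one hr.1.ne']
          exact Real.one_le_rpow_of_pos_of_le_one_of_nonpos hr.1 hr.2 (by linarith)
        have h2 : Real.exp (-1) ≤ Real.exp (-r) := Real.exp_le_exp.2 (by linarith [hr.2])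
        calc Real.exp (-1) * (1 / y ^ q) ≤ Real.exp (-r) * (r ^ q / r * (1 / y ^ q)) := by
              gcongr
              exact le_mul_of_one_le_left (by positivity) h1
          _ = _ := by field_simp
    _ ≤ gammaSmallMoment q y := lintegral_mono_set (Ioc_subset_Ioc_right hy)

/-- The tail of the Thorin measure controls the small jumps of the Thorin subordinator. -/
theorem thorinTailFinite_iff (hU : IsThorinMeasure U) (hq : 0 < q) (hq1 : q ≤ 1) :
    ThorinTailFinite U q ↔ SmallJumpsFinite (thorinLevyMeasure U) q := by
  rw [SmallJumpsFinite, lintegral_puncturedBall_thorinLevyMeasure hU, ThorinTailFinite]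
  have hball : MeasurableSet (Metric.closedBall (0 : EuclideanSpace ℝ ι) 1) :=
    measurableSet_closedBall
  constructor
  · intro h
    have hΓ : ∫⁻ r in Ioi 0, ENNReal.ofReal (Real.exp (-r) * r ^ (q - 1)) < ∞ :=
      (Real.GammaIntegral_convergent hq).lintegral_lt_top
    rw [← lintegral_add_compl _ hball]
    refine ENNReal.add_lt_top.2 ⟨?_, ?_⟩
    · calc ∫⁻ u in Metric.closedBall 0 1, gammaSmallMoment q ‖u‖ ∂U
          ≤ ∫⁻ u in Metric.closedBall 0 1, ENNReal.ofReal (1 / q) ∂U := by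
            refine lintegral_mono_ae (ae_restrict_of_ae ?_)
            filter_upwards [hU.ae_mem] with u hu
              using gammaSmallMoment_le_of_pos hq (norm_pos_iff.2 hu.2)
        _ < ∞ := by
            rw [setLIntegral_const]
            exact ENNReal.mul_lt_top ENNReal.ofReal_lt_top hU.measure_closedBall_lt_top
    · calc ∫⁻ u in (Metric.closedBall 0 1)ᶜ, gammaSmallMoment q ‖u‖ ∂U
          ≤ ∫⁻ u in (Metric.closedBall 0 1)ᶜ, (ENNReal.ofReal (1 / ‖u‖ ^ q) *
              ∫⁻ r in Ioi 0, ENNReal.ofReal (Real.exp (-r) * r ^ (q - 1))) ∂U := by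
            refine lintegral_mono_ae (ae_restrict_of_ae ?_)
            filter_upwards [hU.ae_mem] with u hu
              using gammaSmallMoment_le q (norm_pos_iff.2 hu.2)
        _ < ∞ := by
            rw [lintegral_mul_const' _ _ hΓ.ne]
            exact ENNReal.mul_lt_top h hΓ
  · intro h
    have h1 : ENNReal.ofReal (Real.exp (-1)) *
        ∫⁻ u in (Metric.closedBall 0 1)ᶜ, ENNReal.ofReal (1 / ‖u‖ ^ q) ∂U < ∞ := by
      rw [← lintegral_const_mul' _ _ ENNReal.ofReal_ne_top]
      refine lt_of_le_of_lt ?_ h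
      refine (setLIntegral_mono' hball.compl fun u hu => ?_).trans (setLIntegral_le_lintegral _ _)
      refine le_gammaSmallMoment hq1 ?_
      simp only [mem_compl_iff, Metric.mem_closedBall, dist_zero_right, not_le] at hu
      exact hu.le
    refine lt_top_iff_ne_top.2 fun htop => ?_
    rw [htop, ENNReal.mul_top (by simpa using Real.exp_pos _)] at h1
    exact lt_irrefl _ h1

end ThorinTail

/-! ### Coordinates of random vectors and covariances -/

section Coordinates

variable {ι : Type*} [Fintype ι] {Ω : Type*} [MeasurableSpace Ω] {P : Measure Ω}

lemma charFun_map_coord [DecidableEq ι] {Z : Ω → EuclideanSpace ℝ ι} (hZ : Measurable Z) (k : ι)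
    (r : ℝ) :
    charFun (P.map fun ω => Z ω k) r = charFun (P.map Z) (EuclideanSpace.single k r) := by
  rw [charFun_apply_real, charFun_apply, integral_map (by fun_prop) (by fun_prop),
    integral_map hZ.aemeasurable (by fun_prop)]
  refine integral_congr_ae (ae_of_all _ fun ω => ?_)
  simp [EuclideanSpace.inner_single_right]

lemma quadForm_single [DecidableEq ι] (S : Matrix ι ι ℝ) (k : ι) (r : ℝ) :
    quadForm S (EuclideanSpace.single k r) = S k k * r ^ 2 := by
  rw [quadForm, Finset.sum_eq_single k, Finset.sum_eq_single k]
  · simp; ring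
  · intro l _ hl; simp [hl]
  · simp
  · intro l _ hl; simp [hl]
  · simp

lemma posSemidef_diag_nonneg [DecidableEq ι] {S : Matrix ι ι ℝ} (hS : S.PosSemidef) (k : ι) :
    0 ≤ S k k := by
  have := quadForm_nonneg hS (EuclideanSpace.single k 1)
  simpa [quadForm_single] using this

lemma posSemidef_diag_pos [DecidableEq ι] {S : Matrix ι ι ℝ} (hS : S.PosSemidef) (hu : IsUnit S)
    (k : ι) : 0 < S k k :=
  (hS.posDef_iff_isUnit.2 hu).diag_pos

end Coordinates

/-! ### Joint measurability in time and chance -/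

section MeasurableTime

variable {ι : Type*} [Fintype ι] {Ω : Type*} [MeasurableSpace Ω] {P : Measure Ω}
  {B : ℝ≥0 → Ω → EuclideanSpace ℝ ι}

/-- Only countably many times occur at a fixed level, so measurability in `ω` at each of them
suffices. -/
lemma IsLevyProcess.measurable_uncurry_dyadicCeil (hB : IsLevyProcess P B) (m : ℕ) (i : ι) :
    Measurable fun p : ℝ≥0 × Ω => B (dyadicCeil m p.1) p.2 i := by
  have h1 : Measurable fun p : ℕ × Ω => B (dyadicPoint m p.1) p.2 i :=
    measurable_from_prod_countable_right fun j => by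
      have := hB.measurable (dyadicPoint m j)
      change Measurable fun ω => B (dyadicPoint m j) ω i
      fun_prop
  have h2 : Measurable fun p : ℝ≥0 × Ω => (⌈p.1 * 2 ^ m⌉₊, p.2) :=
    Measurable.prodMk (Nat.measurable_ceil.comp (by fun_prop)) measurable_snd
  have h := h1.comp h2
  simp only [Function.comp_def] at h
  unfold dyadicCeil
  exact h

/-- The approximation of `multiTime` from the right along dyadic times. -/
def dyadicMultiTime (B : ℝ≥0 → Ω → EuclideanSpace ℝ ι) (m : ℕ) (p : EuclideanSpace ℝ ι × Ω) :
    EuclideanSpace ℝ ι :=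
  WithLp.toLp 2 fun i => B (dyadicCeil m (p.1 i).toNNReal) p.2 i

lemma IsLevyProcess.measurable_dyadicMultiTime (hB : IsLevyProcess P B) (m : ℕ) :
    Measurable (dyadicMultiTime B m) := by
  refine (WithLp.measurable_toLp 2 _).comp (measurable_pi_lambda _ fun i => ?_)
  have h : Measurable fun p : EuclideanSpace ℝ ι × Ω => ((p.1 i).toNNReal, p.2) := by fun_prop
  have h2 := (hB.measurable_uncurry_dyadicCeil m i).comp h
  simp only [Function.comp_def] at h2
  exact h2

lemma IsLevyProcess.ae_tendsto_dyadicMultiTime (hB : IsLevyProcess P B) :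
    ∀ᵐ ω ∂P, ∀ t, Tendsto (fun m => dyadicMultiTime B m (t, ω)) atTop (𝓝 (multiTime B t ω)) := by
  filter_upwards [hB.cadlag] with ω hω t
  refine ((PiLp.continuous_toLp 2 (fun _ : ι => ℝ)).tendsto _).comp (tendsto_pi_nhds.2 fun i => ?_)
  have h2 := ((hω (t i).toNNReal).1.tendsto).comp (tendsto_dyadicCeil (t i).toNNReal)
  exact ((PiLp.continuous_apply 2 (fun _ : ι => ℝ) i).tendsto _).comp h2

/-- A Lévy process evaluated at a multivariate time agrees almost surely with a jointly measurable
function of time and chance. -/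
theorem IsLevyProcess.exists_measurable_multiTime (hB : IsLevyProcess P B) :
    ∃ g : EuclideanSpace ℝ ι × Ω → EuclideanSpace ℝ ι, Measurable g ∧
      ∀ᵐ ω ∂P, ∀ t, multiTime B t ω = g (t, ω) := by
  refine ⟨fun p => limUnder atTop fun m => dyadicMultiTime B m p,
    (StronglyMeasurable.limUnder
      fun m => (hB.measurable_dyadicMultiTime m).stronglyMeasurable).measurable, ?_⟩
  filter_upwards [hB.ae_tendsto_dyadicMultiTime] with ω hω t
  exact (hω t).limUnder_eq.symm

lemma IsLevyProcess.measurable_multiTime (hB : IsLevyProcess P B) (t : EuclideanSpace ℝ ι) :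
    Measurable (multiTime B t) := by
  refine (WithLp.measurable_toLp 2 _).comp (measurable_pi_lambda _ fun i => ?_)
  have := hB.measurable (t i).toNNReal
  fun_prop

end MeasurableTime

/-! ### Brownian motion at multivariate times -/

section Brownian

variable {ι : Type*} [Fintype ι] {Ω : Type*} [MeasurableSpace Ω] {P : Measure Ω}
  {B : ℝ≥0 → Ω → EuclideanSpace ℝ ι} {μ : EuclideanSpace ℝ ι} {S : Matrix ι ι ℝ}

/-- The one-dimensional marginals of a Brownian motion. -/
lemma IsBrownianMotion.map_coord [DecidableEq ι] [IsProbabilityMeasure P]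
    (hB : IsBrownianMotion P B μ S) (s : ℝ≥0) (k : ι) :
    P.map (fun ω => B s ω k) = gaussianReal (s * μ k) (s * (S k k).toNNReal) := by
  have hm := hB.isLevyProcess.measurable s
  have : IsProbabilityMeasure (P.map fun ω => B s ω k) :=
    Measure.isProbabilityMeasure_map (by fun_prop)
  refine Measure.ext_of_charFun (funext fun r => ?_)
  rw [charFun_map_coord hm, hB.charFun_eq, charFun_gaussianReal, levyExponent_eq, quadForm_single]
  congr 1
  simp only [integral_zero_measure, EuclideanSpace.inner_single_right, NNReal.coe_mul,
    Real.coe_toNNReal _ (posSemidef_diag_nonneg hB.covariance k)]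
  simp
  ring

lemma integral_sq_gaussianReal (m : ℝ) (v : ℝ≥0) : ∫ x, x ^ 2 ∂(gaussianReal m v) = v + m ^ 2 := by
  have h := variance_eq_sub (memLp_id_gaussianReal (μ := m) (v := v) 2)
  rw [variance_id_gaussianReal] at h
  simp only [Pi.pow_apply, id_eq, integral_id_gaussianReal] at h
  linarith

lemma IsBrownianMotion.lintegral_sq_coord [DecidableEq ι] [IsProbabilityMeasure P]
    (hB : IsBrownianMotion P B μ S) (s : ℝ≥0) (k : ι) :
    ∫⁻ ω, ENNReal.ofReal ((B s ω k) ^ 2) ∂P = ENNReal.ofReal (s * S k k + (s * μ k) ^ 2) := by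
  have hm := hB.isLevyProcess.measurable s
  have h1 := lintegral_map (μ := P) (f := fun x : ℝ => ENNReal.ofReal (x ^ 2))
    (g := fun ω => B s ω k) (by fun_prop) (by fun_prop)
  have hi : Integrable (fun x : ℝ => x ^ 2) (gaussianReal (s * μ k) (s * (S k k).toNNReal)) :=
    (memLp_id_gaussianReal 2).integrable_sq
  rw [← h1, hB.map_coord, ← ofReal_integral_eq_lintegral_ofReal hi
    (ae_of_all _ fun x => sq_nonneg x), integral_sq_gaussianReal]
  simp [Real.coe_toNNReal _ (posSemidef_diag_nonneg hB.covariance k)]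

lemma norm_sq_multiTime {Ω : Type*} (B : ℝ≥0 → Ω → EuclideanSpace ℝ ι) (t : EuclideanSpace ℝ ι)
    (ω : Ω) :
    ‖multiTime B t ω‖ ^ 2 = ∑ i, (B (t i).toNNReal ω i) ^ 2 := by
  rw [EuclideanSpace.norm_sq_eq]
  simp [multiTime]

/-- The constant in the second moment bound for a Brownian motion. -/
def momentConst (μ : EuclideanSpace ℝ ι) (S : Matrix ι ι ℝ) : ℝ := ∑ k, (S k k + (μ k) ^ 2)

lemma momentConst_nonneg [DecidableEq ι] (hS : S.PosSemidef) : 0 ≤ momentConst μ S :=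
  Finset.sum_nonneg fun k _ => add_nonneg (posSemidef_diag_nonneg hS k) (sq_nonneg _)

/-- Coordinate `i` contributes `t_i Σ_ii + (t_i μ_i)²`; for `‖t‖ ≤ 1` both `t_i` and `t_i²` are at
most `‖t‖`. Correlations between coordinates play no role. -/
lemma IsBrownianMotion.lintegral_norm_sq_le [DecidableEq ι] [IsProbabilityMeasure P]
    (hB : IsBrownianMotion P B μ S) {t : EuclideanSpace ℝ ι} (ht : ∀ i, 0 ≤ t i) (ht1 : ‖t‖ ≤ 1) :
    ∫⁻ ω, ENNReal.ofReal (‖multiTime B t ω‖ ^ 2) ∂P ≤ ENNReal.ofReal (momentConst μ S * ‖t‖) := by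
  have hS := posSemidef_diag_nonneg hB.covariance
  simp_rw [norm_sq_multiTime, ENNReal.ofReal_sum_of_nonneg fun i (_ : i ∈ Finset.univ) => sq_nonneg _]
  rw [lintegral_finsetSum _ (fun i _ => by
    have := hB.isLevyProcess.measurable (t i).toNNReal
    fun_prop)]
  simp_rw [hB.lintegral_sq_coord]
  rw [← ENNReal.ofReal_sum_of_nonneg fun i _ => by have := hS i; positivity, momentConst,
    Finset.sum_mul]
  refine ENNReal.ofReal_le_ofReal (Finset.sum_le_sum fun i _ => ?_)
  rw [Real.coe_toNNReal _ (ht i)]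
  have h1 : t i ≤ ‖t‖ := (le_abs_self _).trans (PiLp.norm_apply_le t i)
  have h2 : t i ^ 2 ≤ ‖t‖ := by nlinarith [ht i]
  nlinarith [hS i, sq_nonneg (μ i)]

/-- The first term covers `y ≤ a`, the second `y ≥ a`. With `a = ‖t‖` and `y = ‖B(t)‖²` it turns a
second moment of order `‖t‖` into a `2q`-th moment of order `‖t‖^q`. -/
lemma rpow_le_add_mul {q a y : ℝ} (hq0 : 0 < q) (hq1 : q ≤ 1) (ha : 0 < a) (hy : 0 ≤ y) :
    y ^ q ≤ a ^ q + a ^ (q - 1) * y := by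
  rcases le_total y a with h | h
  · have := Real.rpow_le_rpow hy h hq0.le
    have h2 := Real.rpow_nonneg ha.le (q - 1)
    nlinarith
  · have hy0 : 0 < y := ha.trans_le h
    have h1 : y ^ q = y ^ (q - 1) * y := by rw [Real.rpow_sub_one hy0.ne']; field_simp
    have h2 : y ^ (q - 1) ≤ a ^ (q - 1) := Real.rpow_le_rpow_of_nonpos ha h (by linarith)
    have := Real.rpow_nonneg ha.le q
    nlinarith

/-- Truncated moments of a Brownian motion at a small multivariate time. -/
theorem IsBrownianMotion.lintegral_rpow_le [DecidableEq ι] [IsProbabilityMeasure P]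
    (hB : IsBrownianMotion P B μ S) {q : ℝ} (hq0 : 0 < q) (hq1 : q ≤ 1) {t : EuclideanSpace ℝ ι}
    (ht : t ∈ puncturedOrthant ι) (ht1 : ‖t‖ ≤ 1) :
    ∫⁻ ω, ENNReal.ofReal (‖multiTime B t ω‖ ^ (2 * q)) ∂P ≤
      ENNReal.ofReal (1 + momentConst μ S) * ENNReal.ofReal (‖t‖ ^ q) := by
  have ht0 : 0 < ‖t‖ := norm_pos_iff.2 ht.2
  have hC := momentConst_nonneg (μ := μ) hB.covariance
  have hp := Real.rpow_nonneg ht0.le q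
  have hp1 := Real.rpow_nonneg ht0.le (q - 1)
  calc ∫⁻ ω, ENNReal.ofReal (‖multiTime B t ω‖ ^ (2 * q)) ∂P
      ≤ ∫⁻ ω, (ENNReal.ofReal (‖t‖ ^ q) + ENNReal.ofReal (‖t‖ ^ (q - 1)) *
          ENNReal.ofReal (‖multiTime B t ω‖ ^ 2)) ∂P := by
        refine lintegral_mono fun ω => ?_
        rw [← ENNReal.ofReal_mul hp1, ← ENNReal.ofReal_add hp (by positivity)]
        refine ENNReal.ofReal_le_ofReal ?_
        rw [Real.rpow_mul (norm_nonneg _), Real.rpow_two]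
        exact rpow_le_add_mul hq0 hq1 ht0 (sq_nonneg _)
    _ = ENNReal.ofReal (‖t‖ ^ q) + ENNReal.ofReal (‖t‖ ^ (q - 1)) *
          ∫⁻ ω, ENNReal.ofReal (‖multiTime B t ω‖ ^ 2) ∂P := by
        rw [lintegral_add_left measurable_const, lintegral_const_mul' _ _ ENNReal.ofReal_ne_top]
        simp
    _ ≤ ENNReal.ofReal (‖t‖ ^ q) + ENNReal.ofReal (‖t‖ ^ (q - 1)) *
          ENNReal.ofReal (momentConst μ S * ‖t‖) := by
        gcongr
        exact hB.lintegral_norm_sq_le ht.1 ht1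
    _ = _ := by
        rw [← ENNReal.ofReal_mul hp1, ← ENNReal.ofReal_add hp (by positivity),
          ← ENNReal.ofReal_mul (by positivity), Real.rpow_sub_one ht0.ne']
        congr 1
        field_simp

/-- Anticoncentration of a Gaussian random variable. -/
lemma gaussianReal_Ioo_le (m : ℝ) {v : ℝ≥0} (hv : v ≠ 0) (a : ℝ) :
    gaussianReal m v (Ioo (-a) a) ≤ ENNReal.ofReal (a / √v) := by
  have hv0 : (0 : ℝ) < v := by positivity
  rw [gaussianReal_apply _ hv]
  calc ∫⁻ x in Ioo (-a) a, gaussianPDF m v x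
      ≤ ∫⁻ x in Ioo (-a) a, ENNReal.ofReal (1 / (2 * √v)) := by
        refine lintegral_mono fun x => ?_
        rw [gaussianPDF_def]
        refine ENNReal.ofReal_le_ofReal ?_
        rw [gaussianPDFReal_def]
        have h1 : Real.exp (-(x - m) ^ 2 / (2 * v)) ≤ 1 := by
          refine Real.exp_le_one_iff.2 (div_nonpos_of_nonpos_of_nonneg ?_ (by positivity))
          linarith [sq_nonneg (x - m)]
        have h2 : 2 * √v ≤ √(2 * Real.pi * v) := by
          refine Real.le_sqrt_of_sq_le ?_
          rw [mul_pow, Real.sq_sqrt hv0.le]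
          nlinarith [Real.pi_gt_three]
        have h3 : 0 < 2 * √(v : ℝ) := by positivity
        calc (√(2 * Real.pi * v))⁻¹ * Real.exp (-(x - m) ^ 2 / (2 * v))
            ≤ (2 * √(v : ℝ))⁻¹ * 1 := by gcongr
          _ = _ := by ring
    _ = ENNReal.ofReal (a / √v) := by
        rw [setLIntegral_const, Real.volume_Ioo, ← ENNReal.ofReal_mul (by positivity)]
        congr 1
        have : √(v : ℝ) ≠ 0 := by positivity
        field_simp
        ring

lemma IsBrownianMotion.measure_one_lt_norm_le [DecidableEq ι] [IsProbabilityMeasure P]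
    (hB : IsBrownianMotion P B μ S) {t : EuclideanSpace ℝ ι} (ht : ∀ i, 0 ≤ t i) (ht1 : ‖t‖ ≤ 1) :
    P {ω | 1 < ‖multiTime B t ω‖} ≤ ENNReal.ofReal (momentConst μ S * ‖t‖) := by
  have hmeas := hB.isLevyProcess.measurable_multiTime t
  refine le_trans ?_ (hB.lintegral_norm_sq_le ht ht1)
  calc P {ω | 1 < ‖multiTime B t ω‖}
      ≤ P {ω | 1 ≤ ENNReal.ofReal (‖multiTime B t ω‖ ^ 2)} := by
        refine measure_mono fun ω hω => ?_
        simp only [mem_ofPred_eq] at hω ⊢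
        rw [ENNReal.one_le_ofReal]
        nlinarith
    _ ≤ ∫⁻ ω, ENNReal.ofReal (‖multiTime B t ω‖ ^ 2) ∂P := by
        have := mul_meas_ge_le_lintegral (μ := P)
          (f := fun ω => ENNReal.ofReal (‖multiTime B t ω‖ ^ 2)) (by fun_prop) 1
        simpa using this

/-- The half-width is at most half a standard deviation, so anticoncentration gives `1/2` whatever
the mean. -/
lemma IsBrownianMotion.measure_abs_coord_lt_le [DecidableEq ι] [IsProbabilityMeasure P]
    (hB : IsBrownianMotion P B μ S) {k : ι} {σ : ℝ} (hσ : 0 < σ) (hk : σ ≤ S k k) {s : ℝ≥0}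
    (hs : 0 < s) :
    P {ω | |B s ω k| < √(s * σ) / 2} ≤ ENNReal.ofReal (1 / 2) := by
  have hm := hB.isLevyProcess.measurable s
  have hmk : Measurable fun ω => B s ω k := by fun_prop
  have hSk : 0 < S k k := hσ.trans_le hk
  have hs0 : (0 : ℝ) < s := hs
  have hv : s * (S k k).toNNReal ≠ 0 := mul_ne_zero hs.ne' (Real.toNNReal_pos.2 hSk).ne'
  have h1 := gaussianReal_Ioo_le (s * μ k) hv (√(s * σ) / 2)
  rw [← hB.map_coord, Measure.map_apply hmk measurableSet_Ioo] at h1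
  have h2 : {ω | |B s ω k| < √(s * σ) / 2} =
      (fun ω => B s ω k) ⁻¹' Ioo (-(√(s * σ) / 2)) (√(s * σ) / 2) := by
    ext ω; simp only [mem_ofPred_eq, abs_lt, mem_preimage, mem_Ioo]
  rw [h2]
  refine h1.trans (ENNReal.ofReal_le_ofReal ?_)
  rw [NNReal.coe_mul, Real.coe_toNNReal _ hSk.le, div_le_iff₀ (by positivity)]
  have : √(s * σ) ≤ √(s * S k k) := Real.sqrt_le_sqrt (by gcongr)
  linarith

lemma le_measure_inter_of_compl_le [IsProbabilityMeasure P] {A A' : Set Ω} (hA : MeasurableSet A)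
    (hA' : MeasurableSet A') (h : P Aᶜ ≤ ENNReal.ofReal (1 / 4))
    (h' : P A'ᶜ ≤ ENNReal.ofReal (1 / 2)) : ENNReal.ofReal (1 / 4) ≤ P (A ∩ A') := by
  have h1 : P (A ∩ A')ᶜ ≤ ENNReal.ofReal (3 / 4) := by
    rw [compl_inter]
    refine (measure_union_le _ _).trans ((add_le_add h h').trans ?_)
    rw [← ENNReal.ofReal_add (by norm_num) (by norm_num)]
    norm_num
  have h3 := prob_add_prob_compl (μ := P) (hA.inter hA')
  have h4 : (1 : ℝ≥0∞) ≤ P (A ∩ A') + ENNReal.ofReal (3 / 4) := by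
    rw [← h3]; gcongr
  have h5 : ENNReal.ofReal (1 / 4) + ENNReal.ofReal (3 / 4) = 1 := by
    rw [← ENNReal.ofReal_add (by norm_num) (by norm_num)]
    norm_num
  rw [← h5] at h4
  exact (ENNReal.add_le_add_iff_right ENNReal.ofReal_ne_top).1 h4

lemma exists_norm_le_card_mul [Nonempty ι] {t : EuclideanSpace ℝ ι} (ht : ∀ i, 0 ≤ t i) :
    ∃ k, ‖t‖ ≤ Fintype.card ι * t k := by
  obtain ⟨k, -, hk⟩ := Finset.exists_max_image Finset.univ (fun k => t k) Finset.univ_nonempty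
  refine ⟨k, (norm_le_inner_ones ht).trans ?_⟩
  rw [inner_ones]
  have h2 := Finset.sum_le_card_nsmul Finset.univ (fun i => t i) (t k) hk
  rwa [nsmul_eq_mul, Finset.card_univ] at h2

/-- With probability at least `1 - 1/4 - 1/2`, both `‖B(t)‖ ≤ 1` (Chebyshev) and `B_k(t_k)² ≥ σ
t_k/4` (anticoncentration). There `‖B(t)‖² ≥ σ‖t‖/(4N)`, because coordinate `k` carries a fraction
`1/N` of `‖t‖`. -/
lemma IsBrownianMotion.le_lintegral_rpow [DecidableEq ι] [IsProbabilityMeasure P]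
    (hB : IsBrownianMotion P B μ S) {σ q : ℝ} (hσ : 0 < σ) (hS : ∀ k, σ ≤ S k k) (hq : 0 < q)
    {N : ℝ} (hN : 0 < N) {t : EuclideanSpace ℝ ι} (ht : t ∈ puncturedOrthant ι) (ht1 : ‖t‖ ≤ 1)
    (htC : momentConst μ S * ‖t‖ ≤ 1 / 4) {k : ι} (htk : ‖t‖ ≤ N * t k) :
    ENNReal.ofReal (1 / 4 * (σ / (4 * N)) ^ q) * ENNReal.ofReal (‖t‖ ^ q) ≤
      ∫⁻ ω in {ω | ‖multiTime B t ω‖ ≤ 1}, ENNReal.ofReal (‖multiTime B t ω‖ ^ (2 * q)) ∂P := by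
  have ht0 : 0 < ‖t‖ := norm_pos_iff.2 ht.2
  have htk0 : 0 < t k := pos_of_mul_pos_right (ht0.trans_le htk) hN.le
  have hcoe : (((t k).toNNReal : ℝ≥0) : ℝ) = t k := Real.coe_toNNReal _ htk0.le
  set s := (t k).toNNReal with hs
  have hmeas := hB.isLevyProcess.measurable_multiTime t
  have hmk : Measurable fun ω => B s ω k := by
    have := hB.isLevyProcess.measurable s
    fun_prop
  have hbig := (hB.measure_one_lt_norm_le ht.1 ht1).trans (ENNReal.ofReal_le_ofReal htC)
  have hsmall := hB.measure_abs_coord_lt_le hσ (hS k) (s := s) (Real.toNNReal_pos.2 htk0)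
  set a := √(s * σ) / 2 with ha
  have ha0 : 0 ≤ a := by positivity
  set A := {ω | ‖multiTime B t ω‖ ≤ 1}
  set A' := {ω | a ≤ |B s ω k|}
  have hA : MeasurableSet A := measurableSet_le hmeas.norm measurable_const
  have hA' : MeasurableSet A' := measurableSet_le measurable_const hmk.norm
  have hPA : ENNReal.ofReal (1 / 4) ≤ P (A ∩ A') := by
    refine le_measure_inter_of_compl_le hA hA' ?_ ?_
    · have : Aᶜ = {ω | 1 < ‖multiTime B t ω‖} := by ext ω; simp [A]
      rwa [this]
    · have : A'ᶜ = {ω | |B s ω k| < a} := by ext ω; simp [A']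
      rwa [this]
  have hlow : ∀ ω ∈ A', (σ / (4 * N)) ^ q * ‖t‖ ^ q ≤ ‖multiTime B t ω‖ ^ (2 * q) := fun ω hω => by
    rw [← Real.mul_rpow (by positivity) (norm_nonneg _), Real.rpow_mul (norm_nonneg _),
      Real.rpow_two]
    refine Real.rpow_le_rpow (by positivity) ?_ hq.le
    have h1 : a ^ 2 ≤ (B s ω k) ^ 2 := by
      rw [← sq_abs (B s ω k)]
      exact pow_le_pow_left₀ ha0 hω 2
    have h2 : (B s ω k) ^ 2 ≤ ‖multiTime B t ω‖ ^ 2 := by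
      rw [norm_sq_multiTime]
      exact Finset.single_le_sum (f := fun i => (B (t i).toNNReal ω i) ^ 2)
        (fun i _ => sq_nonneg _) (Finset.mem_univ k)
    refine le_trans ?_ (h1.trans h2)
    rw [ha, div_pow, Real.sq_sqrt (by positivity), hcoe, div_mul_eq_mul_div, div_le_div_iff₀
      (by positivity) (by positivity)]
    nlinarith
  calc ENNReal.ofReal (1 / 4 * (σ / (4 * N)) ^ q) * ENNReal.ofReal (‖t‖ ^ q)
      = ENNReal.ofReal ((σ / (4 * N)) ^ q * ‖t‖ ^ q) * ENNReal.ofReal (1 / 4) := by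
        rw [← ENNReal.ofReal_mul (by positivity), ← ENNReal.ofReal_mul (by positivity)]
        congr 1; ring
    _ ≤ ENNReal.ofReal ((σ / (4 * N)) ^ q * ‖t‖ ^ q) * P (A ∩ A') := by gcongr
    _ = ∫⁻ ω in A ∩ A', ENNReal.ofReal ((σ / (4 * N)) ^ q * ‖t‖ ^ q) ∂P := by
        rw [setLIntegral_const]
    _ ≤ ∫⁻ ω in A ∩ A', ENNReal.ofReal (‖multiTime B t ω‖ ^ (2 * q)) ∂P :=
        setLIntegral_mono' (hA.inter hA') fun ω hω => ENNReal.ofReal_le_ofReal (hlow ω hω.2)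
    _ ≤ _ := lintegral_mono_set inter_subset_left

/-- Lower bound for truncated moments of a nondegenerate Brownian motion at a small multivariate
time. -/
theorem IsBrownianMotion.exists_le_lintegral_rpow [DecidableEq ι] [IsProbabilityMeasure P]
    (hB : IsBrownianMotion P B μ S) (hS : ∀ k, 0 < S k k) {q : ℝ} (hq : 0 < q) :
    ∃ δ > 0, ∃ c > 0, δ ≤ 1 ∧ ∀ t ∈ puncturedOrthant ι, ‖t‖ ≤ δ →
      ENNReal.ofReal c * ENNReal.ofReal (‖t‖ ^ q) ≤
        ∫⁻ ω in {ω | ‖multiTime B t ω‖ ≤ 1}, ENNReal.ofReal (‖multiTime B t ω‖ ^ (2 * q)) ∂P := by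
  -- In dimension zero the punctured orthant is empty and there is no coordinate to choose.
  rcases isEmpty_or_nonempty ι with hι | hι
  · refine ⟨1, one_pos, 1, one_pos, le_rfl, fun t ht => ?_⟩
    exact absurd (Subsingleton.elim t 0) ht.2
  obtain ⟨k0, -, hk0⟩ := Finset.exists_min_image Finset.univ (fun k => S k k) Finset.univ_nonempty
  have hσ0 := hS k0
  have hC0 := momentConst_nonneg (μ := μ) hB.covariance
  have hN0 : (0 : ℝ) < Fintype.card ι := by exact_mod_cast Fintype.card_pos
  have hle : 1 / (4 * (momentConst μ S + 1)) ≤ 1 := by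
    rw [div_le_one (by positivity)]; linarith
  -- This `δ` makes the Chebyshev bound at most `1/4`; adding `1` keeps the denominator positive. In
  -- `c`, the number `N` is the dimension and `σ` the smallest diagonal entry.
  refine ⟨1 / (4 * (momentConst μ S + 1)), by positivity,
    1 / 4 * (S k0 k0 / (4 * Fintype.card ι)) ^ q, by positivity, hle, fun t ht htδ => ?_⟩
  obtain ⟨k, hk⟩ := exists_norm_le_card_mul ht.1
  refine hB.le_lintegral_rpow hσ0 (fun k => hk0 k (Finset.mem_univ k)) hq hN0 ht (htδ.trans hle)
    ?_ hk
  calc momentConst μ S * ‖t‖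
      ≤ (momentConst μ S + 1) * (1 / (4 * (momentConst μ S + 1))) := by gcongr; linarith
    _ = 1 / 4 := by field_simp

end Brownian

/-! ### The splitting of the doubled space into two blocks -/

section Pair

variable {ι : Type*}

/-- The projection of `ℝ^{2n}` to its last `n` coordinates. -/
def lastBlock (x : EuclideanSpace ℝ (ι ⊕ ι)) : EuclideanSpace ℝ ι :=
  WithLp.toLp 2 fun i => x (Sum.inr i)

@[fun_prop]
lemma measurable_lastBlock : Measurable (lastBlock (ι := ι)) := by
  refine (WithLp.measurable_toLp 2 _).comp (measurable_pi_lambda _ fun i => ?_)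
  fun_prop

@[simp]
lemma lastBlock_pair [Fintype ι] (t x : EuclideanSpace ℝ ι) : lastBlock (pair t x) = x := rfl

lemma norm_sq_eq_add_lastBlock [Fintype ι] (x : EuclideanSpace ℝ (ι ⊕ ι)) :
    ‖x‖ ^ 2 = ∑ i, (x (Sum.inl i)) ^ 2 + ‖lastBlock x‖ ^ 2 := by
  simp [EuclideanSpace.norm_sq_eq, Fintype.sum_sum_type, lastBlock]

lemma norm_lastBlock_le [Fintype ι] (x : EuclideanSpace ℝ (ι ⊕ ι)) : ‖lastBlock x‖ ≤ ‖x‖ := by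
  refine (sq_le_sq₀ (norm_nonneg _) (norm_nonneg _)).1 ?_
  rw [norm_sq_eq_add_lastBlock]
  exact le_add_of_nonneg_left (Finset.sum_nonneg fun i _ => sq_nonneg _)

lemma inner_pair_zero [Fintype ι] (θ : EuclideanSpace ℝ ι) (x : EuclideanSpace ℝ (ι ⊕ ι)) :
    inner ℝ (pair 0 θ) x = (inner ℝ θ (lastBlock x) : ℝ) := by
  simp [PiLp.inner_apply, Fintype.sum_sum_type, pair, lastBlock]

lemma quadForm_fromBlocks_pair [Fintype ι] (D : Matrix ι ι ℝ) (θ : EuclideanSpace ℝ ι) :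
    quadForm (Matrix.fromBlocks 0 0 0 D) (pair 0 θ) = quadForm D θ := by
  simp [quadForm, Fintype.sum_sum_type, pair]

lemma measurable_pair [Fintype ι] : Measurable fun p : EuclideanSpace ℝ ι × EuclideanSpace ℝ ι =>
    pair p.1 p.2 := by
  refine (WithLp.measurable_toLp 2 _).comp (measurable_pi_lambda _ fun i => ?_)
  rcases i with i | i
  · simp only [Sum.elim_inl]; fun_prop
  · simp only [Sum.elim_inr]; fun_prop

end Pair

/-! ### The triplet of the last block -/

section LastBlock

variable {ι : Type*} [Fintype ι] {ζ : Measure (EuclideanSpace ℝ (ι ⊕ ι))}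

/-- The Lévy measure of the last block of coordinates of a Lévy process. -/
def lastBlockLevyMeasure (ζ : Measure (EuclideanSpace ℝ (ι ⊕ ι))) :
    Measure (EuclideanSpace ℝ ι) :=
  (ζ.map lastBlock).restrict {0}ᶜ

lemma lintegral_lastBlockLevyMeasure (ζ : Measure (EuclideanSpace ℝ (ι ⊕ ι)))
    {f : EuclideanSpace ℝ ι → ℝ≥0∞} (hf : Measurable f) (h0 : f 0 = 0) :
    ∫⁻ y, f y ∂(lastBlockLevyMeasure ζ) = ∫⁻ x, f (lastBlock x) ∂ζ := by
  rw [lastBlockLevyMeasure, ← lintegral_indicator (measurableSet_singleton _).compl,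
    indicator_eq_self.2, lintegral_map hf measurable_lastBlock]
  intro y hy h
  rw [mem_singleton_iff] at h
  exact hy (h ▸ h0)

lemma integral_lastBlockLevyMeasure {F : Type*} [NormedAddCommGroup F] [NormedSpace ℝ F]
    (ζ : Measure (EuclideanSpace ℝ (ι ⊕ ι)))
    {f : EuclideanSpace ℝ ι → F} (hf : StronglyMeasurable f) (h0 : f 0 = 0) :
    ∫ y, f y ∂(lastBlockLevyMeasure ζ) = ∫ x, f (lastBlock x) ∂ζ := by
  rw [lastBlockLevyMeasure, ← integral_indicator (measurableSet_singleton _).compl,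
    indicator_eq_self.2, integral_map measurable_lastBlock.aemeasurable hf.aestronglyMeasurable]
  intro y hy h
  rw [mem_singleton_iff] at h
  exact hy (h ▸ h0)

lemma IsLevyMeasure.lastBlockLevyMeasure (hζ : IsLevyMeasure ζ) : IsLevyMeasure (WeakSub.lastBlockLevyMeasure ζ) := by
  refine ⟨by simp [WeakSub.lastBlockLevyMeasure], ?_⟩
  rw [lintegral_lastBlockLevyMeasure ζ (by fun_prop) (by simp)]
  refine lt_of_le_of_lt (lintegral_mono fun x => ENNReal.ofReal_le_ofReal ?_) hζ.2
  have := norm_lastBlock_le x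
  gcongr

/-- The set where the truncation of a vector and of its last block differ. -/
def truncationGap (ι : Type*) [Fintype ι] : Set (EuclideanSpace ℝ (ι ⊕ ι)) :=
  {x | ‖lastBlock x‖ ≤ 1 ∧ 1 < ‖x‖}

lemma measurableSet_truncationGap : MeasurableSet (truncationGap ι) :=
  (measurableSet_le measurable_lastBlock.norm measurable_const).inter
    (measurableSet_lt measurable_const measurable_norm)

/-- The gap lies outside the unit ball, where a Lévy measure is finite, and `lastBlock` is bounded
by `1` on it. -/
lemma IsLevyMeasure.integrableOn_truncationGap (hζ : IsLevyMeasure ζ) :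
    IntegrableOn lastBlock (truncationGap ι) ζ := by
  refine Integrable.mono' hζ.integrable_min.integrableOn
    measurable_lastBlock.aestronglyMeasurable ?_
  refine (ae_restrict_iff' measurableSet_truncationGap).2 (ae_of_all _ fun x hx => ?_)
  rw [min_eq_right (by nlinarith [hx.2])]
  exact hx.1

/-- Projection leaves the exponentials unchanged. Only the truncations differ, and because the
projection is a contraction they differ exactly on the gap. -/
lemma levyIntegrand_pair_zero (θ : EuclideanSpace ℝ ι) (x : EuclideanSpace ℝ (ι ⊕ ι)) :
    levyIntegrand (pair 0 θ) x = levyIntegrand θ (lastBlock x) +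
      (truncationGap ι).indicator (fun x => Complex.I * (inner ℝ θ (lastBlock x) : ℝ)) x := by
  classical
  rw [levyIntegrand, levyIntegrand, inner_pair_zero, indicator_apply]
  have h := norm_lastBlock_le x
  by_cases h1 : ‖x‖ ≤ 1
  · have h2 : x ∉ truncationGap ι := fun hx => absurd hx.2 (not_lt.2 h1)
    simp [h1, h.trans h1, h2]
  · by_cases h3 : ‖lastBlock x‖ ≤ 1
    · have h2 : x ∈ truncationGap ι := ⟨h3, not_le.1 h1⟩
      simp [h1, h3, h2]
    · have h2 : x ∉ truncationGap ι := fun hx => h3 hx.1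
      simp [h1, h3, h2]

/-- The characteristic triplet of the last block of coordinates of a Lévy process. -/
lemma levyExponent_pair_zero (hζ : IsLevyMeasure ζ) (m₁ m₂ θ : EuclideanSpace ℝ ι)
    (D : Matrix ι ι ℝ) :
    levyExponent (pair m₁ m₂) (Matrix.fromBlocks 0 0 0 D) ζ (pair 0 θ) =
      levyExponent (m₂ + ∫ x in truncationGap ι, lastBlock x ∂ζ) D (lastBlockLevyMeasure ζ) θ := by
  have hgap := hζ.integrableOn_truncationGap
  have hi : Integrable ((truncationGap ι).indicator
      fun x => Complex.I * (inner ℝ θ (lastBlock x) : ℝ)) ζ :=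
    (integrable_indicator_iff measurableSet_truncationGap).2
      (((hgap.const_inner θ).ofReal (𝕜 := ℂ)).const_mul Complex.I)
  have hj : Integrable (fun x => levyIntegrand θ (lastBlock x)) ζ := by
    have := (hζ.integrable_levyIntegrand (pair 0 θ)).sub hi
    refine this.congr (ae_of_all _ fun x => ?_)
    simp [levyIntegrand_pair_zero]
  have h1 : ∫ x, levyIntegrand (pair 0 θ) x ∂ζ =
      ∫ y, levyIntegrand θ y ∂(lastBlockLevyMeasure ζ) +
        Complex.I * (inner ℝ (∫ x in truncationGap ι, lastBlock x ∂ζ) θ : ℝ) := by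
    simp_rw [levyIntegrand_pair_zero]
    rw [integral_add hj hi, integral_lastBlockLevyMeasure ζ
      (measurable_levyIntegrand θ).stronglyMeasurable (by simp [levyIntegrand]),
      integral_indicator measurableSet_truncationGap, integral_const_mul,
      integral_complex_ofReal, integral_inner hgap θ, real_inner_comm]
  rw [levyExponent_eq, levyExponent_eq, h1, quadForm_fromBlocks_pair, inner_add_left,
    real_inner_comm (pair 0 θ) (pair m₁ m₂), inner_pair_zero, lastBlock_pair, real_inner_comm θ m₂]
  push_cast
  ring

end LastBlock

/-! ### Integration against the Gaussian mixture -/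

section Mixture

variable {ι : Type*} [Fintype ι] {Ω : Type*} [MeasurableSpace Ω] {P : Measure Ω}
  {B : ℝ≥0 → Ω → EuclideanSpace ℝ ι} {τ : Measure (EuclideanSpace ℝ ι)}
  {ζ : Measure (EuclideanSpace ℝ (ι ⊕ ι))}

/-- A Gaussian mixture over multivariate times is the image of a product measure. -/
lemma IsLevyProcess.exists_eq_map_prod [IsProbabilityMeasure P] [SFinite τ]
    (hB : IsLevyProcess P B)
    (hζ : ∀ A, MeasurableSet A → ζ A =
      ∫⁻ t in puncturedOrthant ι, P {ω | pair t (multiTime B t ω) ∈ A} ∂τ) :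
    ∃ Φ : EuclideanSpace ℝ ι × Ω → EuclideanSpace ℝ (ι ⊕ ι), Measurable Φ ∧
      (∀ᵐ ω ∂P, ∀ t, Φ (t, ω) = pair t (multiTime B t ω)) ∧
      ζ = ((τ.restrict (puncturedOrthant ι)).prod P).map Φ := by
  obtain ⟨g, hg, hgB⟩ := hB.exists_measurable_multiTime
  have hΦ : Measurable fun p : EuclideanSpace ℝ ι × Ω => pair p.1 (g p) :=
    measurable_pair.comp (measurable_fst.prodMk hg)
  refine ⟨fun p => pair p.1 (g p), hΦ, ?_, ?_⟩
  · filter_upwards [hgB] with ω hω t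
    rw [hω]
  · ext A hA
    rw [hζ A hA, Measure.map_apply hΦ hA, Measure.prod_apply (hΦ hA)]
    refine lintegral_congr fun t => measure_congr ?_
    filter_upwards [hgB] with ω hω
    exact propext (by
      change pair t (multiTime B t ω) ∈ A ↔ pair t (g (t, ω)) ∈ A
      rw [hω])

lemma IsLevyProcess.lintegral_mixture [IsProbabilityMeasure P] [SFinite τ]
    (hB : IsLevyProcess P B)
    (hζ : ∀ A, MeasurableSet A → ζ A =
      ∫⁻ t in puncturedOrthant ι, P {ω | pair t (multiTime B t ω) ∈ A} ∂τ)
    {f : EuclideanSpace ℝ (ι ⊕ ι) → ℝ≥0∞} (hf : Measurable f) :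
    ∫⁻ x, f x ∂ζ = ∫⁻ t in puncturedOrthant ι, ∫⁻ ω, f (pair t (multiTime B t ω)) ∂P ∂τ := by
  obtain ⟨Φ, hΦ, hae, rfl⟩ := hB.exists_eq_map_prod hζ
  rw [lintegral_map hf hΦ, lintegral_prod (fun p => f (Φ p)) (hf.comp hΦ).aemeasurable]
  refine lintegral_congr fun t => lintegral_congr_ae ?_
  filter_upwards [hae] with ω hω
  rw [hω]

lemma IsLevyProcess.integral_mixture [IsProbabilityMeasure P] [SFinite τ]
    {F : Type*} [NormedAddCommGroup F] [NormedSpace ℝ F]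
    (hB : IsLevyProcess P B)
    (hζ : ∀ A, MeasurableSet A → ζ A =
      ∫⁻ t in puncturedOrthant ι, P {ω | pair t (multiTime B t ω) ∈ A} ∂τ)
    {f : EuclideanSpace ℝ (ι ⊕ ι) → F} (hf : Integrable f ζ) :
    ∫ x, f x ∂ζ = ∫ t in puncturedOrthant ι, ∫ ω, f (pair t (multiTime B t ω)) ∂P ∂τ := by
  obtain ⟨Φ, hΦ, hae, rfl⟩ := hB.exists_eq_map_prod hζ
  rw [integral_map hΦ.aemeasurable hf.aestronglyMeasurable,
    integral_prod (fun p => f (Φ p)) ((integrable_map_measure hf.aestronglyMeasurable hΦ.aemeasurable).1 hf)]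
  refine integral_congr_ae (ae_of_all _ fun t => integral_congr_ae ?_)
  filter_upwards [hae] with ω hω
  rw [hω]

end Mixture

/-! ### The triplet of a VGG process -/

section SecondComponent

variable {ι : Type*} [Fintype ι] {Ω : Type*} [MeasurableSpace Ω] {P : Measure Ω}

lemma charFun_map_lastBlock {Z : Ω → EuclideanSpace ℝ (ι ⊕ ι)} (hZ : Measurable Z)
    (θ : EuclideanSpace ℝ ι) :
    charFun (P.map fun ω => lastBlock (Z ω)) θ = charFun (P.map Z) (pair 0 θ) := by
  have hZ2 : Measurable fun ω => lastBlock (Z ω) := measurable_lastBlock.comp hZ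
  rw [charFun_apply, charFun_apply, integral_map hZ.aemeasurable (by fun_prop),
    integral_map hZ2.aemeasurable (by fun_prop)]
  refine integral_congr_ae (ae_of_all _ fun ω => ?_)
  simp only
  rw [real_inner_comm θ, real_inner_comm (pair 0 θ), inner_pair_zero]

/-- The characteristic triplet of a variance generalised gamma convolution process, in terms of the
Gaussian mixture over its Thorin subordinator. -/
theorem IsVGG.exists_mixture {Y : ℝ≥0 → Ω → EuclideanSpace ℝ ι} {d μ m : EuclideanSpace ℝ ι}
    {S Q : Matrix ι ι ℝ} {U υ : Measure (EuclideanSpace ℝ ι)} (hY : IsVGG.{w} P Y d μ S U)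
    (hL : IsLevy P Y m Q υ) :
    ∃ (ΩB : Type w) (_ : MeasurableSpace ΩB) (PB : Measure ΩB)
      (B : ℝ≥0 → ΩB → EuclideanSpace ℝ ι) (ζ : Measure (EuclideanSpace ℝ (ι ⊕ ι))),
      IsProbabilityMeasure PB ∧ IsBrownianMotion PB B μ S ∧ IsThorinMeasure U ∧ (∀ i, 0 ≤ d i) ∧
      (∀ A, MeasurableSet A → ζ A = ∫⁻ t in puncturedOrthant ι,
        PB {ω | pair t (multiTime B t ω) ∈ A} ∂(thorinLevyMeasure U)) ∧
      IsLevyMeasure ζ ∧ υ = lastBlockLevyMeasure ζ ∧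
      (∀ a, quadForm Q a = quadForm (diamondMat d S) a) ∧
      m = weakMean₂ PB B μ d (thorinLevyMeasure U) + ∫ x in truncationGap ι, lastBlock x ∂ζ := by
  obtain ⟨-, ΩB, ΩT, ΩZ, iB, iT, iZ, PB, PT, PZ, B, T, Z, hPB, hPT, hPZ, hT,
    ⟨hB, d', τ, ⟨-, -, mT, QT, hLT, -, hd⟩, ζ, hζ, hLZ⟩, hid⟩ := hY
  -- The drift and Lévy measure chosen in the weak subordination are thereby forced to be `d` and
  -- `thorinLevyMeasure U`.
  obtain ⟨rfl, rfl⟩ := hT.triplet hLT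
  rw [add_sub_cancel_right] at hd
  subst hd
  -- Nonnegativity of `d ⋄ Σ` is inherited from the block covariance of `Z`.
  have hD : ∀ a, 0 ≤ quadForm (diamondMat d' S) a := fun a => by
    rw [← quadForm_fromBlocks_pair]
    exact quadForm_nonneg hLZ.covariance _
  have hexp : ∀ θ, levyExponent m Q υ θ = levyExponent
      (weakMean₂ PB B μ d' (thorinLevyMeasure U) + ∫ x in truncationGap ι, lastBlock x ∂ζ)
      (diamondMat d' S) (lastBlockLevyMeasure ζ) θ := fun θ => by
    refine eq_of_forall_exp_mul_eq fun t => ?_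
    have hmap : P.map (Y t) = PZ.map fun ω => lastBlock (Z t ω) :=
      (hid.comp (measurable_pi_apply t)).map_eq
    rw [← hL.charFun_eq, hmap, charFun_map_lastBlock (hLZ.isLevyProcess.measurable t),
      hLZ.charFun_eq, levyExponent_pair_zero hLZ.levyMeasure]
  have hQ := quadForm_nonneg hL.covariance
  have hlast := hLZ.levyMeasure.lastBlockLevyMeasure
  exact ⟨ΩB, iB, PB, B, ζ, hPB, hB, hT.thorin, hT.drift_nonneg, hζ, hLZ.levyMeasure,
    levyMeasure_unique hQ hD hL.levyMeasure hlast hexp,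
    quadForm_unique hQ hD hL.levyMeasure hlast hexp,
    location_unique hQ hD hL.levyMeasure hlast hexp⟩

end SecondComponent

/-! ### Thorin tails and small jumps of the mixture -/

section SmallJumps

variable {ι : Type*} [Fintype ι] {Ω : Type*} [MeasurableSpace Ω] {P : Measure Ω}
  {B : ℝ≥0 → Ω → EuclideanSpace ℝ ι} {μ : EuclideanSpace ℝ ι} {S : Matrix ι ι ℝ}
  {U : Measure (EuclideanSpace ℝ ι)} {ζ : Measure (EuclideanSpace ℝ (ι ⊕ ι))}

lemma restrict_thorinLevyMeasure (hU : IsThorinMeasure U) :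
    (thorinLevyMeasure U).restrict (puncturedOrthant ι) = thorinLevyMeasure U :=
  Measure.restrict_eq_self_of_ae_mem (ae_thorinLevyMeasure_mem hU)

/-- The small jumps of a Gaussian mixture over multivariate times. -/
lemma lintegral_puncturedBall_lastBlock [IsProbabilityMeasure P] (hB : IsLevyProcess P B)
    (hU : IsThorinMeasure U)
    (hζ : ∀ A, MeasurableSet A → ζ A = ∫⁻ t in puncturedOrthant ι,
        P {ω | pair t (multiTime B t ω) ∈ A} ∂(thorinLevyMeasure U)) {p : ℝ} (hp : 0 < p) :
    ∫⁻ y in puncturedBall ι, ENNReal.ofReal (‖y‖ ^ p) ∂(lastBlockLevyMeasure ζ) =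
      ∫⁻ t, ∫⁻ ω in {ω | ‖multiTime B t ω‖ ≤ 1}, ENNReal.ofReal (‖multiTime B t ω‖ ^ p) ∂P
        ∂(thorinLevyMeasure U) := by
  have := (isLevyMeasure_thorinLevyMeasure hU).sFinite
  have hf : Measurable ((puncturedBall ι).indicator fun y => ENNReal.ofReal (‖y‖ ^ p)) :=
    Measurable.indicator (by fun_prop) measurableSet_puncturedBall
  rw [← lintegral_indicator measurableSet_puncturedBall, lintegral_lastBlockLevyMeasure ζ hf
    (by simp [puncturedBall]), hB.lintegral_mixture hζ (f := fun x => (puncturedBall ι).indicator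
    (fun y => ENNReal.ofReal (‖y‖ ^ p)) (lastBlock x)) (hf.comp measurable_lastBlock),
    restrict_thorinLevyMeasure hU]
  refine lintegral_congr fun t => ?_
  have hm : MeasurableSet {ω | ‖multiTime B t ω‖ ≤ 1} :=
    measurableSet_le (hB.measurable_multiTime t).norm measurable_const
  rw [← lintegral_indicator hm]
  refine lintegral_congr fun ω => ?_
  classical
  simp only [lastBlock_pair, indicator_apply, puncturedBall, Set.mem_sdiff, mem_closedBall_zero_iff,
    mem_singleton_iff, mem_ofPred_eq]
  by_cases h0 : multiTime B t ω = 0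
  · simp [h0, Real.zero_rpow hp.ne']
  · simp [h0]

/-- For `‖t‖ ≤ 1` the truncated moment is at most `C‖t‖^q`; for `‖t‖ > 1` it is at most `1 = ‖t‖ ∧
1`. Both bounds are integrable. -/
theorem smallJumpsFinite_lastBlock [DecidableEq ι] [IsProbabilityMeasure P]
    (hB : IsBrownianMotion P B μ S) (hU : IsThorinMeasure U)
    (hζ : ∀ A, MeasurableSet A → ζ A = ∫⁻ t in puncturedOrthant ι,
        P {ω | pair t (multiTime B t ω) ∈ A} ∂(thorinLevyMeasure U))
    {q : ℝ} (hq0 : 0 < q) (hq1 : q ≤ 1) (h : ThorinTailFinite U q) :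
    SmallJumpsFinite (lastBlockLevyMeasure ζ) (2 * q) := by
  have hmin := (hasFiniteIntegral_iff_ofReal (ae_of_all _ fun x => by positivity)).1
    (integrable_min_norm_thorinLevyMeasure hU).2
  rw [thorinTailFinite_iff hU hq0 hq1, SmallJumpsFinite,
    ← lintegral_indicator measurableSet_puncturedBall] at h
  rw [SmallJumpsFinite, lintegral_puncturedBall_lastBlock hB.isLevyProcess hU hζ (by linarith)]
  refine lt_of_le_of_lt (lintegral_mono_ae
    (g := fun t => ENNReal.ofReal (1 + momentConst μ S) *
      (puncturedBall ι).indicator (fun x => ENNReal.ofReal (‖x‖ ^ q)) t +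
      ENNReal.ofReal (min ‖t‖ 1)) ?_) ?_
  · filter_upwards [ae_thorinLevyMeasure_mem hU] with t ht
    rcases le_or_gt ‖t‖ 1 with ht1 | ht1
    · have hmem : t ∈ puncturedBall ι := ⟨by simpa using ht1, ht.2⟩
      rw [indicator_of_mem hmem]
      exact le_add_right ((setLIntegral_le_lintegral _ _).trans
        (hB.lintegral_rpow_le hq0 hq1 ht ht1))
    · rw [min_eq_right ht1.le, ENNReal.ofReal_one]
      refine le_add_left ?_
      have hm : MeasurableSet {ω | ‖multiTime B t ω‖ ≤ 1} :=
        measurableSet_le (hB.isLevyProcess.measurable_multiTime t).norm measurable_const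
      calc ∫⁻ ω in {ω | ‖multiTime B t ω‖ ≤ 1}, ENNReal.ofReal (‖multiTime B t ω‖ ^ (2 * q)) ∂P
          ≤ ∫⁻ ω in {ω | ‖multiTime B t ω‖ ≤ 1}, 1 ∂P := by
            refine setLIntegral_mono' hm fun ω hω => ?_
            rw [← ENNReal.ofReal_one]
            exact ENNReal.ofReal_le_ofReal
              (Real.rpow_le_one (norm_nonneg _) hω (by linarith))
        _ ≤ 1 := by rw [setLIntegral_one]; exact prob_le_one
  · rw [lintegral_add_right _ (by fun_prop), lintegral_const_mul' _ _ ENNReal.ofReal_ne_top]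
    exact ENNReal.add_lt_top.2 ⟨ENNReal.mul_lt_top ENNReal.ofReal_lt_top h, hmin⟩

/-- For `‖t‖ ≤ δ` the truncated moment dominates `c‖t‖^q`. For `δ < ‖t‖ ≤ 1` one has `c‖t‖^q ≤
(c/δ)‖t‖`, which is always integrable there. Only positivity of the diagonal of `Σ` is needed. -/
theorem thorinTailFinite_of_smallJumpsFinite_lastBlock [DecidableEq ι] [IsProbabilityMeasure P]
    (hB : IsBrownianMotion P B μ S) (hS : ∀ k, 0 < S k k) (hU : IsThorinMeasure U)
    (hζ : ∀ A, MeasurableSet A → ζ A = ∫⁻ t in puncturedOrthant ι,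
        P {ω | pair t (multiTime B t ω) ∈ A} ∂(thorinLevyMeasure U))
    {q : ℝ} (hq0 : 0 < q) (hq1 : q ≤ 1)
    (h : SmallJumpsFinite (lastBlockLevyMeasure ζ) (2 * q)) : ThorinTailFinite U q := by
  have hmin := (hasFiniteIntegral_iff_ofReal (ae_of_all _ fun x => by positivity)).1
    (integrable_min_norm_thorinLevyMeasure hU).2
  rw [SmallJumpsFinite, lintegral_puncturedBall_lastBlock hB.isLevyProcess hU hζ
    (by linarith)] at h
  rw [thorinTailFinite_iff hU hq0 hq1, SmallJumpsFinite,
    ← lintegral_indicator measurableSet_puncturedBall]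
  obtain ⟨δ, hδ, c, hc, hδ1, hle⟩ := hB.exists_le_lintegral_rpow hS hq0
  have key : ENNReal.ofReal c * ∫⁻ t, (puncturedBall ι).indicator
      (fun x => ENNReal.ofReal (‖x‖ ^ q)) t ∂(thorinLevyMeasure U) < ∞ := by
    rw [← lintegral_const_mul' _ _ ENNReal.ofReal_ne_top]
    refine lt_of_le_of_lt (lintegral_mono_ae
      (g := fun t => (∫⁻ ω in {ω | ‖multiTime B t ω‖ ≤ 1},
        ENNReal.ofReal (‖multiTime B t ω‖ ^ (2 * q)) ∂P) +
        ENNReal.ofReal (c / δ) * ENNReal.ofReal (min ‖t‖ 1)) ?_) ?_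
    · filter_upwards [ae_thorinLevyMeasure_mem hU] with t ht
      by_cases hmem : t ∈ puncturedBall ι
      · rw [indicator_of_mem hmem]
        have ht1 : ‖t‖ ≤ 1 := by simpa using hmem.1
        rcases le_or_gt ‖t‖ δ with htδ | htδ
        · exact le_add_right (hle t ht htδ)
        · refine le_add_left ?_
          rw [← ENNReal.ofReal_mul hc.le, ← ENNReal.ofReal_mul (by positivity), min_eq_left ht1]
          refine ENNReal.ofReal_le_ofReal ?_
          have h1 : ‖t‖ ^ q ≤ 1 := Real.rpow_le_one (norm_nonneg _) ht1 hq0.le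
          have h2 : 1 ≤ ‖t‖ / δ := (one_le_div hδ).2 htδ.le
          calc c * ‖t‖ ^ q ≤ c * (‖t‖ / δ) := by gcongr; exact h1.trans h2
            _ = c / δ * ‖t‖ := by ring
      · simp [indicator_of_notMem hmem]
    · rw [lintegral_add_right _ (by fun_prop), lintegral_const_mul' _ _ ENNReal.ofReal_ne_top]
      exact ENNReal.add_lt_top.2 ⟨h, ENNReal.mul_lt_top ENNReal.ofReal_lt_top hmin⟩
  exact ENNReal.lt_top_of_mul_ne_top_right key.ne (ENNReal.ofReal_pos.2 hc).ne'

end SmallJumps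

/-! ### Finite variation in several dimensions -/

section CoordinateProcesses

variable {ι : Type*} [Fintype ι] {Ω : Type*} [MeasurableSpace Ω] {P : Measure Ω}
  {X : ℝ≥0 → Ω → EuclideanSpace ℝ ι} {m : EuclideanSpace ℝ ι} {Q : Matrix ι ι ℝ}
  {υ : Measure (EuclideanSpace ℝ ι)}

lemma norm_le_sum_abs (x : EuclideanSpace ℝ ι) : ‖x‖ ≤ ∑ k, |x k| := by
  have h0 : 0 ≤ ∑ k, |x k| := Finset.sum_nonneg fun k _ => abs_nonneg _
  refine (sq_le_sq₀ (norm_nonneg _) h0).1 ?_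
  rw [EuclideanSpace.norm_sq_eq]
  exact Finset.sum_sq_le_sq_sum_of_nonneg fun k _ => norm_nonneg _

lemma min_sum_one_le {κ : Type*} (s : Finset κ) {a : κ → ℝ} (ha : ∀ k, 0 ≤ a k) :
    min (∑ k ∈ s, a k) 1 ≤ ∑ k ∈ s, min (a k) 1 := by
  by_cases h : ∃ k ∈ s, 1 ≤ a k
  · obtain ⟨k, hk, h1⟩ := h
    refine (min_le_right _ _).trans ?_
    calc 1 = min (a k) 1 := (min_eq_right h1).symm
      _ ≤ _ := Finset.single_le_sum (f := fun k => min (a k) 1)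
        (fun k _ => le_min (ha k) zero_le_one) hk
  · push Not at h
    refine (min_le_left _ _).trans (Finset.sum_le_sum fun k hk => ?_)
    rw [min_eq_left (h k hk).le]

lemma gridSum_le_sum_coord (f : ℝ≥0 → EuclideanSpace ℝ ι) (N j : ℕ) :
    gridSum f N j ≤ ∑ k, gridSum (fun t => f t k) N j := by
  simp only [gridSum]
  rw [Finset.sum_comm]
  refine Finset.sum_le_sum fun i _ => (norm_le_sum_abs _).trans_eq ?_
  simp

lemma gridSum_coord_le (f : ℝ≥0 → EuclideanSpace ℝ ι) (k : ι) (N j : ℕ) :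
    gridSum (fun t => f t k) N j ≤ gridSum f N j := by
  refine Finset.sum_le_sum fun i _ => ?_
  exact PiLp.norm_apply_le (f (dyadicPoint j (i + 1)) - f (dyadicPoint j i)) k

lemma IsLevyProcess.hasIndepIncrements_coord (hX : IsLevyProcess P X) (k : ι) :
    HasIndepIncrements (fun t ω => X t ω k) P := fun n t ht =>
  (hX.indep n t ht).comp (fun _ x => x k) (fun _ => by fun_prop)

lemma IsLevyProcess.identDistrib_coord (hX : IsLevyProcess P X) (k : ι) (s t : ℝ≥0) :
    IdentDistrib (fun ω => X (s + t) ω k - X s ω k) (fun ω => X t ω k) P P :=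
  (hX.stationary s t).comp (u := fun x : EuclideanSpace ℝ ι => x k) (by fun_prop)

lemma IsLevyProcess.measurable_coord (hX : IsLevyProcess P X) (k : ι) (t : ℝ≥0) :
    Measurable fun ω => X t ω k := by
  have := hX.measurable t
  fun_prop

/-- A Lévy process without Gaussian part and drift, and with summable jumps, has paths of locally
finite variation. -/
theorem IsLevy.hasFiniteVariationPaths [DecidableEq ι] [IsProbabilityMeasure P]
    (hL : IsLevy P X m Q υ)
    (hQ : ∀ a, quadForm Q a = 0) (hυ : Integrable (fun x => min ‖x‖ 1) υ)
    (hm : m = ∫ x in puncturedBall ι, x ∂υ) : HasFiniteVariationPaths P X := by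
  have := hL.levyMeasure.sFinite
  have hon := integrableOn_puncturedBall_of_integrable_min hυ
  have hcoord : ∀ k N, ∀ᵐ ω ∂P, BddAbove (range (gridSum (fun t => X t ω k) N)) := fun k N => by
    have hmk : Measurable fun x : EuclideanSpace ℝ ι => x k := by fun_prop
    -- The image of `υ` may charge the origin, even with infinite mass; all integrands involved
    -- vanish there, so the one-dimensional theorem does not ask for a Lévy measure.
    refine ae_bddAbove_gridSum (ν := υ.map fun x => x k) (X := fun t ω => X t ω k) ?_
      (hL.isLevyProcess.measurable_coord k) (hL.isLevyProcess.hasIndepIncrements_coord k)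
      (hL.isLevyProcess.identDistrib_coord k) (fun h s => ?_) N
    · rw [integrable_map_measure (by fun_prop) hmk.aemeasurable]
      refine Integrable.mono' hυ (by fun_prop) (ae_of_all _ fun x => ?_)
      simp only [Function.comp_apply]
      rw [Real.norm_eq_abs, abs_of_nonneg (by positivity)]
      have := PiLp.norm_apply_le x k
      rw [Real.norm_eq_abs] at this
      gcongr
    · rw [charFun_map_coord (hL.isLevyProcess.measurable h), hL.charFun_eq,
        integral_map hmk.aemeasurable (by fun_prop)]
      have h1 := levyExponent_of_integrable hL.levyMeasure hon 0 Q (EuclideanSpace.single k s)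
      rw [zero_add, ← hm, hQ, inner_zero_left] at h1
      rw [h1]
      simp [EuclideanSpace.inner_single_left]
  filter_upwards [hL.isLevyProcess.cadlag, ae_all_iff.2 fun k => ae_all_iff.2 (hcoord k)]
    with ω hω hb
  refine locallyBoundedVariationOn_of_gridSum (fun t => (hω t).1) fun N => ?_
  choose C hC using fun k => hb k N
  refine ⟨∑ k, C k, ?_⟩
  rintro _ ⟨j, rfl⟩
  exact (gridSum_le_sum_coord _ N j).trans (Finset.sum_le_sum fun k _ => hC k ⟨j, rfl⟩)

lemma re_levyIntegrand (θ x : EuclideanSpace ℝ ι) :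
    (levyIntegrand θ x).re = Real.cos (inner ℝ θ x) - 1 := by
  rw [levyIntegrand, Complex.sub_re, re_cexp_I_mul_sub_one]
  split_ifs <;> simp

lemma neg_re_levyExponent (hυ : IsLevyMeasure υ) (θ : EuclideanSpace ℝ ι) :
    -(levyExponent m Q υ θ).re =
      1 / 2 * quadForm Q θ + ∫ x, (1 - Real.cos (inner ℝ θ x)) ∂υ := by
  have h1 : (∫ x, levyIntegrand θ x ∂υ).re = ∫ x, (levyIntegrand θ x).re ∂υ :=
    (integral_re (hυ.integrable_levyIntegrand θ)).symm
  have h2 : ∫ x, (1 - Real.cos (inner ℝ θ x)) ∂υ = -∫ x, (levyIntegrand θ x).re ∂υ := by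
    rw [← integral_neg]
    simp_rw [re_levyIntegrand, neg_sub]
  rw [h2, ← h1, levyExponent_eq]
  simp [add_comm]

lemma IsLevyMeasure.integrable_one_sub_cos (hυ : IsLevyMeasure υ) (θ : EuclideanSpace ℝ ι) :
    Integrable (fun x => 1 - Real.cos (inner ℝ θ x)) υ := by
  refine (hυ.integrable_levyIntegrand θ).re.neg.congr (ae_of_all _ fun x => ?_)
  simp [re_levyIntegrand]

/-- A Lévy process with paths of locally finite variation has no Gaussian part and has summable
jumps. -/
theorem IsLevy.of_hasFiniteVariationPaths [DecidableEq ι] [IsProbabilityMeasure P]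
    (hL : IsLevy P X m Q υ) (hfv : HasFiniteVariationPaths P X) :
    (∀ k, Q k k = 0) ∧ Integrable (fun x => min ‖x‖ 1) υ := by
  have := hL.levyMeasure.sFinite
  have hcos : ∀ θ, 0 ≤ ∫ x, (1 - Real.cos (inner ℝ θ x)) ∂υ := fun θ =>
    integral_nonneg fun x => one_sub_cos_nonneg _
  have hfin : ∀ k, ∫⁻ s, ENNReal.ofReal (1 / 2 * (Q k k * s ^ 2) +
      ∫ x, (1 - Real.cos (inner ℝ (EuclideanSpace.single k s) x)) ∂υ) ∂(cauchyMeasure 0 1) < ∞ := by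
    intro k
    have h := lintegral_re_exponent_lt_top (X := fun t ω => X t ω k)
      (hL.isLevyProcess.measurable_coord k) (hL.isLevyProcess.hasIndepIncrements_coord k)
      (hL.isLevyProcess.identDistrib_coord k)
      (ψ := fun s => levyExponent m Q υ (EuclideanSpace.single k s)) ?_ fun h s => ?_
    · simpa only [neg_re_levyExponent hL.levyMeasure, quadForm_single] using h
    · filter_upwards [hfv] with ω hω
      obtain ⟨C, hC⟩ := bddAbove_gridSum hω 1
      refine ⟨C, ?_⟩
      rintro _ ⟨j, rfl⟩
      exact (gridSum_coord_le (fun t => X t ω) k 1 j).trans (hC ⟨j, rfl⟩)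
    · rw [charFun_map_coord (hL.isLevyProcess.measurable h), hL.charFun_eq]
  constructor
  · intro k
    by_contra hne
    have hpos : 0 < Q k k := lt_of_le_of_ne (posSemidef_diag_nonneg hL.covariance k) (Ne.symm hne)
    refine absurd (hfin k) (not_lt.2 ?_)
    -- A positive variance puts a multiple of `s²` below `-Re ψ(s)`, and `s²` has infinite Cauchy
    -- integral.
    calc ∞ = ENNReal.ofReal (1 / 2 * Q k k) *
          ∫⁻ s, ENNReal.ofReal (s ^ 2) ∂(cauchyMeasure 0 1) := by
          rw [lintegral_sq_cauchyMeasure, ENNReal.mul_top (ENNReal.ofReal_pos.2 (by positivity)).ne']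
      _ = ∫⁻ s, ENNReal.ofReal (1 / 2 * Q k k) * ENNReal.ofReal (s ^ 2) ∂(cauchyMeasure 0 1) :=
          (lintegral_const_mul' _ _ ENNReal.ofReal_ne_top).symm
      _ ≤ _ := lintegral_mono fun s => by
          rw [← ENNReal.ofReal_mul (by positivity)]
          refine ENNReal.ofReal_le_ofReal ?_
          linarith [hcos (EuclideanSpace.single k s)]
  · have hk : ∀ k, Integrable (fun x : EuclideanSpace ℝ ι => min |x k| 1) υ := fun k => by
      have hmk : Measurable fun x : EuclideanSpace ℝ ι => x k := by fun_prop
      -- By Tonelli this is the Cauchy average of the jump part of `-Re ψ`, and `1 - e^{-|y|}` is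
      -- comparable to `|y| ∧ 1`.
      have h1 : ∫⁻ x, ENNReal.ofReal (1 - Real.exp (-|x k|)) ∂υ < ∞ := by
        have h2 := lintegral_lintegral_one_sub_cos (υ.map fun x => x k) zero_le_one
        rw [lintegral_map (by fun_prop) hmk] at h2
        simp only [one_mul] at h2
        rw [← h2]
        refine lt_of_le_of_lt (lintegral_mono fun s => ?_) (hfin k)
        rw [lintegral_map (by fun_prop) hmk]
        have h3 := ofReal_integral_eq_lintegral_ofReal
          (hL.levyMeasure.integrable_one_sub_cos (EuclideanSpace.single k s))
          (ae_of_all _ fun x => one_sub_cos_nonneg _)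
        have h4 := posSemidef_diag_nonneg hL.covariance k
        simp only [EuclideanSpace.inner_single_left] at h3
        simp only [EuclideanSpace.inner_single_left]
        simp only [conj_trivial] at h3 ⊢
        rw [← h3]
        exact ENNReal.ofReal_le_ofReal (le_add_of_nonneg_left (by positivity))
      have h5 : Integrable (fun x : EuclideanSpace ℝ ι => 1 - Real.exp (-|x k|)) υ :=
        ⟨by fun_prop, (hasFiniteIntegral_iff_ofReal
          (ae_of_all _ fun x => one_sub_exp_neg_nonneg (abs_nonneg _))).2 h1⟩
      refine Integrable.mono' (h5.const_mul 2) (by fun_prop) (ae_of_all _ fun x => ?_)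
      rw [Real.norm_eq_abs, abs_of_nonneg (by positivity)]
      exact min_one_le_two_mul_one_sub_exp (abs_nonneg _)
    refine Integrable.mono' (integrable_finsetSum Finset.univ fun k _ => hk k) (by fun_prop)
      (ae_of_all _ fun x => ?_)
    rw [Real.norm_eq_abs, abs_of_nonneg (by positivity)]
    exact (min_le_min_right 1 (norm_le_sum_abs x)).trans
      (min_sum_one_le _ fun k => abs_nonneg _)

end CoordinateProcesses

/-! ### Vanishing of the drift -/

section FiniteVariation

variable {ι : Type*} [Fintype ι]

lemma IsLevyMeasure.integrable_min_norm {υ : Measure (EuclideanSpace ℝ ι)} (hυ : IsLevyMeasure υ)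
    (h : SmallJumpsFinite υ 1) : Integrable (fun x => min ‖x‖ 1) υ := by
  refine ⟨by fun_prop, (hasFiniteIntegral_iff_ofReal (ae_of_all _ fun x => by positivity)).2 ?_⟩
  rw [SmallJumpsFinite, ← lintegral_indicator measurableSet_puncturedBall] at h
  refine lt_of_le_of_lt (lintegral_mono (g := fun x =>
    (puncturedBall ι).indicator (fun x => ENNReal.ofReal (‖x‖ ^ (1 : ℝ))) x +
      ENNReal.ofReal (min (‖x‖ ^ 2) 1)) fun x => ?_) ?_
  · simp only
    by_cases hx : x ∈ puncturedBall ι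
    · rw [indicator_of_mem hx, Real.rpow_one]
      exact le_add_right (ENNReal.ofReal_le_ofReal (min_le_left _ _))
    · refine le_add_left (ENNReal.ofReal_le_ofReal ?_)
      rcases eq_or_ne x 0 with rfl | h0
      · simp
      · have : 1 < ‖x‖ := by
          by_contra! h1
          exact hx ⟨by simpa using h1, h0⟩
        rw [min_eq_right (b := (1 : ℝ)) this.le, min_eq_right (by nlinarith)]
  · rw [lintegral_add_right _ (by fun_prop)]
    exact ENNReal.add_lt_top.2 ⟨h, hυ.2⟩

lemma smallJumpsFinite_one_of_integrable {υ : Measure (EuclideanSpace ℝ ι)}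
    (h : Integrable (fun x => min ‖x‖ 1) υ) : SmallJumpsFinite υ 1 := by
  have h1 := (integrableOn_puncturedBall_of_integrable_min h).2
  simpa [SmallJumpsFinite, HasFiniteIntegral, ← ofReal_norm] using h1

variable {Ω : Type*} [MeasurableSpace Ω] {P : Measure Ω}
  {B : ℝ≥0 → Ω → EuclideanSpace ℝ ι} {μ : EuclideanSpace ℝ ι}
  {U : Measure (EuclideanSpace ℝ ι)} {ζ : Measure (EuclideanSpace ℝ (ι ⊕ ι))}

/-- The location parameter of a driftless Gaussian mixture with summable jumps. -/
lemma weakMean₂_add_integral_truncationGap [IsProbabilityMeasure P] (hB : IsLevyProcess P B)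
    (hU : IsThorinMeasure U) (hζ₀ : IsLevyMeasure ζ)
    (hζ : ∀ A, MeasurableSet A → ζ A = ∫⁻ t in puncturedOrthant ι,
        P {ω | pair t (multiTime B t ω) ∈ A} ∂(thorinLevyMeasure U))
    (hint : Integrable (fun x => min ‖x‖ 1) (lastBlockLevyMeasure ζ)) :
    weakMean₂ P B μ 0 (thorinLevyMeasure U) + ∫ x in truncationGap ι, lastBlock x ∂ζ =
      ∫ y in puncturedBall ι, y ∂(lastBlockLevyMeasure ζ) := by
  have := (isLevyMeasure_thorinLevyMeasure hU).sFinite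
  have hball : MeasurableSet {x : EuclideanSpace ℝ (ι ⊕ ι) | ‖x‖ ≤ 1} :=
    measurableSet_le measurable_norm measurable_const
  have hmin : Integrable (fun x => min ‖lastBlock x‖ 1) ζ := by
    refine ⟨by fun_prop, (hasFiniteIntegral_iff_ofReal (ae_of_all _ fun x => by positivity)).2 ?_⟩
    rw [← lintegral_lastBlockLevyMeasure ζ (f := fun y => ENNReal.ofReal (min ‖y‖ 1))
      (by fun_prop) (by simp)]
    exact (hasFiniteIntegral_iff_ofReal (ae_of_all _ fun x => by positivity)).1 hint.2
  have hf : Integrable ({x : EuclideanSpace ℝ (ι ⊕ ι) | ‖x‖ ≤ 1}.indicator lastBlock) ζ := by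
    rw [integrable_indicator_iff hball]
    refine Integrable.mono' hmin.integrableOn measurable_lastBlock.aestronglyMeasurable ?_
    refine (ae_restrict_iff' hball).2 (ae_of_all _ fun x hx => ?_)
    rw [min_eq_left ((norm_lastBlock_le x).trans hx)]
  have hgap : Integrable ((truncationGap ι).indicator lastBlock) ζ :=
    (integrable_indicator_iff measurableSet_truncationGap).2 hζ₀.integrableOn_truncationGap
  have h1 : weakMean₂ P B μ 0 (thorinLevyMeasure U) =
      ∫ x, {x : EuclideanSpace ℝ (ι ⊕ ι) | ‖x‖ ≤ 1}.indicator lastBlock x ∂ζ := by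
    have h0 : diamondVec (0 : EuclideanSpace ℝ ι) μ = 0 := by
      ext i; simp [diamondVec]
    rw [weakMean₂, h0, zero_add, hB.integral_mixture hζ hf]
    refine integral_congr_ae (ae_of_all _ fun t => ?_)
    have hm : MeasurableSet {ω | ‖pair t (multiTime B t ω)‖ ≤ 1} :=
      measurableSet_le (measurable_pair.comp
        (measurable_const.prodMk (hB.measurable_multiTime t))).norm measurable_const
    simp only
    rw [← integral_indicator hm]
    rfl
  have h2 : ∫ y in puncturedBall ι, y ∂(lastBlockLevyMeasure ζ) =
      ∫ x, (puncturedBall ι).indicator (fun y => y) (lastBlock x) ∂ζ := by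
    rw [← integral_indicator measurableSet_puncturedBall]
    exact integral_lastBlockLevyMeasure ζ
      ((measurable_id.indicator measurableSet_puncturedBall).stronglyMeasurable) (by simp)
  -- The unit ball of the doubled space and the gap are disjoint, with union `‖lastBlock x‖ ≤ 1`.
  -- The two means thus add up to the full compensator of the last block.
  rw [h1, h2, ← integral_indicator measurableSet_truncationGap, ← integral_add hf hgap]
  refine integral_congr_ae (ae_of_all _ fun x => ?_)
  classical
  have hle := norm_lastBlock_le x
  simp only [indicator_apply, truncationGap, puncturedBall, Set.mem_sdiff,
    mem_closedBall_zero_iff, mem_singleton_iff, mem_ofPred_eq]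
  by_cases hx : ‖x‖ ≤ 1
  · by_cases h0 : lastBlock x = 0
    · simp [h0]
    · simp [hx, hle.trans hx, h0]
  · by_cases h0 : lastBlock x = 0
    · simp [h0]
    · simp [hx, not_le.1 hx, h0]

end FiniteVariation

end WeakSub

end

/-! ### Assembly of the three parts -/

theorem proposition4p2 {n : ℕ}
    {ΩT : Type*} [MeasurableSpace ΩT] (PT : Measure ΩT) [IsProbabilityMeasure PT]
    {ΩY : Type*} [MeasurableSpace ΩY] (PY : Measure ΩY) [IsProbabilityMeasure PY]
    (T : ℝ≥0 → ΩT → EuclideanSpace ℝ (Fin n)) (Y : ℝ≥0 → ΩY → EuclideanSpace ℝ (Fin n))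
    (d μ : EuclideanSpace ℝ (Fin n)) (S : Matrix (Fin n) (Fin n) ℝ)
    (U τ υ : Measure (EuclideanSpace ℝ (Fin n)))
    (hT : WeakSub.IsThorinSubordinator PT T d U)
    (hY : WeakSub.IsVGG.{w} PY Y d μ S U)
    (hτ : WeakSub.HasLevyMeasure PT T τ)
    (hυ : WeakSub.HasLevyMeasure PY Y υ) :
    (∀ q : ℝ, 0 < q → q < 1 →
      (WeakSub.ThorinTailFinite U q ↔ WeakSub.SmallJumpsFinite τ q)) ∧
    (∀ q : ℝ, 0 < q → q < 1 →
      (WeakSub.ThorinTailFinite U q → WeakSub.SmallJumpsFinite υ (2 * q)) ∧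
      (IsUnit S → WeakSub.SmallJumpsFinite υ (2 * q) → WeakSub.ThorinTailFinite U q)) ∧
    ((d = 0 → WeakSub.ThorinTailFinite U (1 / 2) → WeakSub.IsFV PY Y 0 υ) ∧
      (IsUnit S → WeakSub.HasFiniteVariationPaths PY Y →
        d = 0 ∧ WeakSub.ThorinTailFinite U (1 / 2))) := by
  obtain ⟨mT, QT, hLT⟩ := hτ
  obtain ⟨m, Q, hL⟩ := hυ
  obtain ⟨ΩB, iB, PB, B, ζ, hPB, hB, hU, hd, hζ, hζ₀, rfl, hQ, hm⟩ := hY.exists_mixture hL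
  have hdiag := fun hS k => WeakSub.posSemidef_diag_pos hB.covariance hS k
  refine ⟨fun q hq0 hq1 => ?_, fun q hq0 hq1 => ⟨?_, fun hS => ?_⟩, fun h0 hfin => ?_,
    fun hS hfv => ?_⟩
  · rw [(hT.triplet hLT).1]
    exact WeakSub.thorinTailFinite_iff hU hq0 hq1.le
  · exact WeakSub.smallJumpsFinite_lastBlock hB hU hζ hq0 hq1.le
  · exact WeakSub.thorinTailFinite_of_smallJumpsFinite_lastBlock hB (hdiag hS) hU hζ hq0 hq1.le
  · subst h0
    -- At `q = 1/2` the exponent `2q` is `1`, that is, summability of the small jumps.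
    have hsmall := WeakSub.smallJumpsFinite_lastBlock hB hU hζ one_half_pos one_half_lt_one.le hfin
    rw [mul_one_div_cancel two_ne_zero] at hsmall
    have hint := hL.levyMeasure.integrable_min_norm hsmall
    rw [WeakSub.weakMean₂_add_integral_truncationGap hB.isLevyProcess hU hζ₀ hζ hint] at hm
    have hQ0 : ∀ a, WeakSub.quadForm Q a = 0 := fun a => by
      rw [hQ]; simp [WeakSub.quadForm, WeakSub.diamondMat]
    exact ⟨hL.hasFiniteVariationPaths hQ0 hint hm, m, Q, hL,
      WeakSub.integrableOn_puncturedBall_of_integrable_min hint, by rw [hm, sub_self]⟩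
  · obtain ⟨hQ0, hint⟩ := hL.of_hasFiniteVariationPaths hfv
    refine ⟨?_, WeakSub.thorinTailFinite_of_smallJumpsFinite_lastBlock hB (hdiag hS) hU hζ
      one_half_pos one_half_lt_one.le ?_⟩
    · ext k
      -- Evaluated at the `k`-th basis vector, the vanishing Gaussian form of `Y` reads `Σ_kk d_k =
      -- 0`, with `Σ_kk > 0`.
      have h := hQ (EuclideanSpace.single k 1)
      rw [WeakSub.quadForm_single, WeakSub.quadForm_single, hQ0 k] at h
      simpa [WeakSub.diamondMat, (hdiag hS k).ne'] using h
    · rw [mul_one_div_cancel two_ne_zero]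
      exact WeakSub.smallJumpsFinite_one_of_integrable hint
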